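/- Let $E=(E^0,E^1,r,s)$ be a finite directed multigraph without sinks and without sources in which every cycle has an exit (a cycle is a path of non-zero length with equal source and range; it has an exit if the source of one of its edges emits at least two distinct edges). Paths are $\mu=\mu_1\cdots\mu_k$ with $r(\mu_j)=s(\mu_{j+1})$, vertices are paths of length $0$, and $E^*$ is the set of all finite paths. Let $L_{\mathbb Z}(E)$ be the Leavitt path algebra of $E$ over $\mathbb Z$, with generators $P_v$ ($v\in E^0$), $S_e,S_e^*$ ($e\in E^1$) and its standard involution, and let $C^*(E)$ be the graph $C^*$-algebra: the universal $C^*$-algebra generated by mutually orthogonal projections $p_v$ and elements $s_e$ with $s_e^*s_e=p_{r(e)}$ and $p_v=\sum_{s(e)=v}s_es_e^*$. Generators are mapped to generators under $L_{\mathbb Z}(E)\to C^*(E)$. Put $S_\mu=S_{\mu_1}\cdots S_{\mu_k}$, $S_v=P_v$, and likewise $s_\mu$. The diagonal $\mathcal D_{L_{\mathbb Z}(E)}$ is the subalgebra generated by all $S_\mu S_\mu^*$, $\mu\in E^*$, and $\mathcal D_{C^*(E)}$ is the $C^*$-subalgebra generated by all $s_\mu s_\mu^*$. Let $\mathcal J\subseteq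 E^*\times E^*$ be a finite set such that $s(\mu)=s(\nu)$, $r(\mu)=r(\nu)$ and $|\nu|\ge 1$ for all $(\mu,\nu)\in\mathcal J$, and such that $u_{\mathcal J}=\sum_{(\mu,\nu)\in\mathcal J}S_\mu S_\nu^*$ is a unitary in $L_{\mathbb Z}(E)$. Let $\Lambda_{\mathcal J}$ and $\lambda_{\mathcal J}$ be the unital $*$-endomorphisms of $L_{\mathbb Z}(E)$ and of $C^*(E)$ with $\Lambda_{\mathcal J}(P_v)=P_v$, $\Lambda_{\mathcal J}(S_e)=u_{\mathcal J}S_e$ and $\lambda_{\mathcal J}(p_v)=p_v$, $\lambda_{\mathcal J}(s_e)=u_{\mathcal J}s_e$. Write the elements of $\mathcal J$ as $(\mu,e\nu)$ with $e\in E^1$ and $\nu\in E^*$ (where $\nu=r(e)$ if $e\nu$ has length $1$). The coding graph $E_{\mathcal J}$ has vertex set $\mathcal J$ and exactly one edge from $(\mu_1,e_1\nu_1)$ to $(\mu_2,e_2\nu_2)$ whenever $S_{\nu_1}^*S_{\mu_2}\ne0$ in $L_{\mathbb Z}(E)$. The degree of such an edge is $|\alpha|$ if $S_{\nu_1}^*S_{\mu_2}=S_\alpha$,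 it is $0$ if $S_{\nu_1}^*S_{\mu_2}\in\operatorname{span}\{P_v\mid v\in E^0\}$, and it is $-|\alpha|$ if $S_{\nu_1}^*S_{\mu_2}=S_\alpha^*$, with $\alpha\in E^*$. An edge is non-negative if its degree is $\ge0$, and a cycle in $E_{\mathcal J}$ is non-positive if all of its edges have degree $\le0$. For a path $\omega$ in $E_{\mathcal J}$ visiting the vertices $(\mu_1,e_1\nu_1),\dots,(\mu_k,e_k\nu_k)$ in this order put $\mathcal E(\omega)=e_1\cdots e_k$. The labeled graph $(E_{\mathcal J},\mathcal E)$ is left-synchronizing if there is an $m\in\mathbb N$ such that any two paths $\omega_1,\omega_2$ of length $m$ in $E_{\mathcal J}$ with $\mathcal E(\omega_1)=\mathcal E(\omega_2)$ have the same source. Then the following hold. 1. If $E_{\mathcal J}$ contains a non-positive cycle, then $\Lambda_{\mathcal J}$ does not restrict to an automorphism of $\mathcal D_{L_{\mathbb Z}(E)}$. 2. If $E_{\mathcal J}$ has only non-negative edges and contains no non-positive cycle, then $(E_{\mathcal J},\mathcal E)$ is left-synchronizing if and only if $\Lambda_{\mathcal J}$ restricts to an automorphism of $\mathcal D_{L_{\mathbb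 Z}(E)}$. 3. If $E_{\mathcal J}$ contains a non-positive cycle, then $\lambda_{\mathcal J}$ does not restrict to an automorphism of $\mathcal D_{C^*(E)}$. 4. If $E_{\mathcal J}$ has only non-negative edges and contains no non-positive cycle, then $(E_{\mathcal J},\mathcal E)$ is left-synchronizing if and only if $\lambda_{\mathcal J}$ restricts to an automorphism of $\mathcal D_{C^*(E)}$. -/

import Mathlib

/-! ### Directed multigraphs and paths -/

/-- A directed (multi)graph with vertex type `V` and edge type `A`. -/
structure DirectedGraph (V : Type*) (A : Type*) where
  src : A → V
  rng : A → V

namespace DirectedGraph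

section Paths

variable {V A : Type*} (E : DirectedGraph V A)

/-- `E.IsWalk v l`: the edges in `l` can be traversed consecutively, starting from `v`. -/
def IsWalk (E : DirectedGraph V A) : V → List A → Prop
  | _, [] => True
  | v, e :: l => E.src e = v ∧ IsWalk E (E.rng e) l

/-- The vertex reached from `v` after traversing the edges in `l`. -/
def walkEnd (E : DirectedGraph V A) : V → List A → V
  | v, [] => v
  | _, e :: l => walkEnd E (E.rng e) l

/-- Finite paths `μ = μ₁ ⋯ μₖ`, `r(μⱼ) = s(μⱼ₊₁)`. A path with no edges is a vertex. -/
@[ext]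
structure FinPath where
  source : V
  edges : List A
  isWalk : E.IsWalk source edges

namespace FinPath

variable {E}

/-- The range of a path. -/
def range (μ : E.FinPath) : V := E.walkEnd μ.source μ.edges

/-- The number of edges of a path. -/
def length (μ : E.FinPath) : ℕ := μ.edges.length

/-- A cycle is a path of non-zero length with equal source and range. -/
def IsCycle (μ : E.FinPath) : Prop := 0 < μ.length ∧ μ.range = μ.source

/-- A cycle has an exit if the source of one of its edges emits two distinct edges. -/
def HasExit (μ : E.FinPath) : Prop :=
  ∃ e ∈ μ.edges, ∃ f g : A, f ≠ g ∧ E.src f = E.src e ∧ E.src g = E.src e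

theorem edges_ne_nil {μ : E.FinPath} (h : 0 < μ.length) : μ.edges ≠ [] :=
  List.ne_nil_of_length_pos h

/-- The first edge `e` of a path `e κ` of positive length. -/
def firstEdge (μ : E.FinPath) (h : 0 < μ.length) : A := μ.edges.head (edges_ne_nil h)

/-- The path `κ` such that `μ = e κ`, where `e` is the first edge of `μ`. If `μ` has length `1`,
this is the path of length `0` at the vertex `r(e)`. -/
def tail (μ : E.FinPath) (h : 0 < μ.length) : E.FinPath where
  source := E.rng (μ.firstEdge h)
  edges := μ.edges.tail
  isWalk := by
    obtain ⟨v, l, hl⟩ := μ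
    cases l with
    | nil => exact absurd h (lt_irrefl 0)
    | cons e l => exact hl.2

end FinPath

/-- No sinks, no sources, and every cycle has an exit. -/
structure IsAdmissible : Prop where
  no_sinks : ∀ v, ∃ e, E.src e = v
  no_sources : ∀ v, ∃ e, E.rng e = v
  exits : ∀ μ : E.FinPath, μ.IsCycle → μ.HasExit

open Classical in
/-- The edges emitted by a vertex. -/
noncomputable def outEdges [Fintype A] (v : V) : Finset A :=
  Finset.univ.filter (fun e => E.src e = v)

theorem mem_outEdges [Fintype A] (e : A) : e ∈ E.outEdges (E.src e) := by simp [outEdges]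

/-- The element `S_μ = S_{μ₁} ⋯ S_{μₖ}` determined by elements `P_v`, `S_e`, with `S_v = P_v`.
(The leading factor `P_{s(μ)}` is absorbed by `S_{μ₁}` as soon as `μ` has positive length.) -/
def pathElement {B : Type*} [Monoid B] (P : V → B) (S : A → B) (μ : E.FinPath) : B :=
  P μ.source * (μ.edges.map S).prod

end Paths

/-! ### Leavitt path algebras -/

/-- The generators `P_v`, `S_e`, `S_e^*` of a Leavitt path algebra. -/
inductive LeavittGen (V A : Type*)
  | vertex (v : V) : LeavittGen V A
  | edge (e : A) : LeavittGen V A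
  | ghost (e : A) : LeavittGen V A

section Leavitt

open LeavittGen
open FreeAlgebra (ι)

variable {V A : Type*} [Fintype V] [Fintype A] (R : Type*) [CommRing R] (E : DirectedGraph V A)

/-- The defining relations of the Leavitt path algebra; the last one says that the unit of the
(unital, since `V` is finite) algebra is the sum of the vertex idempotents. -/
inductive LeavittRel :
    FreeAlgebra R (LeavittGen V A) → FreeAlgebra R (LeavittGen V A) → Prop
  | idem (v : V) : LeavittRel (ι R (vertex v) * ι R (vertex v)) (ι R (vertex v))
  | orth (v w : V) : v ≠ w → LeavittRel (ι R (vertex v) * ι R (vertex w)) 0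
  | ghost_edge (e f : A) : e ≠ f → LeavittRel (ι R (ghost e) * ι R (edge f)) 0
  | ghost_edge_self (e : A) : LeavittRel (ι R (ghost e) * ι R (edge e)) (ι R (vertex (E.rng e)))
  | src_edge (e : A) : LeavittRel (ι R (vertex (E.src e)) * ι R (edge e)) (ι R (edge e))
  | edge_rng (e : A) : LeavittRel (ι R (edge e) * ι R (vertex (E.rng e))) (ι R (edge e))
  | ghost_src (e : A) : LeavittRel (ι R (ghost e) * ι R (vertex (E.src e))) (ι R (ghost e))
  | rng_ghost (e : A) : LeavittRel (ι R (vertex (E.rng e)) * ι R (ghost e)) (ι R (ghost e))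
  | vertex_sum (v : V) : (E.outEdges v).Nonempty →
      LeavittRel (ι R (vertex v)) (∑ e ∈ E.outEdges v, ι R (edge e) * ι R (ghost e))
  | unit : LeavittRel 1 (∑ v, ι R (vertex v))

/-- The Leavitt path algebra `L_R(E)`. -/
def Leavitt : Type _ := RingQuot (LeavittRel R E)

namespace Leavitt

noncomputable instance : Ring (Leavitt R E) := inferInstanceAs (Ring (RingQuot (LeavittRel R E)))

noncomputable instance : Algebra R (Leavitt R E) :=
  inferInstanceAs (Algebra R (RingQuot (LeavittRel R E)))

/-- The quotient map from the free algebra. -/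
noncomputable def mk : FreeAlgebra R (LeavittGen V A) →ₐ[R] Leavitt R E :=
  RingQuot.mkAlgHom R (LeavittRel R E)

/-- The vertex idempotents `P_v`. -/
noncomputable def P (v : V) : Leavitt R E := mk R E (ι R (vertex v))

/-- The generators `S_e`. -/
noncomputable def S (e : A) : Leavitt R E := mk R E (ι R (edge e))

/-- The generators `S_e^*`. -/
noncomputable def Sghost (e : A) : Leavitt R E := mk R E (ι R (ghost e))

variable {R E}

theorem mk_rel {x y : FreeAlgebra R (LeavittGen V A)} (h : LeavittRel R E x y) :
    mk R E x = mk R E y := RingQuot.mkAlgHom_rel R h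

theorem induction {motive : Leavitt R E → Prop}
    (scalar : ∀ r, motive (algebraMap R _ r)) (hP : ∀ v, motive (P R E v))
    (hS : ∀ e, motive (S R E e)) (hG : ∀ e, motive (Sghost R E e))
    (mul : ∀ a b, motive a → motive b → motive (a * b))
    (add : ∀ a b, motive a → motive b → motive (a + b)) (a : Leavitt R E) : motive a := by
  obtain ⟨x, rfl⟩ : ∃ x, mk R E x = a := RingQuot.mkAlgHom_surjective R (LeavittRel R E) a
  induction x using FreeAlgebra.induction with
  | grade0 r => simpa using scalar r
  | grade1 g =>
    cases g with
    | vertex v => exact hP v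
    | edge e => exact hS e
    | ghost e => exact hG e
  | mul x y hx hy => rw [map_mul]; exact mul _ _ hx hy
  | add x y hx hy => rw [map_add]; exact add _ _ hx hy

variable (E)

theorem P_idem (v : V) : P R E v * P R E v = P R E v := by
  simpa [P] using mk_rel (LeavittRel.idem (R := R) (E := E) v)

theorem P_orth {v w : V} (h : v ≠ w) : P R E v * P R E w = 0 := by
  simpa [P] using mk_rel (LeavittRel.orth (R := R) (E := E) v w h)

theorem ghost_S {e f : A} (h : e ≠ f) : Sghost R E e * S R E f = 0 := by
  simpa [S, Sghost] using mk_rel (LeavittRel.ghost_edge (R := R) (E := E) e f h)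

theorem ghost_S_self (e : A) : Sghost R E e * S R E e = P R E (E.rng e) := by
  simpa [P, S, Sghost] using mk_rel (LeavittRel.ghost_edge_self (R := R) (E := E) e)

theorem P_S (e : A) : P R E (E.src e) * S R E e = S R E e := by
  simpa [P, S] using mk_rel (LeavittRel.src_edge (R := R) (E := E) e)

theorem S_P (e : A) : S R E e * P R E (E.rng e) = S R E e := by
  simpa [P, S] using mk_rel (LeavittRel.edge_rng (R := R) (E := E) e)

theorem ghost_P (e : A) : Sghost R E e * P R E (E.src e) = Sghost R E e := by
  simpa [P, Sghost] using mk_rel (LeavittRel.ghost_src (R := R) (E := E) e)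

theorem P_ghost (e : A) : P R E (E.rng e) * Sghost R E e = Sghost R E e := by
  simpa [P, Sghost] using mk_rel (LeavittRel.rng_ghost (R := R) (E := E) e)

theorem P_eq_sum {v : V} (h : (E.outEdges v).Nonempty) :
    P R E v = ∑ e ∈ E.outEdges v, S R E e * Sghost R E e := by
  simpa [P, S, Sghost] using mk_rel (LeavittRel.vertex_sum (R := R) (E := E) v h)

theorem sum_P : ∑ v, P R E v = 1 := by
  simpa [P] using (mk_rel (LeavittRel.unit (R := R) (E := E))).symm

/-! #### The involution, with `(r S_e)^* = r^* S_e^*` -/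

section Star

variable (R) [StarRing R]

/-- The images of the generators under the involution. -/
noncomputable def starGen : LeavittGen V A → (Leavitt R E)ᵐᵒᵖ
  | vertex v => .op (P R E v)
  | edge e => .op (Sghost R E e)
  | ghost e => .op (S R E e)

theorem star_commute (r : R) (w : FreeMonoid (LeavittGen V A)) :
    Commute (((algebraMap R (Leavitt R E)ᵐᵒᵖ).comp (starRingEnd R)) r)
      (FreeMonoid.lift (starGen R E) w) :=
  Algebra.commutes (star r) _

/-- The involution, as a conjugate linear ring homomorphism from the free algebra to the opposite
of the Leavitt path algebra. -/
noncomputable def starFree : FreeAlgebra R (LeavittGen V A) →+* (Leavitt R E)ᵐᵒᵖ :=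
  (MonoidAlgebra.liftNCRingHom _ _ (star_commute R E)).comp
    (FreeAlgebra.equivMonoidAlgebraFreeMonoid (R := R) (X := LeavittGen V A) :
      FreeAlgebra R (LeavittGen V A) →+* MonoidAlgebra R (FreeMonoid (LeavittGen V A)))

theorem starFree_ι (g : LeavittGen V A) : starFree R E (ι R g) = starGen R E g := by
  have h : (FreeAlgebra.equivMonoidAlgebraFreeMonoid (R := R)) (ι R g) =
      MonoidAlgebra.single (FreeMonoid.of g) 1 := by
    simp [FreeAlgebra.equivMonoidAlgebraFreeMonoid]
  change MonoidAlgebra.liftNCRingHom _ _ (star_commute R E)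
    ((FreeAlgebra.equivMonoidAlgebraFreeMonoid (R := R)) (ι R g)) = _
  rw [h]
  refine (MonoidAlgebra.liftNCRingHom_single _ _ (star_commute R E) _ _).trans ?_
  rw [map_one, one_mul, FreeMonoid.lift_eval_of]

theorem starFree_algebraMap (r : R) :
    starFree R E (algebraMap R _ r) = algebraMap R _ (star r) := by
  have h : (FreeAlgebra.equivMonoidAlgebraFreeMonoid (R := R) (X := LeavittGen V A))
      (algebraMap R _ r) = MonoidAlgebra.single 1 r := by
    simp [MonoidAlgebra.coe_algebraMap]
  change MonoidAlgebra.liftNCRingHom _ _ (star_commute R E)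
    ((FreeAlgebra.equivMonoidAlgebraFreeMonoid (R := R)) (algebraMap R _ r)) = _
  rw [h]
  refine (MonoidAlgebra.liftNCRingHom_single _ _ (star_commute R E) _ _).trans ?_
  rw [map_one, mul_one]; rfl

theorem starFree_rel ⦃x y : FreeAlgebra R (LeavittGen V A)⦄ (h : LeavittRel R E x y) :
    starFree R E x = starFree R E y := by
  induction h <;> simp only [map_mul, map_sum, map_zero, map_one, starFree_ι, starGen,
    ← MulOpposite.op_mul, ← MulOpposite.op_zero, ← MulOpposite.op_one, ← Finset.op_sum,
    MulOpposite.op_inj]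
  case idem v => exact P_idem E v
  case orth v w h => exact P_orth E h.symm
  case ghost_edge e f h => exact ghost_S E h.symm
  case ghost_edge_self e => exact ghost_S_self E e
  case src_edge e => exact ghost_P E e
  case edge_rng e => exact P_ghost E e
  case ghost_src e => exact P_S E e
  case rng_ghost e => exact S_P E e
  case vertex_sum v h => exact P_eq_sum E h
  case unit => exact (sum_P E).symm

/-- The involution, as a ring homomorphism to the opposite ring. -/
noncomputable def starHom : Leavitt R E →+* (Leavitt R E)ᵐᵒᵖ :=
  RingQuot.lift ⟨starFree R E, starFree_rel R E⟩

theorem starHom_mk (x : FreeAlgebra R (LeavittGen V A)) :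
    starHom R E (mk R E x) = starFree R E x := by
  rw [starHom, mk, RingQuot.mkAlgHom_def]
  exact RingQuot.lift_mkRingHom_apply _ _ _

variable {R E}

noncomputable instance : Star (Leavitt R E) := ⟨fun x => (starHom R E x).unop⟩

theorem star_def (x : Leavitt R E) : star x = (starHom R E x).unop := rfl

@[simp] theorem star_P (v : V) : star (P R E v) = P R E v := by
  simp [star_def, P, starHom_mk, starFree_ι, starGen]

@[simp] theorem star_S (e : A) : star (S R E e) = Sghost R E e := by
  simp [star_def, S, starHom_mk, starFree_ι, starGen]

@[simp] theorem star_ghost (e : A) : star (Sghost R E e) = S R E e := by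
  simp [star_def, Sghost, starHom_mk, starFree_ι, starGen]

theorem star_scalar (r : R) :
    star (algebraMap R (Leavitt R E) r) = algebraMap R _ (star r) := by
  rw [star_def, ← (mk R E).commutes, starHom_mk, starFree_algebraMap]; rfl

theorem star_mul_aux (x y : Leavitt R E) : star (x * y) = star y * star x := by
  simp [star_def]

theorem star_add_aux (x y : Leavitt R E) : star (x + y) = star x + star y := by
  simp [star_def]

noncomputable instance : StarRing (Leavitt R E) where
  star_involutive x := by
    induction x using induction with
    | scalar r => simp [star_scalar]
    | hP v => simp
    | hS e => simp
    | hG e => simp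
    | mul a b ha hb => rw [star_mul_aux, star_mul_aux, ha, hb]
    | add a b ha hb => rw [star_add_aux, star_add_aux, ha, hb]
  star_mul := star_mul_aux
  star_add := star_add_aux

instance : StarModule R (Leavitt R E) where
  star_smul r x := by
    rw [Algebra.smul_def, star_mul_aux, star_scalar, ← Algebra.commutes, ← Algebra.smul_def]

end Star

end Leavitt

/-! #### The universal property in the category of `*`-algebras -/

/-- Elements `P_v`, `S_e` of a unital `*`-ring which satisfy, together with the adjoints of the
`S_e`, the relations of the Leavitt path algebra. -/
structure LeavittFamily (B : Type*) [Ring B] [StarRing B] where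
  P : V → B
  S : A → B
  star_P : ∀ v, star (P v) = P v
  idem : ∀ v, P v * P v = P v
  orth : ∀ v w, v ≠ w → P v * P w = 0
  star_S_mul_S : ∀ e f, e ≠ f → star (S e) * S f = 0
  star_S_mul_self : ∀ e, star (S e) * S e = P (E.rng e)
  P_mul_S : ∀ e, P (E.src e) * S e = S e
  S_mul_P : ∀ e, S e * P (E.rng e) = S e
  P_eq_sum : ∀ v, (E.outEdges v).Nonempty → P v = ∑ e ∈ E.outEdges v, S e * star (S e)
  sum_P : ∑ v, P v = 1

namespace LeavittFamily

variable {E} {B : Type*} [Ring B] [StarRing B]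

/-- The images of the generators under the homomorphism determined by a family. -/
def onGen (F : LeavittFamily E B) : LeavittGen V A → B
  | vertex v => F.P v
  | edge e => F.S e
  | ghost e => star (F.S e)

/-- If `u` is a unitary that commutes with all `P_v`, then `P_v` and `u S_e` is a family again. -/
def twist (F : LeavittFamily E B) (u : B) (hu : u ∈ unitary B)
    (hc : ∀ v, u * F.P v = F.P v * u) : LeavittFamily E B where
  P := F.P
  S e := u * F.S e
  star_P := F.star_P
  idem := F.idem
  orth := F.orth
  star_S_mul_S e f h := by
    rw [star_mul, mul_assoc, ← mul_assoc (star u), hu.1, one_mul, F.star_S_mul_S e f h]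
  star_S_mul_self e := by
    rw [star_mul, mul_assoc, ← mul_assoc (star u), hu.1, one_mul, F.star_S_mul_self]
  P_mul_S e := by rw [← mul_assoc, ← hc, mul_assoc, F.P_mul_S]
  S_mul_P e := by rw [mul_assoc, F.S_mul_P]
  P_eq_sum v h := by
    calc F.P v = u * F.P v * star u := by rw [hc, mul_assoc, hu.2, mul_one]
      _ = _ := by
        rw [F.P_eq_sum v h, Finset.mul_sum, Finset.sum_mul]
        exact Finset.sum_congr rfl fun e _ => by simp only [star_mul, mul_assoc]
  sum_P := F.sum_P

variable {R} [Algebra R B]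

theorem onGen_rel (F : LeavittFamily E B) ⦃x y : FreeAlgebra R (LeavittGen V A)⦄
    (h : LeavittRel R E x y) : FreeAlgebra.lift R F.onGen x = FreeAlgebra.lift R F.onGen y := by
  induction h <;> simp only [map_mul, map_sum, map_zero, map_one, FreeAlgebra.lift_ι_apply, onGen]
  case idem v => exact F.idem v
  case orth v w h => exact F.orth v w h
  case ghost_edge e f h => exact F.star_S_mul_S e f h
  case ghost_edge_self e => exact F.star_S_mul_self e
  case src_edge e => exact F.P_mul_S e
  case edge_rng e => exact F.S_mul_P e
  case ghost_src e => simpa [F.star_P] using congrArg star (F.P_mul_S e)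
  case rng_ghost e => simpa [F.star_P] using congrArg star (F.S_mul_P e)
  case vertex_sum v h => exact F.P_eq_sum v h
  case unit => exact F.sum_P.symm

variable (R) in
/-- The algebra homomorphism underlying `lift`. -/
noncomputable def liftAlg (F : LeavittFamily E B) : Leavitt R E →ₐ[R] B :=
  RingQuot.liftAlgHom R ⟨FreeAlgebra.lift R F.onGen, F.onGen_rel⟩

theorem liftAlg_mk (F : LeavittFamily E B) (x : FreeAlgebra R (LeavittGen V A)) :
    F.liftAlg R (Leavitt.mk R E x) = FreeAlgebra.lift R F.onGen x :=
  RingQuot.liftAlgHom_mkAlgHom_apply _ _ _ _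

theorem liftAlg_P (F : LeavittFamily E B) (v : V) : F.liftAlg R (Leavitt.P R E v) = F.P v := by
  simp [Leavitt.P, liftAlg_mk, onGen]

theorem liftAlg_S (F : LeavittFamily E B) (e : A) : F.liftAlg R (Leavitt.S R E e) = F.S e := by
  simp [Leavitt.S, liftAlg_mk, onGen]

theorem liftAlg_ghost (F : LeavittFamily E B) (e : A) :
    F.liftAlg R (Leavitt.Sghost R E e) = star (F.S e) := by
  simp [Leavitt.Sghost, liftAlg_mk, onGen]

variable [StarRing R] [StarModule R B]

variable (R) in
/-- Universal property of `L_R(E)`: a family in the `*`-algebra `B` determines a unital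
`*`-homomorphism `L_R(E) → B`. -/
noncomputable def lift (F : LeavittFamily E B) : Leavitt R E →⋆ₐ[R] B where
  toAlgHom := F.liftAlg R
  map_star' x := by
    change F.liftAlg R (star x) = star (F.liftAlg R x)
    induction x using Leavitt.induction with
    | scalar r => rw [Leavitt.star_scalar, AlgHom.commutes, AlgHom.commutes, algebraMap_star_comm]
    | hP v => rw [Leavitt.star_P, liftAlg_P, F.star_P]
    | hS e => rw [Leavitt.star_S, liftAlg_ghost, liftAlg_S]
    | hG e => rw [Leavitt.star_ghost, liftAlg_ghost, liftAlg_S, star_star]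
    | mul a b ha hb => rw [star_mul, map_mul, map_mul, star_mul, ha, hb]
    | add a b ha hb => rw [star_add, map_add, map_add, star_add, ha, hb]

@[simp] theorem lift_P (F : LeavittFamily E B) (v : V) : F.lift R (Leavitt.P R E v) = F.P v :=
  F.liftAlg_P v

@[simp] theorem lift_S (F : LeavittFamily E B) (e : A) : F.lift R (Leavitt.S R E e) = F.S e :=
  F.liftAlg_S e

end LeavittFamily

namespace Leavitt

/-- The generators of `L_R(E)` themselves. -/
noncomputable def family [StarRing R] : LeavittFamily E (Leavitt R E) where
  P := P R E
  S := S R E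
  star_P := star_P
  idem := P_idem E
  orth _ _ := P_orth E
  star_S_mul_S e f h := by rw [star_S, ghost_S E h]
  star_S_mul_self e := by rw [star_S, ghost_S_self]
  P_mul_S := P_S E
  S_mul_P := S_P E
  P_eq_sum v h := by simp only [star_S]; exact P_eq_sum E h
  sum_P := sum_P E

end Leavitt

end Leavitt

/-! ### The graph `C*`-algebra

`C*(E)` is the enveloping `C*`-algebra of `L_ℂ(E)`, i.e. its (Hausdorff) completion with respect to
the largest `C*`-seminorm. Its universal property with respect to Cuntz–Krieger families in
`C*`-algebras is `GraphCStar.lift`. -/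

section CStar

variable {V A : Type*} [Fintype V] [Fintype A] (E : DirectedGraph V A)

/-- `C*`-seminorms on the `*`-algebra `L_ℂ(E)`. -/
structure IsCStarSeminorm (p : Seminorm ℂ (Leavitt ℂ E)) : Prop where
  mul_le : ∀ x y, p (x * y) ≤ p x * p y
  star_mul_self : ∀ x, p (star x * x) = p x * p x

variable {E} in
theorem IsCStarSeminorm.star_eq {p : Seminorm ℂ (Leavitt ℂ E)} (hp : E.IsCStarSeminorm p)
    (x : Leavitt ℂ E) : p (star x) = p x := by
  have key : ∀ y : Leavitt ℂ E, p y ≤ p (star y) := fun y => by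
    rcases (apply_nonneg p y).eq_or_lt with h | h
    · rw [← h]; exact apply_nonneg p _
    · have := hp.mul_le (star y) y
      rw [hp.star_mul_self] at this
      exact le_of_mul_le_mul_right this h
  exact le_antisymm (by simpa using key (star x)) (key x)

theorem IsCStarSeminorm.zero : E.IsCStarSeminorm 0 := ⟨by simp, by simp⟩

theorem exists_bound (x : Leavitt ℂ E) :
    ∃ C, ∀ p : Seminorm ℂ (Leavitt ℂ E), E.IsCStarSeminorm p → p x ≤ C := by
  have idem : ∀ p : Seminorm ℂ (Leavitt ℂ E), E.IsCStarSeminorm p → ∀ x : Leavitt ℂ E,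
      star x = x → x * x = x → p x ≤ 1 := fun p hp x h1 h2 => by
    have := hp.star_mul_self x
    rw [h1, h2] at this
    nlinarith [apply_nonneg p x]
  have hP : ∀ p : Seminorm ℂ (Leavitt ℂ E), E.IsCStarSeminorm p → ∀ v, p (Leavitt.P ℂ E v) ≤ 1 :=
    fun p hp v => idem p hp _ (Leavitt.star_P v) (Leavitt.P_idem E v)
  have hS : ∀ p : Seminorm ℂ (Leavitt ℂ E), E.IsCStarSeminorm p → ∀ e, p (Leavitt.S ℂ E e) ≤ 1 :=
    fun p hp e => by
      have := hp.star_mul_self (Leavitt.S ℂ E e)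
      rw [Leavitt.star_S, Leavitt.ghost_S_self] at this
      nlinarith [apply_nonneg p (Leavitt.S ℂ E e), hP p hp (E.rng e)]
  induction x using Leavitt.induction with
  | scalar r =>
    refine ⟨‖r‖, fun p hp => ?_⟩
    rw [Algebra.algebraMap_eq_smul_one, map_smul_eq_mul]
    exact mul_le_of_le_one_right (norm_nonneg r) (idem p hp 1 (star_one _) (one_mul _))
  | hP v => exact ⟨1, fun p hp => hP p hp v⟩
  | hS e => exact ⟨1, fun p hp => hS p hp e⟩
  | hG e =>
    refine ⟨1, fun p hp => ?_⟩
    rw [← Leavitt.star_S, hp.star_eq]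
    exact hS p hp e
  | mul a b ha hb =>
    obtain ⟨C, hC⟩ := ha
    obtain ⟨D, hD⟩ := hb
    refine ⟨C * D, fun p hp => (hp.mul_le a b).trans ?_⟩
    exact mul_le_mul (hC p hp) (hD p hp) (apply_nonneg p b) ((apply_nonneg p a).trans (hC p hp))
  | add a b ha hb =>
    obtain ⟨C, hC⟩ := ha
    obtain ⟨D, hD⟩ := hb
    exact ⟨C + D, fun p hp => (map_add_le_add p a b).trans (add_le_add (hC p hp) (hD p hp))⟩

/-- The largest `C*`-seminorm on `L_ℂ(E)`. -/
noncomputable def maxNorm (x : Leavitt ℂ E) : ℝ :=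
  ⨆ p : {p : Seminorm ℂ (Leavitt ℂ E) // E.IsCStarSeminorm p}, p.1 x

instance : Nonempty {p : Seminorm ℂ (Leavitt ℂ E) // E.IsCStarSeminorm p} :=
  ⟨⟨0, IsCStarSeminorm.zero E⟩⟩

variable {E} in
theorem le_maxNorm {p : Seminorm ℂ (Leavitt ℂ E)} (hp : E.IsCStarSeminorm p) (x : Leavitt ℂ E) :
    p x ≤ E.maxNorm x := by
  obtain ⟨C, hC⟩ := E.exists_bound x
  exact le_ciSup (f := fun q : {p : Seminorm ℂ (Leavitt ℂ E) // E.IsCStarSeminorm p} => q.1 x)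
    ⟨C, by rintro _ ⟨q, rfl⟩; exact hC q.1 q.2⟩ ⟨p, hp⟩

theorem maxNorm_nonneg (x : Leavitt ℂ E) : 0 ≤ E.maxNorm x :=
  Real.iSup_nonneg fun p => apply_nonneg p.1 x

theorem maxNorm_mul_le (x y : Leavitt ℂ E) : E.maxNorm (x * y) ≤ E.maxNorm x * E.maxNorm y :=
  ciSup_le fun p => (p.2.mul_le x y).trans <|
    mul_le_mul (le_maxNorm p.2 x) (le_maxNorm p.2 y) (apply_nonneg p.1 y) (E.maxNorm_nonneg x)

theorem maxNorm_star (x : Leavitt ℂ E) : E.maxNorm (star x) = E.maxNorm x := by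
  simp only [maxNorm, fun p : {p : Seminorm ℂ (Leavitt ℂ E) // E.IsCStarSeminorm p} =>
    p.2.star_eq x]

theorem maxNorm_star_mul_self (x : Leavitt ℂ E) :
    E.maxNorm x * E.maxNorm x ≤ E.maxNorm (star x * x) := by
  have h : E.maxNorm x ≤ Real.sqrt (E.maxNorm (star x * x)) :=
    ciSup_le fun p => Real.le_sqrt_of_sq_le <| by
      rw [sq, ← p.2.star_mul_self]
      exact le_maxNorm p.2 _
  calc _ ≤ Real.sqrt (E.maxNorm (star x * x)) * Real.sqrt (E.maxNorm (star x * x)) :=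
        mul_le_mul h h (E.maxNorm_nonneg x) (Real.sqrt_nonneg _)
    _ = _ := Real.mul_self_sqrt (E.maxNorm_nonneg _)

/-- The largest `C*`-seminorm, as a ring seminorm. -/
noncomputable def maxRingSeminorm : RingSeminorm (Leavitt ℂ E) where
  toFun := E.maxNorm
  map_zero' := by simp [maxNorm]
  add_le' x y := ciSup_le fun p => (map_add_le_add p.1 x y).trans <|
    add_le_add (le_maxNorm p.2 x) (le_maxNorm p.2 y)
  neg' x := by simp [maxNorm]
  mul_le' := E.maxNorm_mul_le

noncomputable instance : SeminormedRing (Leavitt ℂ E) := (E.maxRingSeminorm).toSeminormedRing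

theorem norm_eq (x : Leavitt ℂ E) : ‖x‖ = E.maxNorm x := rfl

noncomputable instance : NormedAlgebra ℂ (Leavitt ℂ E) where
  norm_smul_le r x := ciSup_le fun p => by
    rw [map_smul_eq_mul]
    exact mul_le_mul_of_nonneg_left (le_maxNorm p.2 x) (norm_nonneg r)

instance : NormedStarGroup (Leavitt ℂ E) := ⟨fun x => (E.maxNorm_star x).le⟩

/-- The graph `C*`-algebra `C*(E)`. -/
def GraphCStar : Type _ := UniformSpace.Completion (Leavitt ℂ E)

namespace GraphCStar

open UniformSpace

noncomputable instance : NormedRing (GraphCStar E) :=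
  inferInstanceAs (NormedRing (Completion (Leavitt ℂ E)))

instance : CompleteSpace (GraphCStar E) :=
  inferInstanceAs (CompleteSpace (Completion (Leavitt ℂ E)))

noncomputable instance : Algebra ℂ (GraphCStar E) :=
  inferInstanceAs (Algebra ℂ (Completion (Leavitt ℂ E)))

noncomputable instance : NormedAlgebra ℂ (GraphCStar E) where
  norm_smul_le := norm_smul_le (α := ℂ) (β := Completion (Leavitt ℂ E))

/-- The canonical map `L_ℂ(E) → C*(E)`. -/
noncomputable def ofLeavitt : Leavitt ℂ E →ₐ[ℂ] GraphCStar E where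
  toRingHom := (Completion.coeRingHom : Leavitt ℂ E →+* Completion (Leavitt ℂ E))
  commutes' _ := rfl

variable {E}

theorem norm_ofLeavitt (x : Leavitt ℂ E) : ‖ofLeavitt E x‖ = E.maxNorm x :=
  Completion.norm_coe x

theorem continuous_ofLeavitt : Continuous (ofLeavitt E) := Completion.continuous_coe _

theorem induction {motive : GraphCStar E → Prop} (x : GraphCStar E)
    (hc : IsClosed {x | motive x}) (h : ∀ x, motive (ofLeavitt E x)) : motive x :=
  Completion.induction_on x hc h

noncomputable instance : Star (GraphCStar E) :=
  ⟨Completion.map (star : Leavitt ℂ E → Leavitt ℂ E)⟩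

theorem star_ofLeavitt (x : Leavitt ℂ E) : star (ofLeavitt E x) = ofLeavitt E (star x) :=
  Completion.map_coe (starₗᵢ ℂ (E := Leavitt ℂ E)).isometry.uniformContinuous x

theorem continuous_star_aux : Continuous (star : GraphCStar E → GraphCStar E) :=
  Completion.continuous_map

noncomputable instance : StarRing (GraphCStar E) where
  star_involutive x := by
    induction x using induction with
    | hc => exact isClosed_eq (continuous_star_aux.comp continuous_star_aux) continuous_id
    | h x => rw [star_ofLeavitt, star_ofLeavitt, star_star]
  star_mul x y := by
    induction x using induction with
    | hc =>
      exact isClosed_eq (continuous_star_aux.comp (continuous_mul_const y))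
        ((continuous_const_mul _).comp continuous_star_aux)
    | h x =>
      induction y using induction with
      | hc =>
        exact isClosed_eq (continuous_star_aux.comp (continuous_const_mul _))
          ((continuous_mul_const _).comp continuous_star_aux)
      | h y => rw [← map_mul, star_ofLeavitt, star_ofLeavitt, star_ofLeavitt, star_mul, map_mul]
  star_add x y := by
    induction x using induction with
    | hc =>
      exact isClosed_eq (continuous_star_aux.comp (continuous_add_const y))
        ((continuous_add_const _).comp continuous_star_aux)
    | h x =>
      induction y using induction with
      | hc =>
        exact isClosed_eq (continuous_star_aux.comp (continuous_const_add _))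
          ((continuous_const_add _).comp continuous_star_aux)
      | h y => rw [← map_add, star_ofLeavitt, star_ofLeavitt, star_ofLeavitt, star_add, map_add]

instance : CStarRing (GraphCStar E) where
  norm_mul_self_le x := by
    induction x using induction with
    | hc =>
      exact isClosed_le (continuous_norm.mul continuous_norm)
        (continuous_norm.comp (continuous_star_aux.mul continuous_id))
    | h x =>
      rw [star_ofLeavitt, ← map_mul, norm_ofLeavitt, norm_ofLeavitt]
      exact E.maxNorm_star_mul_self x

instance : StarModule ℂ (GraphCStar E) where
  star_smul r x := by
    induction x using induction with
    | hc =>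
      exact isClosed_eq (continuous_star_aux.comp (continuous_const_smul r))
        ((continuous_const_smul _).comp continuous_star_aux)
    | h x => rw [← map_smul, star_ofLeavitt, star_ofLeavitt, star_smul, map_smul]

noncomputable instance : CStarAlgebra (GraphCStar E) where

variable (E)

/-- The vertex projections `p_v`. -/
noncomputable def p (v : V) : GraphCStar E := ofLeavitt E (Leavitt.P ℂ E v)

/-- The partial isometries `s_e`. -/
noncomputable def s (e : A) : GraphCStar E := ofLeavitt E (Leavitt.S ℂ E e)

theorem star_s (e : A) : star (s E e) = ofLeavitt E (Leavitt.Sghost ℂ E e) := by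
  rw [s, star_ofLeavitt, Leavitt.star_S]

/-- The generators of `C*(E)` satisfy the Leavitt relations. -/
noncomputable def family : LeavittFamily E (GraphCStar E) where
  P := p E
  S := s E
  star_P v := by rw [p, star_ofLeavitt, Leavitt.star_P]
  idem v := by rw [p, ← map_mul, Leavitt.P_idem]
  orth v w h := by rw [p, p, ← map_mul, Leavitt.P_orth E h, map_zero]
  star_S_mul_S e f h := by rw [star_s, s, ← map_mul, Leavitt.ghost_S E h, map_zero]
  star_S_mul_self e := by rw [star_s, s, ← map_mul, Leavitt.ghost_S_self, p]
  P_mul_S e := by rw [p, s, ← map_mul, Leavitt.P_S]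
  S_mul_P e := by rw [p, s, ← map_mul, Leavitt.S_P]
  P_eq_sum v h := by
    simp only [star_s]
    rw [p, Leavitt.P_eq_sum E h, map_sum]
    simp only [map_mul, s]
  sum_P := by
    simp only [p]
    rw [← map_sum, Leavitt.sum_P, map_one]

end GraphCStar

/-- A Cuntz–Krieger `E`-family in a unital `C*`-algebra: mutually orthogonal projections `p_v` with
sum `1`, and `s_e` with `s_e^* s_e = p_{r(e)}` and `p_v = ∑_{s(e) = v} s_e s_e^*`
(the latter for vertices that are not sinks). -/
structure CuntzKriegerFamily (B : Type*) [CStarAlgebra B] where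
  p : V → B
  s : A → B
  star_p : ∀ v, star (p v) = p v
  idem : ∀ v, p v * p v = p v
  orth : ∀ v w, v ≠ w → p v * p w = 0
  star_s_mul_s : ∀ e, star (s e) * s e = p (E.rng e)
  p_eq_sum : ∀ v, (E.outEdges v).Nonempty → p v = ∑ e ∈ E.outEdges v, s e * star (s e)
  sum_p : ∑ v, p v = 1

namespace CuntzKriegerFamily

variable {E} {B : Type*} [CStarAlgebra B]

theorem s_star_s (F : CuntzKriegerFamily E B) (e : A) : F.s e * star (F.s e) * F.s e = F.s e := by
  rw [← sub_eq_zero, ← CStarRing.star_mul_self_eq_zero_iff]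
  have h := F.star_s_mul_s e
  have h2 := F.idem (E.rng e)
  simp only [star_sub, star_mul, star_star, sub_mul, mul_sub]
  have h3 : star (F.s e) * (F.s e * star (F.s e)) * (F.s e * star (F.s e) * F.s e) =
      F.p (E.rng e) := by
    calc _ = (star (F.s e) * F.s e) * (star (F.s e) * F.s e) * (star (F.s e) * F.s e) := by
          simp only [mul_assoc]
      _ = _ := by rw [h, h2, h2]
  have h4 : star (F.s e) * (F.s e * star (F.s e)) * F.s e = F.p (E.rng e) := by
    calc _ = (star (F.s e) * F.s e) * (star (F.s e) * F.s e) := by simp only [mul_assoc]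
      _ = _ := by rw [h, h2]
  have h5 : star (F.s e) * (F.s e * star (F.s e) * F.s e) = F.p (E.rng e) := by
    calc _ = (star (F.s e) * F.s e) * (star (F.s e) * F.s e) := by simp only [mul_assoc]
      _ = _ := by rw [h, h2]
  rw [h3, h4, h5, h]; simp

theorem p_mul_s (F : CuntzKriegerFamily E B) (e : A) : F.p (E.src e) * F.s e = F.s e := by
  let _ := CStarAlgebra.spectralOrder B
  let _ := CStarAlgebra.spectralOrderedRing B
  have h1 := F.p_eq_sum _ ⟨e, E.mem_outEdges e⟩
  have h2 : ∑ g ∈ E.outEdges (E.src e),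
      (1 - F.p (E.src e)) * (F.s g * star (F.s g)) * (1 - F.p (E.src e)) = 0 := by
    rw [← Finset.sum_mul, ← Finset.mul_sum, ← h1, sub_mul, one_mul, F.idem, sub_self, zero_mul]
  have h3 := (Finset.sum_eq_zero_iff_of_nonneg (fun g _ => by
    have := star_mul_self_nonneg (star (F.s g) * (1 - F.p (E.src e)))
    simpa [mul_assoc, F.star_p] using this)).1 h2 e (E.mem_outEdges e)
  have h4 : star (star (F.s e) * (1 - F.p (E.src e))) * (star (F.s e) * (1 - F.p (E.src e))) = 0 := by
    simpa [mul_assoc, F.star_p] using h3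
  have h5 := congrArg star (CStarRing.star_mul_self_eq_zero_iff _ |>.1 h4)
  simp only [star_mul, star_sub, star_one, star_star, star_zero, F.star_p, sub_mul, one_mul] at h5
  exact (sub_eq_zero.1 h5).symm

/-- The range projections are orthogonal, since they sum up to projections. -/
theorem star_s_mul_s_of_ne (F : CuntzKriegerFamily E B) {e f : A} (hef : e ≠ f) :
    star (F.s e) * F.s f = 0 := by
  let _ := CStarAlgebra.spectralOrder B
  let _ := CStarAlgebra.spectralOrderedRing B
  by_cases hs : E.src e = E.src f
  · classical
    have h1 := F.p_eq_sum _ ⟨e, E.mem_outEdges e⟩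
    rw [← Finset.add_sum_erase _ _ (E.mem_outEdges e)] at h1
    have h2 : ∑ g ∈ (E.outEdges (E.src e)).erase e,
        star (F.s e) * (F.s g * star (F.s g)) * F.s e = 0 := by
      rw [← Finset.sum_mul, ← Finset.mul_sum, ← sub_eq_iff_eq_add'.mpr h1, mul_sub, sub_mul,
        mul_assoc, F.p_mul_s, mul_assoc, F.s_star_s, sub_self]
    have h3 := (Finset.sum_eq_zero_iff_of_nonneg (fun g _ => by
      have := star_mul_self_nonneg (star (F.s g) * F.s e)
      simpa [mul_assoc] using this)).1 h2 f (by simp [outEdges, hs, hef.symm])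
    have h4 : star (star (F.s f) * F.s e) * (star (F.s f) * F.s e) = 0 := by
      simpa [mul_assoc] using h3
    simpa using congrArg star (CStarRing.star_mul_self_eq_zero_iff _ |>.1 h4)
  · rw [← F.p_mul_s e, ← F.p_mul_s f, star_mul, F.star_p, mul_assoc, ← mul_assoc (F.p (E.src e)),
      F.orth _ _ hs, zero_mul, mul_zero]

/-- In a `C*`-algebra, the Cuntz–Krieger relations imply all relations of `L_ℂ(E)`. -/
def toLeavittFamily (F : CuntzKriegerFamily E B) : LeavittFamily E B where
  P := F.p
  S := F.s
  star_P := F.star_p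
  idem := F.idem
  orth := F.orth
  star_S_mul_S _ _ := F.star_s_mul_s_of_ne
  star_S_mul_self := F.star_s_mul_s
  P_mul_S := F.p_mul_s
  S_mul_P e := by rw [← F.star_s_mul_s, ← mul_assoc, F.s_star_s]
  P_eq_sum := F.p_eq_sum
  sum_P := F.sum_p

end CuntzKriegerFamily

namespace GraphCStar

open UniformSpace

variable {E} {B : Type*} [CStarAlgebra B]

theorem norm_le_of_starAlgHom (φ : Leavitt ℂ E →⋆ₐ[ℂ] B) (x : Leavitt ℂ E) : ‖φ x‖ ≤ ‖x‖ :=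
  le_maxNorm (p := (normSeminorm ℂ B).comp (φ : Leavitt ℂ E →ₗ[ℂ] B))
    ⟨fun x y => by simpa using norm_mul_le (φ x) (φ y),
      fun x => by simpa [map_star] using CStarRing.norm_star_mul_self (x := φ x)⟩ x

theorem uniformContinuous_of_starAlgHom (φ : Leavitt ℂ E →⋆ₐ[ℂ] B) : UniformContinuous φ :=
  uniformContinuous_addMonoidHom_of_continuous
    (AddMonoidHomClass.continuous_of_bound φ 1 (fun x => by
      simpa using norm_le_of_starAlgHom φ x))

/-- A `*`-homomorphism from `L_ℂ(E)` to a `C*`-algebra extends to `C*(E)`. -/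
noncomputable def extend (φ : Leavitt ℂ E →⋆ₐ[ℂ] B) : GraphCStar E →⋆ₐ[ℂ] B :=
  have hφ := uniformContinuous_of_starAlgHom φ
  have hc : Continuous (Completion.extension φ : GraphCStar E → B) :=
    Completion.continuous_extension
  have hx (x : Leavitt ℂ E) : Completion.extension φ (ofLeavitt E x) = φ x :=
    Completion.extension_coe hφ x
  { toFun := Completion.extension φ
    map_one' := by rw [← map_one (ofLeavitt E), hx, map_one]
    map_zero' := by rw [← map_zero (ofLeavitt E), hx, map_zero]
    commutes' r := by rw [← (ofLeavitt E).commutes, hx, AlgHomClass.commutes]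
    map_mul' x y := by
      induction x using induction with
      | hc => exact isClosed_eq (hc.comp (continuous_mul_const y)) (hc.mul continuous_const)
      | h x =>
        induction y using induction with
        | hc => exact isClosed_eq (hc.comp (continuous_const_mul _)) (continuous_const.mul hc)
        | h y => rw [← map_mul, hx, hx, hx, map_mul]
    map_add' x y := by
      induction x using induction with
      | hc => exact isClosed_eq (hc.comp (continuous_add_const y)) (hc.add continuous_const)
      | h x =>
        induction y using induction with
        | hc => exact isClosed_eq (hc.comp (continuous_const_add _)) (continuous_const.add hc)
        | h y => rw [← map_add, hx, hx, hx, map_add]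
    map_star' x := by
      induction x using induction with
      | hc => exact isClosed_eq (hc.comp continuous_star_aux) (continuous_star.comp hc)
      | h x => rw [star_ofLeavitt, hx, hx, map_star] }

theorem extend_ofLeavitt (φ : Leavitt ℂ E →⋆ₐ[ℂ] B) (x : Leavitt ℂ E) :
    extend φ (ofLeavitt E x) = φ x :=
  Completion.extension_coe (uniformContinuous_of_starAlgHom φ) x

/-- Universal property of `C*(E)`: a Cuntz–Krieger family in the `C*`-algebra `B` determines a
unital `*`-homomorphism `C*(E) → B`. -/
noncomputable def lift (F : CuntzKriegerFamily E B) : GraphCStar E →⋆ₐ[ℂ] B :=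
  extend (F.toLeavittFamily.lift ℂ)

theorem lift_p (F : CuntzKriegerFamily E B) (v : V) : lift F (p E v) = F.p v := by
  rw [lift, p, extend_ofLeavitt, LeavittFamily.lift_P]; rfl

theorem lift_s (F : CuntzKriegerFamily E B) (e : A) : lift F (s E e) = F.s e := by
  rw [lift, s, extend_ofLeavitt, LeavittFamily.lift_S]; rfl

end GraphCStar

end CStar

/-! ### Endomorphisms determined by unitaries -/

section Endomorphisms

variable {V A : Type*} [Fintype V] [Fintype A] (E : DirectedGraph V A)

/-- The paths `S_μ` in `L_ℤ(E)`. -/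
noncomputable def leavittPath (μ : E.FinPath) : Leavitt ℤ E :=
  E.pathElement (Leavitt.P ℤ E) (Leavitt.S ℤ E) μ

/-- The paths `s_μ` in `C*(E)`. -/
noncomputable def cstarPath (μ : E.FinPath) : GraphCStar E :=
  E.pathElement (GraphCStar.p E) (GraphCStar.s E) μ

/-- The diagonal subalgebra of `L_ℤ(E)`, generated by the projections `P_μ = S_μ S_μ^*`. -/
noncomputable def leavittDiagonal : Subalgebra ℤ (Leavitt ℤ E) :=
  Algebra.adjoin ℤ (Set.range fun μ : E.FinPath => E.leavittPath μ * star (E.leavittPath μ))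

/-- The diagonal subalgebra of `C*(E)`: the `C*`-subalgebra generated by the projections
`p_μ = s_μ s_μ^*`. -/
noncomputable def cstarDiagonal : StarSubalgebra ℂ (GraphCStar E) :=
  (StarAlgebra.adjoin ℂ
    (Set.range fun μ : E.FinPath => E.cstarPath μ * star (E.cstarPath μ))).topologicalClosure

/-- The set `U_E` of unitaries in `L_ℤ(E)` that commute with all vertex projections. -/
def vertexUnitaries : Set (Leavitt ℤ E) :=
  {u | u ∈ unitary (Leavitt ℤ E) ∧ ∀ v, u * Leavitt.P ℤ E v = Leavitt.P ℤ E v * u}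

/-- The canonical map `L_ℤ(E) → C*(E)`, sending generators to generators. -/
noncomputable def toCStar : Leavitt ℤ E →⋆ₐ[ℤ] GraphCStar E := (GraphCStar.family E).lift ℤ

variable {E}

/-- The unital `*`-endomorphism `Λ_u` of `L_ℤ(E)` with `Λ_u(S_e) = u S_e`, `Λ_u(P_v) = P_v`. -/
noncomputable def leavittEndo (u : Leavitt ℤ E) (hu : u ∈ E.vertexUnitaries) :
    Leavitt ℤ E →⋆ₐ[ℤ] Leavitt ℤ E :=
  ((Leavitt.family ℤ E).twist u hu.1 hu.2).lift ℤ

theorem leavittEndo_P (u : Leavitt ℤ E) (hu : u ∈ E.vertexUnitaries) (v : V) :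
    leavittEndo u hu (Leavitt.P ℤ E v) = Leavitt.P ℤ E v := by
  rw [leavittEndo, LeavittFamily.lift_P]; rfl

theorem leavittEndo_S (u : Leavitt ℤ E) (hu : u ∈ E.vertexUnitaries) (e : A) :
    leavittEndo u hu (Leavitt.S ℤ E e) = u * Leavitt.S ℤ E e := by
  rw [leavittEndo, LeavittFamily.lift_S]; rfl

/-- The Cuntz–Krieger family `p_v`, `u s_e` in `C*(E)`. -/
noncomputable def twistedFamily (u : Leavitt ℤ E) (hu : u ∈ E.vertexUnitaries) :
    CuntzKriegerFamily E (GraphCStar E) :=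
  let F : LeavittFamily E (GraphCStar E) := (GraphCStar.family E).twist (E.toCStar u)
    (Unitary.map_mem E.toCStar hu.1) (fun v => by
      have h : E.toCStar (Leavitt.P ℤ E v) = (GraphCStar.family E).P v := LeavittFamily.lift_P _ v
      rw [← h, ← map_mul, hu.2, map_mul])
  { p := GraphCStar.p E
    s := fun e => E.toCStar u * GraphCStar.s E e
    star_p := F.star_P
    idem := F.idem
    orth := F.orth
    star_s_mul_s := F.star_S_mul_self
    p_eq_sum := F.P_eq_sum
    sum_p := F.sum_P }

/-- The unital `*`-endomorphism `λ_u` of `C*(E)` with `λ_u(s_e) = u s_e`, `λ_u(p_v) = p_v`. -/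
noncomputable def cstarEndo (u : Leavitt ℤ E) (hu : u ∈ E.vertexUnitaries) :
    GraphCStar E →⋆ₐ[ℂ] GraphCStar E :=
  GraphCStar.lift (twistedFamily u hu)

theorem cstarEndo_p (u : Leavitt ℤ E) (hu : u ∈ E.vertexUnitaries) (v : V) :
    cstarEndo u hu (GraphCStar.p E v) = GraphCStar.p E v :=
  GraphCStar.lift_p _ v

theorem cstarEndo_s (u : Leavitt ℤ E) (hu : u ∈ E.vertexUnitaries) (e : A) :
    cstarEndo u hu (GraphCStar.s E e) = E.toCStar u * GraphCStar.s E e :=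
  GraphCStar.lift_s _ e

/-! ### Polynomial unitaries and their coding graphs -/

variable (E) in
/-- A finite set `J` of pairs of paths with common sources and common ranges such that
`u_J = ∑_{(μ, ν) ∈ J} S_μ S_ν^*` is unitary. The second components are required to have positive
length, so that they can be written as `e κ` with an edge `e`. -/
structure PolynomialUnitary where
  J : Finset (E.FinPath × E.FinPath)
  source_eq : ∀ q ∈ J, q.1.source = q.2.source
  range_eq : ∀ q ∈ J, q.1.range = q.2.range
  pos : ∀ q ∈ J, 0 < q.2.length
  unitary_sum : ∑ q ∈ J, E.leavittPath q.1 * star (E.leavittPath q.2) ∈ unitary (Leavitt ℤ E)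

namespace PolynomialUnitary

variable (𝒥 : PolynomialUnitary E)

/-- The unitary `u_J`. -/
noncomputable def u : Leavitt ℤ E :=
  ∑ q ∈ 𝒥.J, E.leavittPath q.1 * star (E.leavittPath q.2)

theorem u_mem : 𝒥.u ∈ E.vertexUnitaries := by
  refine ⟨𝒥.unitary_sum, fun v => ?_⟩
  rw [u, Finset.sum_mul, Finset.mul_sum]
  refine Finset.sum_congr rfl fun q hq => ?_
  have h : ∀ x y : Leavitt ℤ E, Leavitt.P ℤ E q.2.source * x * (y * Leavitt.P ℤ E q.2.source) *
      Leavitt.P ℤ E v =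
      Leavitt.P ℤ E v * (Leavitt.P ℤ E q.2.source * x * (y * Leavitt.P ℤ E q.2.source)) := by
    intro x y
    by_cases hv : v = q.2.source
    · subst hv
      simp only [← mul_assoc, Leavitt.P_idem]
      simp only [mul_assoc, Leavitt.P_idem]
    · rw [mul_assoc, mul_assoc y, Leavitt.P_orth E (Ne.symm hv), ← mul_assoc, ← mul_assoc,
        ← mul_assoc, ← mul_assoc, Leavitt.P_orth E hv]
      simp
  have := h (q.1.edges.map (Leavitt.S ℤ E)).prod (star (q.2.edges.map (Leavitt.S ℤ E)).prod)
  simpa only [leavittPath, pathElement, 𝒥.source_eq q hq, star_mul, Leavitt.star_P] using this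

/-- The endomorphism `Λ_J` of `L_ℤ(E)`. -/
noncomputable def leavittEndo : Leavitt ℤ E →⋆ₐ[ℤ] Leavitt ℤ E :=
  DirectedGraph.leavittEndo 𝒥.u 𝒥.u_mem

/-- The endomorphism `λ_J` of `C*(E)`. -/
noncomputable def cstarEndo : GraphCStar E →⋆ₐ[ℂ] GraphCStar E :=
  DirectedGraph.cstarEndo 𝒥.u 𝒥.u_mem

/-- For `a = (μ₁, e₁ν₁)` and `b = (μ₂, e₂ν₂)` in `J`, the element `S_{ν₁}^* S_{μ₂}`. -/
noncomputable def label (a b : 𝒥.J) : Leavitt ℤ E :=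
  star (E.leavittPath (a.1.2.tail (𝒥.pos a.1 a.2))) * E.leavittPath b.1.1

/-- The coding graph `E_J`: its vertex set is `J`, and there is one edge from `a` to `b` whenever
`S_{ν₁}^* S_{μ₂} ≠ 0`. -/
def codingGraph :
    DirectedGraph 𝒥.J {q : 𝒥.J × 𝒥.J // 𝒥.label q.1 q.2 ≠ 0} where
  src η := η.1.1
  rng η := η.1.2

/-- `𝒥.HasDegree η d`: the edge `η` of the coding graph, with label `L`, has degree `d`, i.e.
`L = S_α` and `d = |α|`, or `L` is in the span of the vertex projections and `d = 0`, or
`L = S_α^*` and `d = -|α|`. -/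
def HasDegree (η : {q : 𝒥.J × 𝒥.J // 𝒥.label q.1 q.2 ≠ 0}) (d : ℤ) : Prop :=
  (∃ α : E.FinPath, 𝒥.label η.1.1 η.1.2 = E.leavittPath α ∧ d = α.length) ∨
  (𝒥.label η.1.1 η.1.2 ∈ Submodule.span ℤ (Set.range (Leavitt.P ℤ E)) ∧ d = 0) ∨
  (∃ α : E.FinPath, 𝒥.label η.1.1 η.1.2 = star (E.leavittPath α) ∧ d = -α.length)

/-- The coding graph has only non-negative edges. -/
def OnlyNonnegativeEdges : Prop := ∀ η, ∃ d, 𝒥.HasDegree η d ∧ 0 ≤ d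

/-- The coding graph contains a non-positive cycle, i.e. a cycle all of whose edges have
degree at most `0`. -/
def HasNonpositiveCycle : Prop :=
  ∃ ω : 𝒥.codingGraph.FinPath, ω.IsCycle ∧ ∀ η ∈ ω.edges, ∃ d, 𝒥.HasDegree η d ∧ d ≤ 0

/-- The edge `e` for a vertex `(μ, e ν)` of the coding graph. -/
def vertexEdge (a : 𝒥.J) : A := a.1.2.firstEdge (𝒥.pos a.1 a.2)

/-- The label `ℰ(ω) = e₁ e₂ ⋯` of a path in the coding graph, as the sequence of edges of a path
in `E`; it lists the edges `e` of all the vertices that `ω` visits. -/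
def edgeLabel (ω : 𝒥.codingGraph.FinPath) : List A :=
  𝒥.vertexEdge ω.source :: ω.edges.map fun η => 𝒥.vertexEdge (𝒥.codingGraph.rng η)

/-- The labeled graph `(E_J, ℰ)` is left-synchronizing. -/
def LeftSynchronizing : Prop :=
  ∃ m : ℕ, ∀ ω₁ ω₂ : 𝒥.codingGraph.FinPath, ω₁.length = m → ω₂.length = m →
    𝒥.edgeLabel ω₁ = 𝒥.edgeLabel ω₂ → ω₁.source = ω₂.source

/-- `Λ_J` restricts to an automorphism of the diagonal of `L_ℤ(E)`. -/
def LeavittRestrictsToAut : Prop :=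
  Set.BijOn 𝒥.leavittEndo E.leavittDiagonal E.leavittDiagonal

/-- `λ_J` restricts to an automorphism of the diagonal of `C*(E)`. -/
def CStarRestrictsToAut : Prop :=
  Set.BijOn 𝒥.cstarEndo E.cstarDiagonal E.cstarDiagonal

end PolynomialUnitary

end Endomorphisms

end DirectedGraph

/-! Let X be the space of infinite paths. An element of either diagonal acts as a function on X,
whose value at x is `evalAt x` (of its image in C*(E)), and this function determines the element
(`eq_zero_of_mem_leavittDiagonal`, `eq_zero_of_mem_cstarDiagonal`). Unitarity of u_J means that the
cylinders of the first components of J partition X, and so do those of the second components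
(`existsUnique_fst`, `existsUnique_snd`). Hence the adjoint of u_J moves y = μx to eνx, where (μ,
eν) = `code y`. Put `shift y` = νx, and let `dualMap y` be the sequence of the edges e of the codes
along the orbit of y under `shift`.

On the diagonal the endomorphism is composition with `dualMap` (`evalAt_cstarEndo`). The dual map is
continuous and, X being compact, onto, so the endomorphism is always injective on the diagonal. Its
range is the whole diagonal exactly when `dualMap` is injective: projections separate points, and
conversely compactness expresses each cylinder through finitely many preimages of cylinders, with
integer coefficients. Both automorphism questions thus become one question about `dualMap`
(`leavittRestrictsToAut_iff`, `cstarRestrictsToAut_iff`).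

The rest is combinatorial. The codes along the orbit of y form a path in the coding graph whose
label is `dualMap y`. The edge from (μ₁, e₁ν₁) to (μ₂, e₂ν₂) has degree |μ₂| - |ν₁|
(`HasDegree.eq`). If it is at most 0, ν₁ extends μ₂, so the code of y determines that of `shift y`;
around a non-positive cycle `dualMap` is therefore constant on a cylinder, and the exit condition
puts two points into it (`not_injective_of_hasNonpositiveCycle`).

If all degrees are at least 0, every finite walk begins an itinerary, so left-synchronization says
that a fixed number of letters of `dualMap y` determines `code y`. Injectivity implies this by
compactness (`leftSynchronizing_of_injective`). Conversely, two paths with the same image have the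
same codes forever. Agreement of their remainders, pulled back along an edge, grows by the degree of
the edge, and without non-positive cycles positive degrees keep recurring, so the paths are equal
(`injective_of_leftSynchronizing`). -/

/-! ### Partial permutations acting on `ℓ²` -/

namespace PEquiv

open ContinuousLinearMap

variable {κ : Type*}

/-- The values of `f` transported along a partial bijection. -/
noncomputable def pullback (g : PEquiv κ κ) (f : κ → ℂ) (y : κ) : ℂ := (g.symm y).elim 0 f

/-- Different points y have different preimages under g, so the sum is a partial sum of the norm of
f, without repetitions. -/
theorem sum_norm_pullback_le (g : PEquiv κ κ) (f : lp (fun _ : κ => ℂ) 2) (s : Finset κ) :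
    ∑ y ∈ s, ‖g.pullback f y‖ ^ (2 : ENNReal).toReal ≤ ‖f‖ ^ (2 : ENNReal).toReal := by
  classical
  have h1 : ∀ y, ‖g.pullback f y‖ ^ (2 : ENNReal).toReal =
      ∑ x ∈ (g.symm y).toFinset, ‖f x‖ ^ (2 : ENNReal).toReal := fun y => by
    unfold pullback
    cases g.symm y <;> simp
  simp only [h1]
  rw [← Finset.sum_biUnion]
  · exact lp.sum_rpow_le_norm_rpow (by simp) f _
  · intro y _ z _ hyz
    refine Finset.disjoint_left.2 fun x hx hx' => hyz ?_
    rw [Option.mem_toFinset] at hx hx'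
    have e1 := g.mem_iff_mem.1 hx
    have e2 := g.mem_iff_mem.1 hx'
    exact Option.some_injective _ (e1.symm.trans e2)

/-- The partial isometry of `ℓ²(κ)` that permutes the basis vectors along a partial bijection. -/
noncomputable def toOperator (g : PEquiv κ κ) :
    lp (fun _ : κ => ℂ) 2 →L[ℂ] lp (fun _ : κ => ℂ) 2 :=
  LinearMap.mkContinuous
    { toFun := fun f => ⟨g.pullback f, memℓp_gen' (C := ‖f‖ ^ (2 : ENNReal).toReal)
        (g.sum_norm_pullback_le f)⟩
      map_add' := fun f h => by
        ext y; simp only [lp.coeFn_add, Pi.add_apply, pullback]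
        cases g.symm y <;> simp
      map_smul' := fun c f => by
        ext y; simp only [lp.coeFn_smul, Pi.smul_apply, pullback, RingHom.id_apply]
        cases g.symm y <;> simp } 1
    fun f => by
      rw [one_mul]
      exact lp.norm_le_of_forall_sum_le (by simp) (norm_nonneg f) (g.sum_norm_pullback_le f)

theorem toOperator_apply (g : PEquiv κ κ) (f : lp (fun _ : κ => ℂ) 2) (y : κ) :
    g.toOperator f y = (g.symm y).elim 0 f := rfl

end PEquiv

/-- The basis vectors of `ℓ²(κ)`. -/
noncomputable def lp.basisVector {κ : Type*} (k : κ) : lp (fun _ : κ => ℂ) 2 := by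
  classical exact lp.single 2 k 1

namespace lp

open scoped Classical in
theorem basisVector_apply {κ : Type*} (k j : κ) :
    basisVector k j = if j = k then 1 else 0 := by
  simp [basisVector, Pi.single_apply]

theorem inner_basisVector_left {κ : Type*} (k : κ) (f : lp (fun _ : κ => ℂ) 2) :
    inner ℂ (basisVector k) f = f k := by
  classical
  simp [basisVector, lp.inner_single_left]

open scoped Classical in
theorem inner_basisVector {κ : Type*} (k j : κ) :
    inner ℂ (basisVector k) (basisVector j) = if k = j then (1 : ℂ) else 0 := by
  rw [inner_basisVector_left, basisVector_apply]

theorem norm_basisVector {κ : Type*} (k : κ) : ‖basisVector k‖ = 1 := by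
  classical
  rw [basisVector, lp.norm_single (by simp), norm_one]

theorem basisVector_ne_zero {κ : Type*} (k : κ) : basisVector k ≠ 0 := fun h => by
  have := inner_basisVector k k
  rw [h] at this
  simp at this

theorem operator_ext {κ : Type*} {a b : lp (fun _ : κ => ℂ) 2 →L[ℂ] lp (fun _ : κ => ℂ) 2}
    (h : ∀ k, a (basisVector k) = b (basisVector k)) : a = b := by
  classical
  refine lp.ext_continuousLinearMap (by simp) fun k => ?_
  ext1
  exact h k

end lp

namespace PEquiv

open lp

variable {κ : Type*}

theorem toOperator_basisVector (g : PEquiv κ κ) (k : κ) :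
    g.toOperator (basisVector k) = (g k).elim 0 basisVector := by
  classical
  ext y
  rw [toOperator_apply]
  have hm := g.mem_iff_mem (a := k) (b := y)
  rcases h : g k with _ | z <;> rcases h' : g.symm y with _ | x
  · simp
  · have : x ≠ k := by rintro rfl; simp [h, h'] at hm
    simp [basisVector_apply, this]
  · have : y ≠ z := by rintro rfl; simp [h, h'] at hm
    simp [basisVector_apply, this]
  · simp [h, h'] at hm
    simp [basisVector_apply, hm, eq_comm]

/-- Both sides have the same matrix entries: the entry at (y, k) is 1 exactly when g maps y to k. -/
theorem star_toOperator (g : PEquiv κ κ) : star g.toOperator = g.symm.toOperator := by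
  classical
  rw [ContinuousLinearMap.star_eq_adjoint]
  refine operator_ext fun k => ?_
  ext y
  rw [← inner_basisVector_left y, ContinuousLinearMap.adjoint_inner_right, toOperator_basisVector,
    toOperator_apply, symm_symm]
  cases g y <;> simp [inner_basisVector_left]

end PEquiv

/-! ### Infinite paths -/

namespace DirectedGraph

variable {V A : Type*}

/-- Infinite paths of a directed graph. -/
@[ext]
structure InfPath (E : DirectedGraph V A) where
  seq : ℕ → A
  isPath : ∀ n, E.rng (seq n) = E.src (seq (n + 1))

namespace InfPath

variable {E : DirectedGraph V A}

/-- The source of an infinite path. -/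
def source (x : E.InfPath) : V := E.src (x.seq 0)

/-- The infinite path without its first `n` edges. -/
def drop (n : ℕ) (x : E.InfPath) : E.InfPath where
  seq k := x.seq (n + k)
  isPath k := x.isPath (n + k)

/-- The first `n` edges of an infinite path. -/
def take (n : ℕ) (x : E.InfPath) : List A := (List.range n).map x.seq

/-- The infinite path `e x`. -/
def cons (e : A) (x : E.InfPath) (h : E.rng e = x.source) : E.InfPath where
  seq n := Nat.casesOn n e x.seq
  isPath n := by
    cases n with
    | zero => exact h
    | succ n => exact x.isPath n

@[simp] theorem drop_zero (x : E.InfPath) : x.drop 0 = x := by ext; simp [drop]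

theorem drop_drop (m n : ℕ) (x : E.InfPath) : (x.drop m).drop n = x.drop (m + n) := by
  ext; simp [drop, add_assoc]

@[simp] theorem seq_drop (m n : ℕ) (x : E.InfPath) : (x.drop m).seq n = x.seq (m + n) := rfl

@[simp] theorem length_take (n : ℕ) (x : E.InfPath) : (x.take n).length = n := by simp [take]

@[simp] theorem take_zero (x : E.InfPath) : x.take 0 = [] := rfl

theorem take_succ (n : ℕ) (x : E.InfPath) : x.take (n + 1) = x.seq 0 :: (x.drop 1).take n := by
  simp [take, List.range_succ_eq_map, drop, Function.comp_def, add_comm]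

theorem take_add (m n : ℕ) (x : E.InfPath) : x.take (m + n) = x.take m ++ (x.drop m).take n := by
  simp [take, List.range_add, drop, Function.comp_def]

theorem source_drop_one (x : E.InfPath) : (x.drop 1).source = E.rng (x.seq 0) := (x.isPath 0).symm

@[simp] theorem seq_cons_zero (e : A) (x : E.InfPath) (h : E.rng e = x.source) :
    (cons e x h).seq 0 = e := rfl

@[simp] theorem drop_cons (e : A) (x : E.InfPath) (h : E.rng e = x.source) :
    (cons e x h).drop 1 = x := by
  ext n; simp [drop, cons, add_comm 1 n]

theorem cons_drop (x : E.InfPath) : cons (x.seq 0) (x.drop 1) x.source_drop_one.symm = x := by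
  ext n
  cases n with
  | zero => rfl
  | succ n => simp [cons, add_comm 1 n]

theorem seq_eq_of_take_eq {x y : E.InfPath} {n k : ℕ} (h : x.take n = y.take n) (hk : k < n) :
    x.seq k = y.seq k := by
  have := congrArg (fun l => l[k]?) h
  simpa [take, hk] using this

theorem ext_of_take {x y : E.InfPath} (h : ∀ n, x.take n = y.take n) : x = y := by
  ext k
  exact seq_eq_of_take_eq (h (k + 1)) k.lt_succ_self

theorem take_eq_of_le {x y : E.InfPath} {m n : ℕ} (hm : m ≤ n) (h : x.take n = y.take n) :
    x.take m = y.take m := by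
  obtain ⟨k, rfl⟩ := Nat.exists_eq_add_of_le hm
  rw [take_add, take_add] at h
  exact (List.append_inj h (by simp)).1

theorem isWalk_take (n : ℕ) (x : E.InfPath) : E.IsWalk x.source (x.take n) := by
  induction n generalizing x with
  | zero => trivial
  | succ n ih =>
    rw [take_succ]
    exact ⟨rfl, x.source_drop_one ▸ ih (x.drop 1)⟩

theorem walkEnd_take (n : ℕ) (x : E.InfPath) :
    E.walkEnd x.source (x.take n) = (x.drop n).source := by
  induction n generalizing x with
  | zero => simp [walkEnd]
  | succ n ih =>
    rw [take_succ, walkEnd, ← x.source_drop_one, ih, drop_drop, add_comm]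

/-! ### Prefixes and concatenation of infinite paths -/

/-- The initial segment of length `n`, as a finite path. -/
def takePath (n : ℕ) (x : E.InfPath) : E.FinPath := ⟨x.source, x.take n, x.isWalk_take n⟩

/-- The infinite path starts at `v` with the edges in `l`. -/
def StartsWith (x : E.InfPath) (v : V) (l : List A) : Prop := x.source = v ∧ x.take l.length = l

theorem startsWith_nil {x : E.InfPath} {v : V} : x.StartsWith v [] ↔ x.source = v := by
  simp [StartsWith]

theorem startsWith_cons {x : E.InfPath} {v : V} {e : A} {l : List A} :
    x.StartsWith v (e :: l) ↔
      x.source = v ∧ x.seq 0 = e ∧ (x.drop 1).StartsWith (E.rng e) l := by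
  rw [StartsWith, List.length_cons, take_succ, List.cons.injEq, StartsWith, source_drop_one]
  constructor
  · rintro ⟨h1, h2, h3⟩
    exact ⟨h1, h2, by rw [h2], h3⟩
  · rintro ⟨h1, h2, -, h3⟩
    exact ⟨h1, h2, h3⟩

theorem startsWith_append {x : E.InfPath} {v : V} {l k : List A} :
    x.StartsWith v (l ++ k) ↔ x.StartsWith v l ∧ (x.drop l.length).take k.length = k := by
  rw [StartsWith, List.length_append, take_add, StartsWith, and_assoc]
  refine and_congr_right fun _ => ⟨fun h => List.append_inj h (by simp), fun h => by rw [h.1, h.2]⟩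

theorem StartsWith.source_drop {x : E.InfPath} {v : V} {l : List A} (h : x.StartsWith v l) :
    (x.drop l.length).source = E.walkEnd v l := by
  obtain ⟨rfl, h⟩ := h
  rw [← walkEnd_take, h]

/-- Two paths with a common prefix extension are comparable. -/
theorem StartsWith.comparable {x : E.InfPath} {v w : V} {l k : List A} (h : x.StartsWith v l)
    (h' : x.StartsWith w k) : v = w ∧ ((∃ t, k = l ++ t) ∨ ∃ t, l = k ++ t) := by
  refine ⟨h.1.symm.trans h'.1, ?_⟩
  rcases le_total l.length k.length with hl | hl
  · obtain ⟨n, hn⟩ := Nat.exists_eq_add_of_le hl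
    have := h'.2
    rw [hn, take_add, h.2] at this
    exact .inl ⟨_, this.symm⟩
  · obtain ⟨n, hn⟩ := Nat.exists_eq_add_of_le hl
    have := h.2
    rw [hn, take_add, h'.2] at this
    exact .inr ⟨_, this.symm⟩

/-- A finite path can be composed with an infinite path that starts at its range. -/
theorem exists_append {v : V} {l : List A} (hl : E.IsWalk v l) (x : E.InfPath)
    (hx : x.source = E.walkEnd v l) :
    ∃ y : E.InfPath, y.StartsWith v l ∧ y.drop l.length = x := by
  induction l generalizing v with
  | nil => exact ⟨x, startsWith_nil.2 hx, by simp⟩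
  | cons e l ih =>
    obtain ⟨y, hy, hy'⟩ := ih hl.2 hx
    refine ⟨cons e y hy.1.symm, startsWith_cons.2 ⟨hl.1, rfl, by simpa using hy⟩, ?_⟩
    rw [List.length_cons, add_comm, ← drop_drop, drop_cons, hy']

theorem eq_of_startsWith {x y : E.InfPath} {v : V} {l : List A} (hx : x.StartsWith v l)
    (hy : y.StartsWith v l) (h : x.drop l.length = y.drop l.length) : x = y := by
  refine ext_of_take fun n => take_eq_of_le (Nat.le_add_left n l.length) ?_
  rw [take_add, take_add, hx.2, hy.2, h]

theorem exists_source (hE : ∀ v, ∃ e, E.src e = v) (v : V) : ∃ x : E.InfPath, x.source = v := by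
  choose f hf using hE
  let g : ℕ → V := fun n => Nat.rec v (fun _ w => E.rng (f w)) n
  exact ⟨⟨fun n => f (g n), fun n => (hf (E.rng (f (g n)))).symm⟩, hf v⟩

theorem exists_startsWith (hE : ∀ v, ∃ e, E.src e = v) {v : V} {l : List A} (hl : E.IsWalk v l) :
    ∃ x : E.InfPath, x.StartsWith v l := by
  obtain ⟨x, hx⟩ := exists_source hE (E.walkEnd v l)
  obtain ⟨y, hy, -⟩ := exists_append hl x hx
  exact ⟨y, hy⟩

/-! ### Cylinder topology and compactness -/

/-- Two infinite paths have the same source and agree in the first `n` edges. -/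
def Agree (n : ℕ) (x y : E.InfPath) : Prop := x.source = y.source ∧ x.take n = y.take n

theorem Agree.symm {n : ℕ} {x y : E.InfPath} (h : Agree n x y) : Agree n y x :=
  ⟨h.1.symm, h.2.symm⟩

theorem Agree.trans {n : ℕ} {x y z : E.InfPath} (h : Agree n x y) (h' : Agree n y z) :
    Agree n x z := ⟨h.1.trans h'.1, h.2.trans h'.2⟩

theorem Agree.mono {m n : ℕ} (hm : m ≤ n) {x y : E.InfPath} (h : Agree n x y) : Agree m x y :=
  ⟨h.1, take_eq_of_le hm h.2⟩

/-- The extra edge is what fixes the source: for n = 0 the empty initial segment would say nothing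
about it. -/
theorem agree_of_take_succ {n : ℕ} {x y : E.InfPath} (h : x.take (n + 1) = y.take (n + 1)) :
    Agree n x y :=
  ⟨congrArg E.src (seq_eq_of_take_eq h n.succ_pos), take_eq_of_le n.le_succ h⟩

theorem Agree.startsWith {n : ℕ} {x y : E.InfPath} (h : Agree n x y) {v : V} {l : List A}
    (hl : l.length ≤ n) (hx : x.StartsWith v l) : y.StartsWith v l :=
  ⟨h.1.symm.trans hx.1, (take_eq_of_le hl h.2).symm.trans hx.2⟩

theorem eq_of_agree {x y : E.InfPath} (h : ∀ n, Agree n x y) : x = y :=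
  ext_of_take fun n => (h n).2

/-- The space of infinite paths of a finite graph is compact. -/
theorem exists_limit [Finite A] (x : ℕ → E.InfPath) :
    ∃ y : E.InfPath, ∀ n, ∀ᶠ m in (Filter.hyperfilter ℕ : Filter ℕ), Agree n (x m) y := by
  -- An ultrafilter on a finite alphabet is principal, so each coordinate has a limit along a fixed
  -- free ultrafilter on ℕ.
  have h1 : ∀ k, ∃ a, ∀ᶠ m in (Filter.hyperfilter ℕ : Filter ℕ), (x m).seq k = a := fun k => by
    obtain ⟨a, ha⟩ := ((Filter.hyperfilter ℕ).map fun m => (x m).seq k).eq_pure_of_finite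
    refine ⟨a, ?_⟩
    have : ({a} : Set A) ∈ (Filter.hyperfilter ℕ).map fun m => (x m).seq k := by
      rw [ha]; exact Set.mem_singleton a
    exact this
  choose a ha using h1
  have h2 : ∀ n, ∀ᶠ m in (Filter.hyperfilter ℕ : Filter ℕ), ∀ k < n, (x m).seq k = a k := fun n =>
    (Filter.eventually_all_finite (Set.finite_lt_nat n)).2 fun k _ => ha k
  refine ⟨⟨a, fun n => ?_⟩, fun n => ?_⟩
  -- Two consecutive limit edges occur together in a single x m, hence they are composable.
  · obtain ⟨m, hm⟩ := (h2 (n + 2)).exists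
    rw [← hm n (by omega), ← hm (n + 1) (by omega)]
    exact (x m).isPath n
  · filter_upwards [h2 (n + 1)] with m hm
    refine agree_of_take_succ ?_
    exact List.map_congr_left fun k hk => hm k (List.mem_range.1 hk)

/-- An infinite path in a finite graph visits some vertex twice. -/
theorem exists_source_drop_eq [Finite V] (x : E.InfPath) :
    ∃ i n, 0 < n ∧ (x.drop i).source = ((x.drop i).drop n).source := by
  obtain ⟨i, j, hij, h⟩ := Finite.exists_ne_map_eq_of_infinite fun i => (x.drop i).source
  rcases lt_or_gt_of_ne hij with hl | hl
  · exact ⟨i, j - i, by omega, by rw [drop_drop, h]; congr 2; omega⟩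
  · exact ⟨j, i - j, by omega, by rw [drop_drop, ← h]; congr 2; omega⟩

theorem isCycle_takePath {x : E.InfPath} {n : ℕ} (hn : 0 < n) (h : x.source = (x.drop n).source) :
    (x.takePath n).IsCycle := by
  refine ⟨by simpa [FinPath.length, takePath] using hn, ?_⟩
  exact (walkEnd_take n x).trans h.symm

theorem mem_take {x : E.InfPath} {n : ℕ} {e : A} (h : e ∈ x.take n) : ∃ k < n, x.seq k = e := by
  simpa [take] using h

/-- If every cycle has an exit, then every vertex is the source of two infinite paths. -/
theorem exists_ne_source [Finite V] (hE : E.IsAdmissible) (v : V) :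
    ∃ x y : E.InfPath, x ≠ y ∧ x.source = v ∧ y.source = v := by
  obtain ⟨x, hx⟩ := exists_source hE.no_sinks v
  -- A repeated vertex on x closes a cycle inside x. The second path follows x up to an exit of this
  -- cycle and leaves it there.
  obtain ⟨i, n, hn, h⟩ := x.exists_source_drop_eq
  obtain ⟨e, he, f, g, hfg, hf, hg⟩ := hE.exits _ (isCycle_takePath hn h)
  obtain ⟨k, -, hk⟩ := mem_take he
  rw [seq_drop] at hk
  obtain ⟨f', hf', hne⟩ : ∃ f', E.src f' = E.src e ∧ f' ≠ e := by
    by_cases hfe : f = e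
    · exact ⟨g, hg, fun h => hfg (hfe.trans h.symm)⟩
    · exact ⟨f, hf, hfe⟩
  obtain ⟨z, hz⟩ := exists_source hE.no_sinks (E.rng f')
  have hw : E.walkEnd v (x.take (i + k)) = E.src f' := by
    rw [← hx, walkEnd_take, hf', ← hk]; rfl
  obtain ⟨y, hy, hy'⟩ := exists_append (hx ▸ x.isWalk_take (i + k)) (cons f' z hz.symm) hw.symm
  refine ⟨x, y, ?_, hx, hy.1⟩
  rintro rfl
  rw [length_take] at hy'
  apply hne
  rw [← hk, ← seq_cons_zero f' z hz.symm, ← hy']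
  rfl

end InfPath

end DirectedGraph

/-! ### Monomials and diagonal elements of Leavitt families -/

namespace DirectedGraph

variable {V A : Type*}

theorem isWalk_append {E : DirectedGraph V A} {v : V} {l k : List A} :
    E.IsWalk v (l ++ k) ↔ E.IsWalk v l ∧ E.IsWalk (E.walkEnd v l) k := by
  induction l generalizing v with
  | nil => simp [IsWalk, walkEnd]
  | cons e l ih => rw [List.cons_append, IsWalk, IsWalk, walkEnd, ih, and_assoc]

namespace LeavittFamily

variable [Fintype V] [Fintype A] {E : DirectedGraph V A} {B : Type*} [Ring B] [StarRing B]
variable (F : LeavittFamily E B)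

/-- The element `P_v S_{e₁} S_{e₂} ⋯` for a list of edges. -/
def word (v : V) (l : List A) : B := F.P v * (l.map F.S).prod

/-- The element `x x^*` for the monomial `x = P_v S_{e₁} S_{e₂} ⋯`. -/
def proj (v : V) (l : List A) : B := F.word v l * star (F.word v l)

@[simp] theorem word_nil (v : V) : F.word v [] = F.P v := by simp [word]

theorem P_mul_word (v : V) (l : List A) : F.P v * F.word v l = F.word v l := by
  rw [word, ← mul_assoc, F.idem]

theorem P_mul_word_of_ne {v w : V} (h : v ≠ w) (l : List A) : F.P v * F.word w l = 0 := by
  rw [word, ← mul_assoc, F.orth _ _ h, zero_mul]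

theorem word_cons (v : V) (e : A) (l : List A) :
    F.word v (e :: l) = F.P v * (F.S e * F.word (E.rng e) l) := by
  rw [word, word, List.map_cons, List.prod_cons, ← mul_assoc (F.S e), F.S_mul_P]

theorem word_src_cons (e : A) (l : List A) :
    F.word (E.src e) (e :: l) = F.S e * F.word (E.rng e) l := by
  rw [word_cons, ← mul_assoc, F.P_mul_S]

theorem word_cons_of_ne {v : V} {e : A} (h : E.src e ≠ v) (l : List A) :
    F.word v (e :: l) = 0 := by
  rw [word_cons, ← F.P_mul_S, ← mul_assoc, ← mul_assoc, F.orth _ _ h.symm, zero_mul, zero_mul]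

/-- Words are built from arbitrary lists, so that sums can run over the full product of `V` and `Fin
n → A`; the lists that are not walks contribute nothing. -/
theorem word_eq_zero {v : V} {l : List A} (h : ¬ E.IsWalk v l) : F.word v l = 0 := by
  induction l generalizing v with
  | nil => exact absurd trivial h
  | cons e l ih =>
    by_cases hv : E.src e = v
    · rw [word_cons, ih fun hl => h ⟨hv, hl⟩, mul_zero, mul_zero]
    · exact F.word_cons_of_ne hv l

theorem word_append (v : V) (l k : List A) :
    F.word v (l ++ k) = F.word v l * F.word (E.walkEnd v l) k := by
  induction l generalizing v with
  | nil => rw [word_nil]; exact (F.P_mul_word v k).symm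
  | cons e l ih => rw [List.cons_append, word_cons, ih, word_cons, walkEnd]; simp only [mul_assoc]

theorem star_word_mul_word_append {v : V} {l : List A} (h : E.IsWalk v l) (k : List A) :
    star (F.word v l) * F.word v (l ++ k) = F.word (E.walkEnd v l) k := by
  induction l generalizing v with
  | nil => rw [word_nil, F.star_P]; exact F.P_mul_word v k
  | cons e l ih =>
    obtain ⟨rfl, h⟩ := h
    rw [List.cons_append, word_src_cons, word_src_cons, star_mul, mul_assoc,
      ← mul_assoc (star (F.S e)), F.star_S_mul_self, P_mul_word, ih h, walkEnd]

theorem star_word_append_mul_word {v : V} {l : List A} (h : E.IsWalk v l) (k : List A) :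
    star (F.word v (l ++ k)) * F.word v l = star (F.word (E.walkEnd v l) k) := by
  rw [← F.star_word_mul_word_append h, star_mul, star_star]

theorem star_word_mul_word_of_ne {v w : V} (h : v ≠ w) (l k : List A) :
    star (F.word v l) * F.word w k = 0 := by
  rw [← F.P_mul_word v l, star_mul, F.star_P, mul_assoc, F.P_mul_word_of_ne h, mul_zero]

/-- Common first edges cancel in the middle of the product. This goes on until two different edges
meet, which gives zero, or one of the lists is exhausted. -/
theorem comparable_of_star_word_mul_word_ne_zero {v w : V} {l k : List A}
    (h : star (F.word v l) * F.word w k ≠ 0) :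
    v = w ∧ E.IsWalk v l ∧ E.IsWalk w k ∧ ((∃ t, k = l ++ t) ∨ ∃ t, l = k ++ t) := by
  obtain rfl : v = w := by_contra fun hv => h (F.star_word_mul_word_of_ne hv l k)
  have hl : E.IsWalk v l := by_contra fun h' => h (by rw [F.word_eq_zero h', star_zero, zero_mul])
  have hk : E.IsWalk v k := by_contra fun h' => h (by rw [F.word_eq_zero h', mul_zero])
  refine ⟨rfl, hl, hk, ?_⟩
  induction l generalizing v k with
  | nil => exact .inl ⟨k, rfl⟩
  | cons e l ih =>
    cases k with
    | nil => exact .inr ⟨e :: l, rfl⟩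
    | cons f k =>
      obtain ⟨rfl, hl⟩ := hl
      rw [word_src_cons, ← hk.1, word_src_cons, star_mul, mul_assoc,
        ← mul_assoc (star (F.S e))] at h
      obtain rfl : e = f := by_contra fun hef => h (by
        rw [F.star_S_mul_S e f hef, zero_mul, mul_zero])
      rw [F.star_S_mul_self, P_mul_word] at h
      rcases ih h hl hk.2 with ⟨t, rfl⟩ | ⟨t, rfl⟩
      · exact .inl ⟨t, rfl⟩
      · exact .inr ⟨t, rfl⟩

/-! ### Projections of words -/

theorem star_proj (v : V) (l : List A) : star (F.proj v l) = F.proj v l := by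
  rw [proj, star_mul, star_star]

theorem proj_eq_zero {v : V} {l : List A} (h : ¬ E.IsWalk v l) : F.proj v l = 0 := by
  rw [proj, F.word_eq_zero h, zero_mul]

theorem proj_mul_proj_append (v : V) (l k : List A) :
    F.proj v l * F.proj v (l ++ k) = F.proj v (l ++ k) := by
  by_cases h : E.IsWalk v l
  · calc _ = F.word v l * (star (F.word v l) * F.word v (l ++ k)) * star (F.word v (l ++ k)) := by
          simp only [proj, mul_assoc]
      _ = _ := by rw [F.star_word_mul_word_append h, ← word_append, proj]
  · rw [F.proj_eq_zero h, F.proj_eq_zero fun h' => h (isWalk_append.1 h').1, zero_mul]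

theorem proj_mul_proj_self (v : V) (l : List A) : F.proj v l * F.proj v l = F.proj v l := by
  simpa using F.proj_mul_proj_append v l []

theorem proj_mul_proj_of_not_prefix {v w : V} {l k : List A} (hlk : l.length ≤ k.length)
    (h : ¬ (v = w ∧ ∃ t, k = l ++ t)) : F.proj v l * F.proj w k = 0 := by
  have : star (F.word v l) * F.word w k = 0 := by
    by_contra h'
    obtain ⟨rfl, -, -, h1 | ⟨t, rfl⟩⟩ := F.comparable_of_star_word_mul_word_ne_zero h'
    · exact h ⟨rfl, h1⟩
    · refine h ⟨rfl, [], ?_⟩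
      obtain rfl : t = [] := List.eq_nil_of_length_eq_zero (by
        rw [List.length_append] at hlk; omega)
      simp
  calc _ = F.word v l * (star (F.word v l) * F.word w k) * star (F.word w k) := by
        simp only [proj, mul_assoc]
    _ = 0 := by rw [this, mul_zero, zero_mul]

theorem sum_S_mul_star_S (hE : ∀ v, ∃ e, E.src e = v) : ∑ e, F.S e * star (F.S e) = 1 := by
  classical
  rw [← F.sum_P, ← Finset.sum_fiberwise Finset.univ E.src]
  refine Finset.sum_congr rfl fun v _ => ?_
  obtain ⟨e, he⟩ := hE v
  rw [F.P_eq_sum v ⟨e, he ▸ E.mem_outEdges e⟩]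
  refine Finset.sum_congr ?_ fun _ _ => rfl
  ext; simp [outEdges]

/-- Peeling off the first edge reduces length n + 1 to length n; since there are no sinks, the range
projections of the edges add up to 1. -/
theorem sum_proj (hE : ∀ v, ∃ e, E.src e = v) (n : ℕ) (v : V) :
    ∑ w : Fin n → A, F.proj v (List.ofFn w) = F.P v := by
  induction n generalizing v with
  | zero => simp [proj, F.star_P, F.idem]
  | succ n ih =>
    rw [← (Fin.consEquiv fun _ => A).sum_comp, Fintype.sum_prod_type]
    calc _ = ∑ e, F.P v * (F.S e * star (F.S e)) * F.P v := by
          refine Finset.sum_congr rfl fun e _ => ?_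
          have h1 : ∀ w : Fin n → A, F.proj v (List.ofFn (Fin.consEquiv (fun _ => A) (e, w))) =
              F.P v * F.S e * F.proj (E.rng e) (List.ofFn w) * (star (F.S e) * F.P v) := fun w => by
            simp [Fin.consEquiv, List.ofFn_succ, proj, word_cons, F.star_P, mul_assoc]
          rw [Finset.sum_congr rfl fun w _ => h1 w, ← Finset.sum_mul, ← Finset.mul_sum, ih,
            mul_assoc _ (F.S e), F.S_mul_P]
          simp only [mul_assoc]
      _ = F.P v := by
          rw [← Finset.sum_mul, ← Finset.mul_sum, F.sum_S_mul_star_S hE, mul_one, F.idem]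

theorem map_word {C : Type*} [Ring C] [StarRing C] {G : LeavittFamily E C} {φ : B →+* C}
    (hP : ∀ v, φ (F.P v) = G.P v) (hS : ∀ e, φ (F.S e) = G.S e) (v : V) (l : List A) :
    φ (F.word v l) = G.word v l := by
  rw [word, map_mul, hP, map_list_prod, List.map_map, word]
  congr 3
  ext e; exact hS e

section Diagonal

variable {R : Type*} [CommRing R] [StarRing R] [Algebra R B] [StarModule R B]

open scoped Classical in
/-- The `*`-homomorphism which maps functions on the set of words of length `n` to linear
combinations of the projections of these words. -/
noncomputable def diagonalHom (R : Type*) [CommRing R] [StarRing R] [Algebra R B] [StarModule R B]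
    (hE : ∀ v, ∃ e, E.src e = v) (n : ℕ) : (V × (Fin n → A) → R) →⋆ₐ[R] B where
  toFun c := ∑ i, c i • F.proj i.1 (List.ofFn i.2)
  map_zero' := by simp
  map_add' c d := by simp [add_smul, Finset.sum_add_distrib]
  map_one' := by
    simp only [Pi.one_apply, one_smul, Fintype.sum_prod_type, F.sum_proj hE, F.sum_P]
  map_mul' c d := by
    rw [Finset.sum_mul]
    refine Finset.sum_congr rfl fun i _ => ?_
    rw [Finset.mul_sum, Finset.sum_eq_single i]
    · rw [smul_mul_smul_comm, F.proj_mul_proj_self, Pi.mul_apply]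
    · intro j _ hj
      -- Words of equal length are orthogonal unless equal, because a prefix of full length is the
      -- whole word.
      rw [smul_mul_smul_comm, F.proj_mul_proj_of_not_prefix (by simp), smul_zero]
      rintro ⟨h1, t, ht⟩
      obtain rfl : t = [] := by
        have := congrArg List.length ht
        simpa using this
      rw [List.append_nil] at ht
      exact hj (Prod.ext h1.symm (List.ofFn_injective ht))
    · simp
  commutes' r := by
    simp only [Pi.algebraMap_apply, Algebra.algebraMap_self, RingHom.id_apply, ← Finset.smul_sum,
      Fintype.sum_prod_type, F.sum_proj hE, F.sum_P, Algebra.algebraMap_eq_smul_one]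
  map_star' c := by simp [star_sum, star_smul, F.star_proj]

theorem diagonalHom_apply (hE : ∀ v, ∃ e, E.src e = v) (n : ℕ) (c : V × (Fin n → A) → R) :
    F.diagonalHom R hE n c = ∑ i, c i • F.proj i.1 (List.ofFn i.2) := rfl

open scoped Classical in
-- Multiply by 1, written as the sum of all projections of length n: those which extend the given
-- word survive unchanged, the others are annihilated.
theorem proj_eq_diagonalHom (hE : ∀ v, ∃ e, E.src e = v) {v : V} {l : List A} {n : ℕ}
    (hn : l.length ≤ n) :
    F.proj v l = F.diagonalHom R hE n
      fun i => if v = i.1 ∧ ∃ t, List.ofFn i.2 = l ++ t then 1 else 0 := by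
  have h1 : F.proj v l = F.proj v l * F.diagonalHom R hE n 1 := by rw [map_one, mul_one]
  rw [h1, diagonalHom_apply, diagonalHom_apply, Finset.mul_sum]
  refine Finset.sum_congr rfl fun i _ => ?_
  rw [Pi.one_apply, one_smul]
  split_ifs with h
  · obtain ⟨rfl, t, ht⟩ := h
    rw [ht, one_smul, proj_mul_proj_append]
  · rw [zero_smul, F.proj_mul_proj_of_not_prefix (by simpa using hn) h]

/-- The set of all finite linear combinations of projections, as a subalgebra. -/
noncomputable def diagonalSubalgebra (R : Type*) [CommRing R] [StarRing R] [Algebra R B]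
    [StarModule R B] (hE : ∀ v, ∃ e, E.src e = v) : StarSubalgebra R B where
  -- Asking for all large n, rather than for some n, brings two elements to a common level without
  -- having to refine either of them.
  carrier := {d | ∃ N, ∀ n, N ≤ n → d ∈ (F.diagonalHom R hE n).range}
  mul_mem' := by
    rintro a b ⟨N, hN⟩ ⟨M, hM⟩
    exact ⟨max N M, fun n hn => mul_mem (hN n (le_of_max_le_left hn)) (hM n (le_of_max_le_right hn))⟩
  add_mem' := by
    rintro a b ⟨N, hN⟩ ⟨M, hM⟩
    exact ⟨max N M, fun n hn => add_mem (hN n (le_of_max_le_left hn)) (hM n (le_of_max_le_right hn))⟩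
  algebraMap_mem' r := ⟨0, fun n _ => algebraMap_mem _ r⟩
  star_mem' := by
    rintro a ⟨N, hN⟩
    exact ⟨N, fun n hn => star_mem (hN n hn)⟩

theorem proj_mem_diagonalSubalgebra (hE : ∀ v, ∃ e, E.src e = v) (v : V) (l : List A) :
    F.proj v l ∈ F.diagonalSubalgebra R hE :=
  ⟨l.length, fun _ hn => ⟨_, (F.proj_eq_diagonalHom hE hn).symm⟩⟩

end Diagonal

end LeavittFamily

end DirectedGraph

/-! ### The representation of `C*(E)` on `ℓ²` of the infinite paths -/

namespace DirectedGraph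

open lp

variable {V A : Type*} (E : DirectedGraph V A)

open scoped Classical in
/-- The partial bijection `(x, n) ↦ (e x, n + 1)`. -/
noncomputable def edgePEquiv (e : A) : PEquiv (E.InfPath × ℤ) (E.InfPath × ℤ) where
  toFun k := if h : E.rng e = k.1.source then some (.cons e k.1 h, k.2 + 1) else none
  invFun k := if k.1.seq 0 = e then some (k.1.drop 1, k.2 - 1) else none
  inv k j := by
    obtain ⟨x, n⟩ := k
    obtain ⟨y, m⟩ := j
    constructor
    · intro h
      split_ifs at h with h1
      · simp only [Option.some.injEq, Prod.mk.injEq] at h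
        obtain ⟨rfl, rfl⟩ := h
        subst h1
        rw [dif_pos y.source_drop_one.symm]
        simp [InfPath.cons_drop]
    · intro h
      split_ifs at h with h1
      · simp only [Option.some.injEq, Prod.mk.injEq] at h
        obtain ⟨rfl, rfl⟩ := h
        simp

open scoped Classical in
/-- The identity on the set of all `(x, n)` such that the source of `x` is `v`. -/
noncomputable def vertexPEquiv (v : V) : PEquiv (E.InfPath × ℤ) (E.InfPath × ℤ) :=
  PEquiv.ofSet {k | k.1.source = v}

open scoped Classical in
theorem vertex_toOperator_basisVector (v : V) (x : E.InfPath) (n : ℤ) :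
    (E.vertexPEquiv v).toOperator (basisVector (x, n)) =
      if x.source = v then basisVector (x, n) else 0 := by
  rw [PEquiv.toOperator_basisVector]
  by_cases h : x.source = v <;> simp [vertexPEquiv, PEquiv.ofSet, h]

theorem edge_toOperator_basisVector (e : A) (x : E.InfPath) (n : ℤ) (h : E.rng e = x.source) :
    (E.edgePEquiv e).toOperator (basisVector (x, n)) = basisVector (.cons e x h, n + 1) := by
  rw [PEquiv.toOperator_basisVector]
  simp [edgePEquiv, h]

theorem edge_toOperator_basisVector_of_ne (e : A) (x : E.InfPath) (n : ℤ)
    (h : E.rng e ≠ x.source) : (E.edgePEquiv e).toOperator (basisVector (x, n)) = 0 := by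
  rw [PEquiv.toOperator_basisVector]
  simp [edgePEquiv, h]

open scoped Classical in
theorem star_edge_toOperator_basisVector (e : A) (x : E.InfPath) (n : ℤ) :
    star (E.edgePEquiv e).toOperator (basisVector (x, n)) =
      if x.seq 0 = e then basisVector (x.drop 1, n - 1) else 0 := by
  rw [PEquiv.star_toOperator, PEquiv.toOperator_basisVector]
  change (if x.seq 0 = e then some (x.drop 1, n - 1) else none : Option _).elim 0 basisVector = _
  split_ifs <;> rfl

theorem edge_toOperator_mul_star (e : A) (x : E.InfPath) (n : ℤ) (h : x.seq 0 = e) :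
    (E.edgePEquiv e).toOperator (basisVector (x.drop 1, n - 1)) = basisVector (x, n) := by
  subst h
  rw [edge_toOperator_basisVector _ _ _ _ x.source_drop_one.symm, InfPath.cons_drop]
  simp

variable [Fintype V] [Fintype A]

/-- The Cuntz–Krieger family acting on `ℓ²(X × ℤ)`, where `X` is the set of infinite paths. -/
noncomputable def pathSpaceFamily : CuntzKriegerFamily E
    (lp (fun _ : E.InfPath × ℤ => ℂ) 2 →L[ℂ] lp (fun _ : E.InfPath × ℤ => ℂ) 2) where
  p v := (E.vertexPEquiv v).toOperator
  s e := (E.edgePEquiv e).toOperator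
  star_p v := by rw [PEquiv.star_toOperator, vertexPEquiv, PEquiv.ofSet_symm]
  idem v := operator_ext fun ⟨x, n⟩ => by
    change (E.vertexPEquiv v).toOperator ((E.vertexPEquiv v).toOperator _) = _
    rw [vertex_toOperator_basisVector]
    split_ifs with h
    · rw [vertex_toOperator_basisVector, if_pos h]
    · rw [map_zero]
  orth v w h := operator_ext fun ⟨x, n⟩ => by
    change (E.vertexPEquiv v).toOperator ((E.vertexPEquiv w).toOperator _) = 0
    rw [vertex_toOperator_basisVector]
    split_ifs with h'
    · rw [vertex_toOperator_basisVector, if_neg fun h'' => h (h''.symm.trans h')]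
    · rw [map_zero]
  star_s_mul_s e := operator_ext fun ⟨x, n⟩ => by
    change star (E.edgePEquiv e).toOperator ((E.edgePEquiv e).toOperator _) = _
    rw [vertex_toOperator_basisVector]
    split_ifs with h
    · rw [edge_toOperator_basisVector _ _ _ _ h.symm, star_edge_toOperator_basisVector]
      simp
    · rw [edge_toOperator_basisVector_of_ne _ _ _ _ (Ne.symm h), map_zero]
  p_eq_sum v _ := operator_ext fun ⟨x, n⟩ => by
    classical
    rw [_root_.sum_apply, vertex_toOperator_basisVector]
    -- Only the first edge of x contributes to the sum at x.
    have h1 : ∀ e, ((E.edgePEquiv e).toOperator * star (E.edgePEquiv e).toOperator)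
        (basisVector (x, n)) = open scoped Classical in
          if x.seq 0 = e then basisVector (x, n) else 0 := fun e => by
      change (E.edgePEquiv e).toOperator (star (E.edgePEquiv e).toOperator _) = _
      rw [star_edge_toOperator_basisVector]
      split_ifs with h
      · rw [edge_toOperator_mul_star _ _ _ _ h]
      · rw [map_zero]
    rw [Finset.sum_congr rfl fun e _ => h1 e, Finset.sum_ite_eq]
    by_cases hv : E.src (x.seq 0) = v <;> simp [outEdges, InfPath.source, hv]
  sum_p := operator_ext fun ⟨x, n⟩ => by
    classical
    rw [_root_.sum_apply]
    simp [vertex_toOperator_basisVector]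

/-- The representation of `C*(E)` on `ℓ²(X × ℤ)`, where `X` is the set of infinite paths. -/
noncomputable def pathSpaceRep : GraphCStar E →⋆ₐ[ℂ]
    (lp (fun _ : E.InfPath × ℤ => ℂ) 2 →L[ℂ] lp (fun _ : E.InfPath × ℤ => ℂ) 2) :=
  GraphCStar.lift E.pathSpaceFamily

/-- The Leavitt family underlying `pathSpaceFamily`. -/
noncomputable def pathSpaceLeavittFamily : LeavittFamily E
    (lp (fun _ : E.InfPath × ℤ => ℂ) 2 →L[ℂ] lp (fun _ : E.InfPath × ℤ => ℂ) 2) :=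
  E.pathSpaceFamily.toLeavittFamily

open scoped Classical in
theorem P_basisVector (v : V) (x : E.InfPath) (n : ℤ) :
    E.pathSpaceLeavittFamily.P v (basisVector (x, n)) =
      if x.source = v then basisVector (x, n) else 0 :=
  E.vertex_toOperator_basisVector v x n

theorem S_basisVector (x : E.InfPath) (n : ℤ) :
    E.pathSpaceLeavittFamily.S (x.seq 0) (basisVector (x.drop 1, n)) = basisVector (x, n + 1) := by
  have := edge_toOperator_mul_star E _ x (n + 1) rfl
  rwa [add_sub_cancel_right] at this

open scoped Classical in
theorem star_S_basisVector (e : A) (x : E.InfPath) (n : ℤ) :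
    star (E.pathSpaceLeavittFamily.S e) (basisVector (x, n)) =
      if x.seq 0 = e then basisVector (x.drop 1, n - 1) else 0 :=
  E.star_edge_toOperator_basisVector e x n

variable {E}

theorem toCStar_P (v : V) : E.toCStar (Leavitt.P ℤ E v) = GraphCStar.p E v :=
  LeavittFamily.lift_P _ v

theorem toCStar_S (e : A) : E.toCStar (Leavitt.S ℤ E e) = GraphCStar.s E e :=
  LeavittFamily.lift_S _ e

theorem leavittPath_eq (μ : E.FinPath) :
    E.leavittPath μ = (Leavitt.family ℤ E).word μ.source μ.edges := rfl

theorem toCStar_word (v : V) (l : List A) :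
    E.toCStar ((Leavitt.family ℤ E).word v l) = (GraphCStar.family E).word v l :=
  LeavittFamily.map_word (φ := (E.toCStar : Leavitt ℤ E →+* GraphCStar E)) _ toCStar_P toCStar_S v l

theorem toCStar_proj (v : V) (l : List A) :
    E.toCStar ((Leavitt.family ℤ E).proj v l) = (GraphCStar.family E).proj v l := by
  rw [LeavittFamily.proj, map_mul, map_star, toCStar_word, LeavittFamily.proj]

theorem pathSpaceRep_p (v : V) :
    E.pathSpaceRep (GraphCStar.p E v) = E.pathSpaceLeavittFamily.P v :=
  GraphCStar.lift_p _ v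

theorem pathSpaceRep_s (e : A) :
    E.pathSpaceRep (GraphCStar.s E e) = E.pathSpaceLeavittFamily.S e :=
  GraphCStar.lift_s _ e

theorem pathSpaceRep_word (v : V) (l : List A) :
    E.pathSpaceRep ((GraphCStar.family E).word v l) = E.pathSpaceLeavittFamily.word v l :=
  LeavittFamily.map_word (F := GraphCStar.family E) (φ := RingHomClass.toRingHom E.pathSpaceRep)
    pathSpaceRep_p pathSpaceRep_s v l

theorem star_word_basisVector (v : V) (l : List A) (x : E.InfPath) (n : ℤ)
    (h : x.StartsWith v l) :
    star (E.pathSpaceLeavittFamily.word v l) (basisVector (x, n)) =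
      basisVector (x.drop l.length, n - l.length) := by
  induction l generalizing v x n with
  | nil =>
    rw [InfPath.startsWith_nil] at h
    rw [LeavittFamily.word_nil, LeavittFamily.star_P, P_basisVector, if_pos h]
    simp
  | cons e l ih =>
    obtain ⟨rfl, rfl, h⟩ := InfPath.startsWith_cons.1 h
    rw [InfPath.source, LeavittFamily.word_src_cons, star_mul, mul_apply_eq_comp,
      star_S_basisVector, if_pos rfl, ih _ _ _ h, InfPath.drop_drop, List.length_cons, add_comm 1]
    congr 2
    push_cast; ring

theorem star_word_basisVector_of_not (v : V) (l : List A) (x : E.InfPath) (n : ℤ)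
    (h : ¬ x.StartsWith v l) :
    star (E.pathSpaceLeavittFamily.word v l) (basisVector (x, n)) = 0 := by
  induction l generalizing v x n with
  | nil =>
    rw [InfPath.startsWith_nil] at h
    rw [LeavittFamily.word_nil, LeavittFamily.star_P, P_basisVector, if_neg h]
  | cons e l ih =>
    by_cases hv : E.src e = v
    · subst hv
      rw [LeavittFamily.word_src_cons, star_mul, mul_apply_eq_comp, star_S_basisVector]
      split_ifs with h1
      · refine ih _ _ _ fun h2 => h (InfPath.startsWith_cons.2 ⟨by rw [InfPath.source, h1], h1, h2⟩)
      · rw [map_zero]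
    · rw [LeavittFamily.word_cons_of_ne _ hv, star_zero]; rfl

theorem word_basisVector (v : V) (l : List A) (x : E.InfPath) (n : ℤ) (h : x.StartsWith v l) :
    E.pathSpaceLeavittFamily.word v l (basisVector (x.drop l.length, n)) =
      basisVector (x, n + l.length) := by
  induction l generalizing v x n with
  | nil =>
    rw [InfPath.startsWith_nil] at h
    rw [LeavittFamily.word_nil, P_basisVector]
    simp [h]
  | cons e l ih =>
    obtain ⟨rfl, rfl, h⟩ := InfPath.startsWith_cons.1 h
    rw [InfPath.source, LeavittFamily.word_src_cons, mul_apply_eq_comp,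
      List.length_cons, add_comm l.length, ← InfPath.drop_drop, ih _ _ _ h, S_basisVector]
    congr 2
    push_cast; ring

/-- A word absorbs on the right the projection of the vertex where it ends. -/
theorem word_basisVector_of_not (v : V) (l : List A) (x : E.InfPath) (n : ℤ)
    (h : x.source ≠ E.walkEnd v l) :
    E.pathSpaceLeavittFamily.word v l (basisVector (x, n)) = 0 := by
  have h1 := E.pathSpaceLeavittFamily.word_append v l []
  rw [List.append_nil, LeavittFamily.word_nil] at h1
  rw [h1, mul_apply_eq_comp, P_basisVector, if_neg h, map_zero]

end DirectedGraph

/-! ### Evaluating diagonal elements at infinite paths -/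

namespace DirectedGraph

open lp

variable {V A : Type*} {E : DirectedGraph V A}

namespace InfPath

/-- The infinite path `x` starts with the finite path `μ`. -/
def HasPrefix (x : E.InfPath) (μ : E.FinPath) : Prop := x.StartsWith μ.source μ.edges

/-- Every infinite path lies in exactly one of the cylinders indexed by `V × (Fin n → A)`, the one
named by its own source and first n edges. Evaluating a sum over cylinders thereby selects one
coefficient. -/
theorem startsWith_ofFn {x : E.InfPath} {n : ℕ} {i : V × (Fin n → A)} :
    x.StartsWith i.1 (List.ofFn i.2) ↔ (x.source, fun k : Fin n => x.seq k) = i := by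
  have h : x.take n = List.ofFn fun k : Fin n => x.seq k := by
    refine List.ext_getElem (by simp) fun k hk _ => ?_
    simp [take]
  obtain ⟨v, w⟩ := i
  simp only [StartsWith, Prod.mk.injEq, List.length_ofFn, h]
  exact and_congr_right fun _ => List.ofFn_injective.eq_iff

theorem take_add_drop (x : E.InfPath) {v : V} {l : List A} (h : x.StartsWith v l) (n : ℕ) :
    x.take (l.length + n) = l ++ (x.drop l.length).take n := by
  rw [take_add, h.2]

end InfPath

variable [Fintype V] [Fintype A]

theorem norm_pathSpaceRep_le (a : GraphCStar E) : ‖E.pathSpaceRep a‖ ≤ ‖a‖ :=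
  NonUnitalStarAlgHom.norm_apply_le E.pathSpaceRep a

/-- The vector functional of `C*(E)` given by the basis vector of an infinite path. -/
noncomputable def evalAt (x : E.InfPath) : GraphCStar E →L[ℂ] ℂ :=
  LinearMap.mkContinuous
    -- The height 0 is arbitrary, as elements of the diagonal act alike at every height.
    { toFun := fun a => inner ℂ (basisVector (x, (0 : ℤ)))
        (E.pathSpaceRep a (basisVector (x, (0 : ℤ))))
      map_add' := fun a b => by rw [map_add, _root_.add_apply, inner_add_right]
      map_smul' := fun c a => by
        rw [map_smul, _root_.smul_apply, inner_smul_right]; rfl } 1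
    fun a => by
      have h : ‖basisVector (x, (0 : ℤ))‖ = 1 := norm_basisVector _
      calc _ ≤ ‖basisVector (x, (0 : ℤ))‖ * ‖E.pathSpaceRep a (basisVector (x, (0 : ℤ)))‖ :=
            norm_inner_le_norm _ _
        _ ≤ 1 * ‖a‖ := by
            rw [h]
            gcongr
            refine (ContinuousLinearMap.le_opNorm _ _).trans ?_
            rw [h, mul_one]
            exact norm_pathSpaceRep_le a

theorem evalAt_apply (x : E.InfPath) (a : GraphCStar E) : evalAt x a =
    inner ℂ (basisVector (x, (0 : ℤ))) (E.pathSpaceRep a (basisVector (x, (0 : ℤ)))) := rfl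

theorem norm_evalAt_le (x : E.InfPath) (a : GraphCStar E) : ‖evalAt x a‖ ≤ ‖a‖ := by
  have := (evalAt x).le_of_opNorm_le (LinearMap.mkContinuous_norm_le _ zero_le_one _) a
  rwa [one_mul] at this

/-- Projections of words have the form a a*, so it suffices to know whether a* sends the basis
vector of x to zero or to a basis vector. -/
theorem evalAt_mul_star (x : E.InfPath) (a : GraphCStar E) : evalAt x (a * star a) =
    inner ℂ (star (E.pathSpaceRep a) (basisVector (x, (0 : ℤ))))
      (star (E.pathSpaceRep a) (basisVector (x, (0 : ℤ)))) := by
  rw [evalAt_apply, map_mul, map_star, mul_apply_eq_comp, ContinuousLinearMap.star_eq_adjoint,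
    ContinuousLinearMap.adjoint_inner_left]

open scoped Classical in
theorem evalAt_proj (x : E.InfPath) (v : V) (l : List A) :
    evalAt x ((GraphCStar.family E).proj v l) = if x.StartsWith v l then 1 else 0 := by
  rw [LeavittFamily.proj, evalAt_mul_star, pathSpaceRep_word]
  split_ifs with h
  · rw [star_word_basisVector _ _ _ _ h, inner_basisVector, if_pos rfl]
  · rw [star_word_basisVector_of_not _ _ _ _ h, inner_zero_left]

theorem evalAt_diagonalHom (hE : ∀ v, ∃ e, E.src e = v) (x : E.InfPath) (n : ℕ)
    (c : V × (Fin n → A) → ℂ) :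
    evalAt x ((GraphCStar.family E).diagonalHom ℂ hE n c) = c (x.source, fun k => x.seq k) := by
  classical
  rw [LeavittFamily.diagonalHom_apply, map_sum]
  simp only [map_smul, evalAt_proj, InfPath.startsWith_ofFn]
  simp

theorem evalAt_toCStar_diagonalHom (hE : ∀ v, ∃ e, E.src e = v) (x : E.InfPath) (n : ℕ)
    (c : V × (Fin n → A) → ℤ) :
    evalAt x (E.toCStar ((Leavitt.family ℤ E).diagonalHom ℤ hE n c)) =
      c (x.source, fun k => x.seq k) := by
  classical
  rw [LeavittFamily.diagonalHom_apply, map_sum, map_sum]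
  simp only [map_zsmul, map_smul, toCStar_proj, evalAt_proj, InfPath.startsWith_ofFn]
  simp

theorem adjoin_eq_diagonalSubalgebra (hE : ∀ v, ∃ e, E.src e = v) :
    StarAlgebra.adjoin ℂ
      (Set.range fun μ : E.FinPath => E.cstarPath μ * star (E.cstarPath μ)) =
    (GraphCStar.family E).diagonalSubalgebra ℂ hE := by
  refine le_antisymm (StarAlgebra.adjoin_le ?_) ?_
  · rintro _ ⟨μ, rfl⟩
    exact LeavittFamily.proj_mem_diagonalSubalgebra _ hE _ _
  · rintro a ⟨N, hN⟩
    obtain ⟨c, rfl⟩ := hN N le_rfl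
    refine sum_mem fun i _ => SMulMemClass.smul_mem _ ?_
    by_cases hi : E.IsWalk i.1 (List.ofFn i.2)
    · exact StarAlgebra.subset_adjoin _ _ ⟨⟨_, _, hi⟩, rfl⟩
    · rw [LeavittFamily.proj_eq_zero _ hi]
      exact zero_mem _

theorem cstarDiagonal_eq (hE : ∀ v, ∃ e, E.src e = v) : E.cstarDiagonal =
    ((GraphCStar.family E).diagonalSubalgebra ℂ hE).topologicalClosure := by
  rw [cstarDiagonal, adjoin_eq_diagonalSubalgebra hE]

/-- This gives the normal form of diagonal elements: linear combinations of the projections of words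
of one common length. -/
theorem mem_leavittDiagonal_iff (hE : ∀ v, ∃ e, E.src e = v) {d : Leavitt ℤ E} :
    d ∈ E.leavittDiagonal ↔ d ∈ (Leavitt.family ℤ E).diagonalSubalgebra ℤ hE := by
  constructor
  · intro h
    have : E.leavittDiagonal ≤ ((Leavitt.family ℤ E).diagonalSubalgebra ℤ hE).toSubalgebra := by
      refine Algebra.adjoin_le ?_
      rintro _ ⟨μ, rfl⟩
      exact LeavittFamily.proj_mem_diagonalSubalgebra _ hE _ _
    exact this h
  · rintro ⟨N, hN⟩
    obtain ⟨c, rfl⟩ := hN N le_rfl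
    refine sum_mem fun i _ => Subalgebra.smul_mem _ ?_ _
    by_cases hi : E.IsWalk i.1 (List.ofFn i.2)
    · exact Algebra.subset_adjoin ⟨⟨_, _, hi⟩, rfl⟩
    · rw [LeavittFamily.proj_eq_zero _ hi]
      exact zero_mem _

theorem proj_mem_leavittDiagonal (hE : ∀ v, ∃ e, E.src e = v) (v : V) (l : List A) :
    (Leavitt.family ℤ E).proj v l ∈ E.leavittDiagonal :=
  (mem_leavittDiagonal_iff hE).2 (LeavittFamily.proj_mem_diagonalSubalgebra _ hE v l)

theorem proj_mem_cstarDiagonal (hE : ∀ v, ∃ e, E.src e = v) (v : V) (l : List A) :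
    (GraphCStar.family E).proj v l ∈ E.cstarDiagonal := by
  rw [cstarDiagonal_eq hE]
  exact StarSubalgebra.le_topologicalClosure _
    (LeavittFamily.proj_mem_diagonalSubalgebra _ hE v l)

theorem toCStar_mem_cstarDiagonal (hE : ∀ v, ∃ e, E.src e = v) {d : Leavitt ℤ E}
    (hd : d ∈ E.leavittDiagonal) : E.toCStar d ∈ E.cstarDiagonal := by
  obtain ⟨N, hN⟩ := (mem_leavittDiagonal_iff hE).1 hd
  obtain ⟨c, rfl⟩ := hN N le_rfl
  change E.toCStar (∑ i, c i • (Leavitt.family ℤ E).proj i.1 (List.ofFn i.2)) ∈ _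
  rw [map_sum]
  refine sum_mem fun i _ => ?_
  rw [map_zsmul, toCStar_proj]
  exact zsmul_mem (proj_mem_cstarDiagonal hE _ _) _

/-- In the normal form, the coefficient of a walk is the value at any infinite path that extends the
walk, and such a path exists since there are no sinks. Thus injectivity of the map from L_ℤ(E) to
C*(E) is not needed. -/
theorem eq_zero_of_mem_leavittDiagonal (hE : ∀ v, ∃ e, E.src e = v) {d : Leavitt ℤ E}
    (hd : d ∈ E.leavittDiagonal) (h : ∀ x : E.InfPath, evalAt x (E.toCStar d) = 0) : d = 0 := by
  obtain ⟨N, hN⟩ := (mem_leavittDiagonal_iff hE).1 hd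
  obtain ⟨c, hc⟩ := hN N le_rfl
  change (Leavitt.family ℤ E).diagonalHom ℤ hE N c = d at hc
  subst hc
  rw [LeavittFamily.diagonalHom_apply]
  refine Finset.sum_eq_zero fun i _ => ?_
  by_cases hi : E.IsWalk i.1 (List.ofFn i.2)
  · obtain ⟨x, hx⟩ := InfPath.exists_startsWith hE hi
    have h1 := h x
    rw [evalAt_toCStar_diagonalHom, InfPath.startsWith_ofFn.1 hx, Int.cast_eq_zero] at h1
    rw [h1, Algebra.smul_def, map_zero, zero_mul]
  · rw [LeavittFamily.proj_eq_zero _ hi, Algebra.smul_def, mul_zero]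

/-- `diagonalHom` is a *-homomorphism from functions with the supremum norm, hence contractive. Once
the coefficients of lists that are not walks are set to 0, each remaining coefficient is a value of
a at some infinite path. -/
theorem norm_le_of_mem_diagonalSubalgebra (hE : ∀ v, ∃ e, E.src e = v) {a : GraphCStar E}
    (ha : a ∈ (GraphCStar.family E).diagonalSubalgebra ℂ hE) {C : ℝ} (hC : 0 ≤ C)
    (h : ∀ x : E.InfPath, ‖evalAt x a‖ ≤ C) : ‖a‖ ≤ C := by
  classical
  obtain ⟨N, hN⟩ := ha
  obtain ⟨c, hc⟩ := hN N le_rfl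
  change (GraphCStar.family E).diagonalHom ℂ hE N c = a at hc
  subst hc
  have h1 : (GraphCStar.family E).diagonalHom ℂ hE N c = (GraphCStar.family E).diagonalHom ℂ hE N
      fun i => if E.IsWalk i.1 (List.ofFn i.2) then c i else 0 := by
    rw [LeavittFamily.diagonalHom_apply, LeavittFamily.diagonalHom_apply]
    refine Finset.sum_congr rfl fun i _ => ?_
    split_ifs with hi
    · rfl
    · rw [LeavittFamily.proj_eq_zero _ hi, smul_zero, smul_zero]
  rw [h1]
  refine (NonUnitalStarAlgHom.norm_apply_le _ _).trans ((pi_norm_le_iff_of_nonneg hC).2 fun i => ?_)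
  split_ifs with hi
  · obtain ⟨x, hx⟩ := InfPath.exists_startsWith hE hi
    have h2 := h x
    rwa [evalAt_diagonalHom, InfPath.startsWith_ofFn.1 hx] at h2
  · rwa [_root_.norm_zero]

/-- Approximate d by a finite combination a. Where d evaluates to 0, the values of a are bounded by
‖d - a‖, hence so is the norm of a; if d - a is smaller than half of d, this contradicts d ≠ 0. -/
theorem eq_zero_of_mem_cstarDiagonal (hE : ∀ v, ∃ e, E.src e = v) {d : GraphCStar E}
    (hd : d ∈ E.cstarDiagonal) (h : ∀ x : E.InfPath, evalAt x d = 0) : d = 0 := by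
  rw [cstarDiagonal_eq hE] at hd
  by_contra hne
  have hpos : 0 < ‖d‖ := norm_pos_iff.2 hne
  obtain ⟨a, ha, had⟩ := Metric.mem_closure_iff.1 hd (‖d‖ / 2) (half_pos hpos)
  rw [dist_eq_norm] at had
  have h1 : ‖a‖ ≤ ‖d - a‖ := norm_le_of_mem_diagonalSubalgebra hE ha (norm_nonneg _) fun x => by
    have := norm_evalAt_le x (d - a)
    rwa [map_sub, h, zero_sub, _root_.norm_neg] at this
  have h2 : ‖d‖ ≤ ‖d - a‖ + ‖a‖ := by simpa using norm_add_le (d - a) a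
  linarith

/-- Diagonal elements are determined on the dense subalgebra spanned by projections. -/
theorem cstarDiagonal_induction (hE : ∀ v, ∃ e, E.src e = v) {S : Submodule ℂ (GraphCStar E)}
    (hS : IsClosed (S : Set (GraphCStar E)))
    (h : ∀ v l, (GraphCStar.family E).proj v l ∈ S) {d : GraphCStar E}
    (hd : d ∈ E.cstarDiagonal) : d ∈ S := by
  rw [cstarDiagonal_eq hE] at hd
  refine closure_minimal (s := ((GraphCStar.family E).diagonalSubalgebra ℂ hE : Set _)) ?_ hS
    (by exact hd)
  rintro a ⟨N, hN⟩
  obtain ⟨c, rfl⟩ := hN N le_rfl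
  exact sum_mem fun i _ => Submodule.smul_mem _ _ (h _ _)

end DirectedGraph

/-! ### The dynamics of a polynomial unitary on the infinite paths -/

namespace DirectedGraph

open lp

variable {V A : Type*} {E : DirectedGraph V A}

theorem FinPath.edges_eq (μ : E.FinPath) (h : 0 < μ.length) :
    μ.edges = μ.firstEdge h :: (μ.tail h).edges :=
  (List.cons_head_tail (FinPath.edges_ne_nil h)).symm

theorem FinPath.source_eq (μ : E.FinPath) (h : 0 < μ.length) :
    μ.source = E.src (μ.firstEdge h) := by
  have := μ.isWalk
  rw [μ.edges_eq h] at this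
  exact this.1.symm

theorem FinPath.range_tail (μ : E.FinPath) (h : 0 < μ.length) :
    (μ.tail h).range = μ.range := by
  rw [FinPath.range, FinPath.range, μ.edges_eq h]
  rfl

variable [Fintype V] [Fintype A]

/-- If `∑ S_μ S_ν^*` acts isometrically, then the sets of infinite paths that start with `ν` form
a partition. -/
theorem existsUnique_hasPrefix (J : Finset (E.FinPath × E.FinPath))
    (hr : ∀ q ∈ J, q.1.range = q.2.range)
    (hu : star (∑ q ∈ J, E.leavittPath q.1 * star (E.leavittPath q.2)) *
      ∑ q ∈ J, E.leavittPath q.1 * star (E.leavittPath q.2) = 1) (y : E.InfPath) :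
    ∃! q, q ∈ J ∧ y.HasPrefix q.2 := by
  classical
  set W := E.pathSpaceRep (E.toCStar (∑ q ∈ J, E.leavittPath q.1 * star (E.leavittPath q.2)))
    with hW
  set S := J.filter fun q => y.HasPrefix q.2
  -- Each summand sends the basis vector of y to zero or to a single basis vector.
  have hz : ∀ q ∈ J, ∃ k : E.InfPath × ℤ,
      (E.pathSpaceLeavittFamily.word q.1.source q.1.edges *
        star (E.pathSpaceLeavittFamily.word q.2.source q.2.edges)) (basisVector (y, 0)) =
      if y.HasPrefix q.2 then basisVector k else 0 := fun q hq => by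
    rw [mul_apply_eq_comp]
    by_cases hy : y.HasPrefix q.2
    · obtain ⟨z, hz, hz'⟩ := InfPath.exists_append q.1.isWalk (y.drop q.2.edges.length)
        (hy.source_drop.trans (hr q hq).symm)
      refine ⟨(z, 0 - q.2.edges.length + q.1.edges.length), ?_⟩
      rw [if_pos hy, star_word_basisVector _ _ _ _ hy, ← hz', word_basisVector _ _ _ _ hz]
    · exact ⟨(y, 0), by rw [if_neg hy, star_word_basisVector_of_not _ _ _ _ hy, map_zero]⟩
  have : Nonempty (E.InfPath × ℤ) := ⟨(y, 0)⟩
  choose! k hk using hz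
  have h1 : W (basisVector (y, 0)) = ∑ q ∈ S, basisVector (k q) := by
    rw [Finset.sum_filter, hW, map_sum, map_sum, _root_.sum_apply]
    refine Finset.sum_congr rfl fun q hq => ?_
    rw [← hk q hq, map_mul, map_mul, map_star, map_star, leavittPath_eq, leavittPath_eq,
      toCStar_word, toCStar_word, pathSpaceRep_word, pathSpaceRep_word]
  have h2 : inner ℂ (W (basisVector (y, 0))) (W (basisVector (y, 0))) = 1 := by
    rw [← ContinuousLinearMap.adjoint_inner_right, ← ContinuousLinearMap.star_eq_adjoint,
      ← mul_apply_eq_comp, hW, ← map_star, ← map_star, ← map_mul, ← map_mul, hu, map_one, map_one]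
    simp [norm_basisVector]
  -- The squared norm 1 of the image counts the pairs (q, r) with equal target. The pairs with q = r
  -- alone bound the size of S by 1, and an empty S would give 0.
  have h3 : ∑ q ∈ S, ∑ r ∈ S, (if k q = k r then 1 else 0 : ℕ) = 1 := by
    rw [h1, sum_inner] at h2
    simp only [inner_sum, inner_basisVector] at h2
    exact_mod_cast h2
  have h4 : S.card ≤ 1 := by
    rw [← h3, Finset.card_eq_sum_ones]
    refine Finset.sum_le_sum fun q hq => ?_
    refine le_trans ?_ (Finset.single_le_sum (fun _ _ => Nat.zero_le _) hq)
    simp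
  have h5 : S.Nonempty := by
    by_contra h
    rw [Finset.not_nonempty_iff_eq_empty] at h
    rw [h] at h3
    simp at h3
  obtain ⟨q, hq⟩ := Finset.card_eq_one.1 (le_antisymm h4 h5.card_pos)
  have h6 : ∀ r, r ∈ J ∧ y.HasPrefix r.2 ↔ r = q := fun r => by
    rw [← Finset.mem_singleton, ← hq]
    simp only [S, Finset.mem_filter]
  exact ⟨q, (h6 q).2 rfl, fun r hr => (h6 r).1 hr⟩

namespace PolynomialUnitary

variable (𝒥 : E.PolynomialUnitary)

theorem existsUnique_snd (y : E.InfPath) : ∃! a : 𝒥.J, y.HasPrefix a.1.2 := by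
  obtain ⟨q, ⟨h1, h2⟩, h3⟩ := existsUnique_hasPrefix 𝒥.J 𝒥.range_eq 𝒥.unitary_sum.1 y
  exact ⟨⟨q, h1⟩, h2, fun a ha => Subtype.ext (h3 a.1 ⟨a.2, ha⟩)⟩

theorem star_u : star 𝒥.u = ∑ q ∈ 𝒥.J, E.leavittPath q.2 * star (E.leavittPath q.1) := by
  simp [u, star_sum, star_mul]

/-- The same argument for the adjoint of u_J, which is the sum over the swapped pairs; here the
other half of unitarity enters. -/
theorem existsUnique_fst (y : E.InfPath) : ∃! a : 𝒥.J, y.HasPrefix a.1.1 := by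
  classical
  have h := existsUnique_hasPrefix (𝒥.J.map (Equiv.prodComm _ _).toEmbedding) (E := E)
    (fun q hq => by
      obtain ⟨r, hr, rfl⟩ := Finset.mem_map.1 hq
      exact (𝒥.range_eq r hr).symm) ?_ y
  · obtain ⟨q, ⟨h1, h2⟩, h3⟩ := h
    obtain ⟨r, hr, rfl⟩ := Finset.mem_map.1 h1
    refine ⟨⟨r, hr⟩, h2, fun a ha => Subtype.ext ?_⟩
    exact (Equiv.prodComm _ _).injective (h3 _ ⟨Finset.mem_map_of_mem _ a.2, ha⟩)
  · simp only [Finset.sum_map, Equiv.coe_toEmbedding, Equiv.prodComm_apply, Prod.fst_swap,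
      Prod.snd_swap]
    rw [← star_u, star_star]
    exact 𝒥.unitary_sum.2

/-- The second component of `(μ, e ν)` without its first edge. -/
def rest (a : 𝒥.J) : E.FinPath := a.1.2.tail (𝒥.pos a.1 a.2)

theorem snd_edges (a : 𝒥.J) : a.1.2.edges = 𝒥.vertexEdge a :: (𝒥.rest a).edges :=
  a.1.2.edges_eq _

theorem snd_source (a : 𝒥.J) : a.1.2.source = E.src (𝒥.vertexEdge a) := a.1.2.source_eq _

theorem rest_range (a : 𝒥.J) : (𝒥.rest a).range = a.1.1.range :=
  (a.1.2.range_tail _).trans (𝒥.range_eq _ a.2).symm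

theorem fst_source (a : 𝒥.J) : a.1.1.source = E.src (𝒥.vertexEdge a) :=
  (𝒥.source_eq _ a.2).trans (𝒥.snd_source a)

/-! ### Codes, the shift map and the dual map -/

/-- The element `(μ, e ν)` such that `y` starts with `μ`. -/
noncomputable def code (y : E.InfPath) : 𝒥.J := (𝒥.existsUnique_fst y).choose

theorem hasPrefix_code (y : E.InfPath) : y.HasPrefix (𝒥.code y).1.1 :=
  (𝒥.existsUnique_fst y).choose_spec.1

theorem code_eq {y : E.InfPath} {a : 𝒥.J} (h : y.HasPrefix a.1.1) : 𝒥.code y = a :=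
  ((𝒥.existsUnique_fst y).choose_spec.2 a h).symm

theorem code_eq_iff {y : E.InfPath} {a : 𝒥.J} : 𝒥.code y = a ↔ y.HasPrefix a.1.1 :=
  ⟨fun h => h ▸ 𝒥.hasPrefix_code y, 𝒥.code_eq⟩

theorem source_eq_src_code (y : E.InfPath) : y.source = E.src (𝒥.vertexEdge (𝒥.code y)) :=
  (𝒥.hasPrefix_code y).1.trans (𝒥.fst_source _)

theorem exists_shift (y : E.InfPath) : ∃ z : E.InfPath, z.HasPrefix (𝒥.rest (𝒥.code y)) ∧
    z.drop (𝒥.rest (𝒥.code y)).length = y.drop (𝒥.code y).1.1.length :=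
  InfPath.exists_append (𝒥.rest (𝒥.code y)).isWalk _
    ((𝒥.hasPrefix_code y).source_drop.trans (𝒥.rest_range _).symm)

/-- The map `μ x ↦ ν x` on infinite paths, for `(μ, e ν)` in `J`. -/
noncomputable def shift (y : E.InfPath) : E.InfPath := (𝒥.exists_shift y).choose

theorem hasPrefix_shift (y : E.InfPath) : (𝒥.shift y).HasPrefix (𝒥.rest (𝒥.code y)) :=
  (𝒥.exists_shift y).choose_spec.1

theorem drop_shift (y : E.InfPath) :
    (𝒥.shift y).drop (𝒥.rest (𝒥.code y)).length = y.drop (𝒥.code y).1.1.length :=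
  (𝒥.exists_shift y).choose_spec.2

theorem rng_code (y : E.InfPath) :
    E.rng (𝒥.vertexEdge (𝒥.code y)) = (𝒥.shift y).source := (𝒥.hasPrefix_shift y).1.symm

theorem shift_eq {y z : E.InfPath} {a : 𝒥.J} (ha : y.HasPrefix a.1.1)
    (h1 : z.HasPrefix (𝒥.rest a)) (h2 : z.drop (𝒥.rest a).length = y.drop a.1.1.length) :
    𝒥.shift y = z := by
  obtain rfl := 𝒥.code_eq ha
  exact InfPath.eq_of_startsWith (𝒥.hasPrefix_shift y) h1 ((𝒥.drop_shift y).trans h2.symm)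

/-- The shift map is onto each set of paths with a given prefix `ν`. -/
theorem exists_shift_eq (a : 𝒥.J) {z : E.InfPath} (hz : z.HasPrefix (𝒥.rest a)) :
    ∃ y, 𝒥.code y = a ∧ 𝒥.shift y = z := by
  obtain ⟨y, hy, hy'⟩ := InfPath.exists_append a.1.1.isWalk (z.drop (𝒥.rest a).length)
    (hz.source_drop.trans (𝒥.rest_range a))
  exact ⟨y, 𝒥.code_eq hy, 𝒥.shift_eq hy hz hy'.symm⟩

/-- Every pair of an edge `e` and a path that starts at `r(e)` arises from an infinite path. -/
theorem exists_vertexEdge_shift_eq {e : A} {z : E.InfPath} (h : E.rng e = z.source) :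
    ∃ y, 𝒥.vertexEdge (𝒥.code y) = e ∧ 𝒥.shift y = z := by
  -- The path e z starts with exactly one second component eν; exchanging this for μ gives y.
  obtain ⟨a, ha, -⟩ := 𝒥.existsUnique_snd (.cons e z h)
  rw [InfPath.HasPrefix, snd_edges, InfPath.startsWith_cons, InfPath.drop_cons,
    InfPath.seq_cons_zero] at ha
  obtain ⟨-, rfl, ha⟩ := ha
  obtain ⟨y, rfl, hy⟩ := 𝒥.exists_shift_eq a ha
  exact ⟨y, rfl, hy⟩

/-- This path is eνx for y = μx, the one to which the adjoint of u_J moves y. -/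
theorem hasPrefix_cons_shift (y : E.InfPath) :
    (InfPath.cons _ (𝒥.shift y) (𝒥.rng_code y)).HasPrefix (𝒥.code y).1.2 := by
  rw [InfPath.HasPrefix, snd_edges, InfPath.startsWith_cons, snd_source, InfPath.drop_cons]
  exact ⟨rfl, rfl, 𝒥.hasPrefix_shift y⟩

/-- The map on infinite paths that is dual to the restriction of the endomorphism. -/
noncomputable def dualMap (y : E.InfPath) : E.InfPath where
  seq n := 𝒥.vertexEdge (𝒥.code (𝒥.shift^[n] y))
  isPath n := by
    rw [rng_code, source_eq_src_code, Function.iterate_succ_apply']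

theorem dualMap_seq (y : E.InfPath) (n : ℕ) :
    (𝒥.dualMap y).seq n = 𝒥.vertexEdge (𝒥.code (𝒥.shift^[n] y)) := rfl

theorem dualMap_drop (y : E.InfPath) (n : ℕ) :
    (𝒥.dualMap y).drop n = 𝒥.dualMap (𝒥.shift^[n] y) := by
  ext k
  rw [InfPath.seq_drop, dualMap_seq, dualMap_seq, ← Function.iterate_add_apply, add_comm]

theorem dualMap_drop_one (y : E.InfPath) : (𝒥.dualMap y).drop 1 = 𝒥.dualMap (𝒥.shift y) :=
  𝒥.dualMap_drop y 1

theorem source_dualMap (y : E.InfPath) : (𝒥.dualMap y).source = y.source :=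
  (𝒥.source_eq_src_code y).symm

/-! #### The endomorphisms and the dual map -/

/-- As y starts with only one first component μ, a single summand of the adjoint survives, and it
replaces μ by eν. The height m plays no further role. -/
theorem star_u_basisVector (y : E.InfPath) (n : ℤ) : ∃ m,
    star (E.pathSpaceRep (E.toCStar 𝒥.u)) (basisVector (y, n)) =
      basisVector (.cons _ (𝒥.shift y) (𝒥.rng_code y), m) := by
  classical
  have h1 := 𝒥.hasPrefix_cons_shift y
  set z := InfPath.cons _ (𝒥.shift y) (𝒥.rng_code y)
  have h2 : z.drop (𝒥.code y).1.2.edges.length = y.drop (𝒥.code y).1.1.edges.length := by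
    rw [snd_edges, List.length_cons, add_comm, ← InfPath.drop_drop, InfPath.drop_cons]
    exact 𝒥.drop_shift y
  refine ⟨n - (𝒥.code y).1.1.edges.length + (𝒥.code y).1.2.edges.length, ?_⟩
  rw [← map_star, ← map_star, star_u, map_sum, map_sum, _root_.sum_apply,
    Finset.sum_eq_single (𝒥.code y).1]
  · rw [map_mul, map_mul, map_star, map_star, leavittPath_eq, leavittPath_eq,
      toCStar_word, toCStar_word, pathSpaceRep_word, pathSpaceRep_word, mul_apply_eq_comp,
      star_word_basisVector _ _ _ _ (𝒥.hasPrefix_code y), ← h2, word_basisVector _ _ _ _ h1]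
  · intro q hq hne
    rw [map_mul, map_mul, map_star, map_star, leavittPath_eq, leavittPath_eq,
      toCStar_word, toCStar_word, pathSpaceRep_word, pathSpaceRep_word, mul_apply_eq_comp,
      star_word_basisVector_of_not, map_zero]
    intro h
    exact hne (congrArg Subtype.val (𝒥.code_eq (a := ⟨q, hq⟩) h)).symm
  · exact fun h => absurd (𝒥.code y).2 h

theorem cstarEndo_p (v : V) : 𝒥.cstarEndo ((GraphCStar.family E).P v) = (GraphCStar.family E).P v :=
  DirectedGraph.cstarEndo_p _ _ v

theorem cstarEndo_s (e : A) : 𝒥.cstarEndo ((GraphCStar.family E).S e) =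
    E.toCStar 𝒥.u * (GraphCStar.family E).S e :=
  DirectedGraph.cstarEndo_s _ _ e

/-- The adjoint of u S_e first turns y into e' followed by `shift y`, where e' is the edge of `code
y`, and then asks whether e' = e and removes it. Iterating this tests the letters of `dualMap y` one
after the other. -/
theorem star_cstarEndo_word_basisVector (v : V) (l : List A) (y : E.InfPath) (n : ℤ) :
    ((𝒥.dualMap y).StartsWith v l → ∃ k,
      star (E.pathSpaceRep (𝒥.cstarEndo ((GraphCStar.family E).word v l)))
        (basisVector (y, n)) = basisVector k) ∧
    (¬ (𝒥.dualMap y).StartsWith v l →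
      star (E.pathSpaceRep (𝒥.cstarEndo ((GraphCStar.family E).word v l)))
        (basisVector (y, n)) = 0) := by
  classical
  induction l generalizing v y n with
  | nil =>
    have h : star (E.pathSpaceRep (𝒥.cstarEndo ((GraphCStar.family E).word v [])))
        (basisVector (y, n)) = if y.source = v then basisVector (y, n) else 0 := by
      rw [LeavittFamily.word_nil, cstarEndo_p, ← map_star, (GraphCStar.family E).star_P]
      change E.pathSpaceRep (GraphCStar.p E v) _ = _
      rw [pathSpaceRep_p, P_basisVector]
    rw [InfPath.startsWith_nil, source_dualMap, h]
    exact ⟨fun h => ⟨_, if_pos h⟩, fun h => if_neg h⟩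
  | cons e l ih =>
    by_cases hv : E.src e = v
    · subst hv
      obtain ⟨m, hm⟩ := 𝒥.star_u_basisVector y n
      have h : star (E.pathSpaceRep (𝒥.cstarEndo ((GraphCStar.family E).word (E.src e) (e :: l))))
          (basisVector (y, n)) = if 𝒥.vertexEdge (𝒥.code y) = e then
            star (E.pathSpaceRep (𝒥.cstarEndo ((GraphCStar.family E).word (E.rng e) l)))
              (basisVector (𝒥.shift y, m - 1)) else 0 := by
        rw [LeavittFamily.word_src_cons, map_mul, map_mul, cstarEndo_s, map_mul, star_mul, star_mul,
          mul_apply_eq_comp, mul_apply_eq_comp, hm,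
          show (GraphCStar.family E).S e = GraphCStar.s E e from rfl, pathSpaceRep_s, star_S_basisVector, InfPath.seq_cons_zero, InfPath.drop_cons]
        split_ifs
        · rfl
        · rw [map_zero]
      rw [h, InfPath.startsWith_cons, dualMap_drop_one]
      have h0 : (𝒥.dualMap y).seq 0 = 𝒥.vertexEdge (𝒥.code y) := rfl
      rw [h0]
      constructor
      · rintro ⟨-, h1, h2⟩
        rw [if_pos h1]
        exact (ih _ _ _).1 h2
      · intro h1
        split_ifs with h2
        · exact (ih _ _ _).2 fun h3 =>
            h1 ⟨by rw [InfPath.source, h0, h2], h2, h3⟩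
        · rfl
    · rw [LeavittFamily.word_cons_of_ne _ hv, map_zero, map_zero, star_zero]
      refine ⟨fun h => absurd ?_ hv, fun _ => rfl⟩
      rw [InfPath.startsWith_cons] at h
      rw [← h.2.1, ← h.1]; rfl

theorem evalAt_cstarEndo_proj (y : E.InfPath) (v : V) (l : List A) :
    evalAt y (𝒥.cstarEndo ((GraphCStar.family E).proj v l)) =
      evalAt (𝒥.dualMap y) ((GraphCStar.family E).proj v l) := by
  classical
  rw [evalAt_proj, LeavittFamily.proj, map_mul, map_star, evalAt_mul_star]
  split_ifs with h
  · obtain ⟨k, hk⟩ := (𝒥.star_cstarEndo_word_basisVector v l y 0).1 h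
    rw [hk, inner_basisVector, if_pos rfl]
  · rw [(𝒥.star_cstarEndo_word_basisVector v l y 0).2 h, inner_zero_left]

theorem norm_cstarEndo_le (d : GraphCStar E) : ‖𝒥.cstarEndo d‖ ≤ ‖d‖ :=
  NonUnitalStarAlgHom.norm_apply_le 𝒥.cstarEndo d

theorem continuous_cstarEndo : Continuous 𝒥.cstarEndo :=
  AddMonoidHomClass.continuous_of_bound 𝒥.cstarEndo 1 fun d => by
    rw [one_mul]; exact 𝒥.norm_cstarEndo_le d

/-- The duality between the endomorphism and the dual map. Both sides are linear and continuous in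
d, so the projections of words suffice. -/
theorem evalAt_cstarEndo (hE : ∀ v, ∃ e, E.src e = v) (y : E.InfPath) {d : GraphCStar E}
    (hd : d ∈ E.cstarDiagonal) : evalAt y (𝒥.cstarEndo d) = evalAt (𝒥.dualMap y) d := by
  let S : Submodule ℂ (GraphCStar E) := LinearMap.eqLocus
    ((evalAt y).toLinearMap ∘ₗ (𝒥.cstarEndo : GraphCStar E →ₗ[ℂ] GraphCStar E))
    (evalAt (𝒥.dualMap y)).toLinearMap
  refine cstarDiagonal_induction hE (S := S) ?_ (fun v l => 𝒥.evalAt_cstarEndo_proj y v l) hd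
  exact isClosed_eq ((evalAt y).continuous.comp 𝒥.continuous_cstarEndo)
    (evalAt (𝒥.dualMap y)).continuous

/-- Both composites agree on generators. Hence evaluation at infinite paths also controls the
endomorphism of L_ℤ(E). -/
theorem toCStar_leavittEndo (d : Leavitt ℤ E) :
    E.toCStar (𝒥.leavittEndo d) = 𝒥.cstarEndo (E.toCStar d) := by
  induction d using Leavitt.induction with
  | scalar r =>
    rw [AlgHomClass.commutes, AlgHomClass.commutes, eq_intCast, map_intCast]
  | hP v =>
    rw [leavittEndo, leavittEndo_P, toCStar_P]
    exact (𝒥.cstarEndo_p v).symm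
  | hS e =>
    rw [leavittEndo, leavittEndo_S, map_mul, toCStar_S]
    exact (𝒥.cstarEndo_s e).symm
  | hG e =>
    rw [← Leavitt.star_S, map_star, map_star, map_star, map_star]
    rw [leavittEndo, leavittEndo_S, map_mul, toCStar_S]
    exact congrArg star (𝒥.cstarEndo_s e).symm
  | mul a b ha hb => rw [map_mul, map_mul, ha, hb, map_mul, map_mul]
  | add a b ha hb => rw [map_add, map_add, ha, hb, map_add, map_add]

end PolynomialUnitary

end DirectedGraph

/-! ### Automorphisms of the diagonal and injectivity of the dual map -/

namespace DirectedGraph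

variable {V A : Type*} {E : DirectedGraph V A}

namespace InfPath

theorem agree_iff {x y : E.InfPath} {n : ℕ} : Agree n x y ↔
    (x.source, fun k : Fin n => x.seq k) = (y.source, fun k : Fin n => y.seq k) := by
  have h : y.StartsWith x.source (x.take n) ↔ Agree n x y := by
    simp only [StartsWith, length_take, Agree, eq_comm]
  have h' : x.take n = List.ofFn fun k : Fin n => x.seq k :=
    List.ext_getElem (by simp) fun k hk _ => by simp [take]
  rw [← h, h', eq_comm]
  exact startsWith_ofFn (i := (x.source, fun k : Fin n => x.seq k))

theorem StartsWith.agree {x y : E.InfPath} {v : V} {l : List A} {n : ℕ} (hx : x.StartsWith v l)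
    (hy : y.StartsWith v l) (h : (x.drop l.length).take n = (y.drop l.length).take n) :
    Agree (l.length + n) x y :=
  ⟨hx.1.trans hy.1.symm, by rw [take_add_drop x hx, take_add_drop y hy, h]⟩

end InfPath

variable [Fintype V] [Fintype A]

/-- Normal forms exist at every sufficiently high level, so all short words can be avoided. This
matters for conjugation by u_J, which is transparent only on long words. -/
theorem leavittDiagonal_induction (hE : ∀ v, ∃ e, E.src e = v) (N : ℕ)
    {S : AddSubgroup (Leavitt ℤ E)}
    (h : ∀ v l, N ≤ l.length → E.IsWalk v l → (Leavitt.family ℤ E).proj v l ∈ S)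
    {d : Leavitt ℤ E} (hd : d ∈ E.leavittDiagonal) : d ∈ S := by
  obtain ⟨M, hM⟩ := (mem_leavittDiagonal_iff hE).1 hd
  obtain ⟨c, rfl⟩ := hM (max N M) (le_max_right _ _)
  refine sum_mem fun i _ => ?_
  by_cases hi : E.IsWalk i.1 (List.ofFn i.2)
  · rw [Algebra.smul_def, eq_intCast, ← zsmul_eq_mul]
    exact zsmul_mem (h _ _ (by simp) hi) _
  · rw [LeavittFamily.proj_eq_zero _ hi, Algebra.smul_def, mul_zero]
    exact zero_mem _

theorem conj_mem_leavittDiagonal (hE : ∀ v, ∃ e, E.src e = v) (a : Leavitt ℤ E) (N : ℕ)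
    (h : ∀ v l, N ≤ l.length → E.IsWalk v l →
      a * (Leavitt.family ℤ E).proj v l * star a ∈ E.leavittDiagonal)
    {d : Leavitt ℤ E} (hd : d ∈ E.leavittDiagonal) : a * d * star a ∈ E.leavittDiagonal :=
  leavittDiagonal_induction hE N (S := E.leavittDiagonal.toSubring.toAddSubgroup.comap
    ((AddMonoidHom.mulRight (star a)).comp (AddMonoidHom.mulLeft a))) h hd

theorem S_conj_mem_leavittDiagonal (hE : ∀ v, ∃ e, E.src e = v) (e : A) {d : Leavitt ℤ E}
    (hd : d ∈ E.leavittDiagonal) :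
    (Leavitt.family ℤ E).S e * d * star ((Leavitt.family ℤ E).S e) ∈ E.leavittDiagonal := by
  refine conj_mem_leavittDiagonal hE _ 0 (fun v l _ _ => ?_) hd
  by_cases hv : E.rng e = v
  · subst hv
    have h := proj_mem_leavittDiagonal hE (E.src e) (e :: l)
    rw [LeavittFamily.proj, LeavittFamily.word_src_cons, star_mul] at h
    simpa only [LeavittFamily.proj, mul_assoc] using h
  · rw [← (Leavitt.family ℤ E).S_mul_P, LeavittFamily.proj, ← mul_assoc, mul_assoc (_ * _),
      mul_assoc ((Leavitt.family ℤ E).S e),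
      LeavittFamily.P_mul_word_of_ne _ hv, mul_zero, zero_mul]
    exact zero_mem _

namespace PolynomialUnitary

variable (𝒥 : E.PolynomialUnitary)

/-! ### Invariance of the diagonals under the endomorphisms -/

theorem exists_length_le : ∃ M, ∀ a : 𝒥.J, a.1.1.edges.length ≤ M ∧ a.1.2.edges.length ≤ M := by
  refine ⟨∑ a : 𝒥.J, (a.1.1.edges.length + a.1.2.edges.length), fun a => ?_⟩
  have := Finset.single_le_sum (f := fun a : 𝒥.J => a.1.1.edges.length + a.1.2.edges.length)
    (fun _ _ => Nat.zero_le _) (Finset.mem_univ a)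
  omega

/-- A walk at least as long as all components in J begins with exactly one second component ν. The
corresponding summand replaces ν by μ, and the other summands vanish. -/
theorem u_mul_word (hE : ∀ v, ∃ e, E.src e = v) {M : ℕ}
    (hM : ∀ a : 𝒥.J, a.1.1.edges.length ≤ M ∧ a.1.2.edges.length ≤ M) {v : V} {l : List A}
    (hl : M ≤ l.length) (hw : E.IsWalk v l) :
    ∃ w k, 𝒥.u * (Leavitt.family ℤ E).word v l = (Leavitt.family ℤ E).word w k := by
  obtain ⟨x, hx⟩ := InfPath.exists_startsWith hE hw
  obtain ⟨a, ha, ha'⟩ := 𝒥.existsUnique_snd x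
  -- Since l is long, being comparable with l means being a prefix of l.
  have hpre : ∀ b : 𝒥.J, ((∃ t, l = b.1.2.edges ++ t) ∨ ∃ t, b.1.2.edges = l ++ t) →
      ∃ t, l = b.1.2.edges ++ t := by
    rintro b (h | ⟨t, ht⟩)
    · exact h
    · have h1 := (hM b).2
      rw [ht, List.length_append] at h1
      obtain rfl : t = [] := List.eq_nil_of_length_eq_zero (by omega)
      exact ⟨[], by simpa using ht.symm⟩
  obtain ⟨rfl, h⟩ := InfPath.StartsWith.comparable ha hx
  obtain ⟨t, rfl⟩ := hpre a h
  refine ⟨a.1.1.source, a.1.1.edges ++ t, ?_⟩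
  rw [u, Finset.sum_mul, Finset.sum_eq_single a.1]
  · have hr : E.walkEnd a.1.1.source a.1.1.edges = E.walkEnd a.1.2.source a.1.2.edges :=
      𝒥.range_eq _ a.2
    rw [leavittPath_eq, leavittPath_eq, mul_assoc,
      LeavittFamily.star_word_mul_word_append _ a.1.2.isWalk, LeavittFamily.word_append, hr]
  · intro q hq hne
    by_contra h0
    rw [mul_assoc, leavittPath_eq, leavittPath_eq] at h0
    obtain ⟨h1, -, -, h2⟩ := LeavittFamily.comparable_of_star_word_mul_word_ne_zero _
      (right_ne_zero_of_mul h0)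
    obtain ⟨t', ht'⟩ := hpre ⟨q, hq⟩ h2
    have h3 : x.HasPrefix q.2 := by
      rw [ht', ← h1] at hx
      exact (InfPath.startsWith_append.1 hx).1
    exact hne (congrArg Subtype.val (ha' ⟨q, hq⟩ h3))
  · exact fun h => absurd a.2 h

theorem u_conj_mem_leavittDiagonal (hE : ∀ v, ∃ e, E.src e = v) {d : Leavitt ℤ E}
    (hd : d ∈ E.leavittDiagonal) : 𝒥.u * d * star 𝒥.u ∈ E.leavittDiagonal := by
  obtain ⟨M, hM⟩ := 𝒥.exists_length_le
  refine conj_mem_leavittDiagonal hE _ M (fun v l hl hw => ?_) hd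
  obtain ⟨w, k, h⟩ := 𝒥.u_mul_word hE hM hl hw
  rw [LeavittFamily.proj, ← mul_assoc, mul_assoc (_ * _), ← star_mul, h]
  exact proj_mem_leavittDiagonal hE w k

theorem leavittEndo_P (v : V) :
    𝒥.leavittEndo ((Leavitt.family ℤ E).P v) = (Leavitt.family ℤ E).P v :=
  DirectedGraph.leavittEndo_P _ _ v

theorem leavittEndo_S (e : A) :
    𝒥.leavittEndo ((Leavitt.family ℤ E).S e) = 𝒥.u * (Leavitt.family ℤ E).S e :=
  DirectedGraph.leavittEndo_S _ _ e

/-- The image of the projection of eκ arises from the image of that of κ by conjugation with S_e and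
then with u_J, and both conjugations preserve the diagonal. -/
theorem leavittEndo_proj_mem (hE : ∀ v, ∃ e, E.src e = v) (v : V) (l : List A) :
    𝒥.leavittEndo ((Leavitt.family ℤ E).proj v l) ∈ E.leavittDiagonal := by
  induction l generalizing v with
  | nil =>
    have h := proj_mem_leavittDiagonal hE v []
    rw [LeavittFamily.proj, LeavittFamily.word_nil] at h ⊢
    rwa [map_mul, map_star, leavittEndo_P]
  | cons e l ih =>
    by_cases hv : E.src e = v
    · subst hv
      have h := 𝒥.u_conj_mem_leavittDiagonal hE (S_conj_mem_leavittDiagonal hE e (ih (E.rng e)))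
      rw [LeavittFamily.proj, map_mul, map_star] at h ⊢
      rw [LeavittFamily.word_src_cons, map_mul, leavittEndo_S, star_mul, star_mul]
      simpa only [mul_assoc] using h
    · rw [LeavittFamily.proj, LeavittFamily.word_cons_of_ne _ hv, zero_mul, map_zero]
      exact zero_mem _

theorem leavittEndo_mem (hE : ∀ v, ∃ e, E.src e = v) {d : Leavitt ℤ E}
    (hd : d ∈ E.leavittDiagonal) : 𝒥.leavittEndo d ∈ E.leavittDiagonal :=
  leavittDiagonal_induction hE 0 (S := E.leavittDiagonal.toSubring.toAddSubgroup.comap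
    (𝒥.leavittEndo : Leavitt ℤ E →+ Leavitt ℤ E))
    (fun v l _ _ => 𝒥.leavittEndo_proj_mem hE v l) hd

theorem isClosed_cstarDiagonal : IsClosed (E.cstarDiagonal : Set (GraphCStar E)) :=
  StarSubalgebra.isClosed_topologicalClosure _

/-- The preimage of the closed diagonal is a closed subspace, and it contains the projections by the
corresponding fact for L_ℤ(E). -/
theorem cstarEndo_mem (hE : ∀ v, ∃ e, E.src e = v) {d : GraphCStar E}
    (hd : d ∈ E.cstarDiagonal) : 𝒥.cstarEndo d ∈ E.cstarDiagonal := by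
  refine cstarDiagonal_induction hE (S := E.cstarDiagonal.toSubalgebra.toSubmodule.comap
    (𝒥.cstarEndo : GraphCStar E →ₗ[ℂ] GraphCStar E)) ?_ (fun v l => ?_) hd
  · exact isClosed_cstarDiagonal.preimage 𝒥.continuous_cstarEndo
  · change 𝒥.cstarEndo ((GraphCStar.family E).proj v l) ∈ E.cstarDiagonal
    rw [← toCStar_proj, ← toCStar_leavittEndo]
    exact toCStar_mem_cstarDiagonal hE (𝒥.leavittEndo_proj_mem hE v l)

/-! #### Continuity and surjectivity of the dual map -/

/-- The code is visible in the first M edges, and the shift map discards at most M edges of y; all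
later edges are copied. -/
theorem agree_shift {M : ℕ}
    (hM : ∀ a : 𝒥.J, a.1.1.edges.length ≤ M ∧ a.1.2.edges.length ≤ M) {N : ℕ} {y y' : E.InfPath}
    (h : InfPath.Agree (M + N) y y') :
    𝒥.code y' = 𝒥.code y ∧ InfPath.Agree N (𝒥.shift y) (𝒥.shift y') := by
  have h1 := 𝒥.hasPrefix_code y
  have h2 : 𝒥.code y' = 𝒥.code y :=
    𝒥.code_eq (h.startsWith ((hM _).1.trans (Nat.le_add_right _ _)) h1)
  refine ⟨h2, ?_⟩
  have h3 := 𝒥.hasPrefix_code y'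
  have h4 := 𝒥.hasPrefix_shift y'
  have h5 := 𝒥.drop_shift y'
  rw [h2] at h3 h4 h5
  have h6 := (h.mono (Nat.add_le_add_right (hM (𝒥.code y)).1 N)).2
  rw [InfPath.take_add_drop _ h1, InfPath.take_add_drop _ h3, List.append_cancel_left_eq] at h6
  refine ((𝒥.hasPrefix_shift y).agree h4 ?_).mono (Nat.le_add_left N _)
  change ((𝒥.shift y).drop (𝒥.rest (𝒥.code y)).length).take N =
    ((𝒥.shift y').drop (𝒥.rest (𝒥.code y)).length).take N
  rw [𝒥.drop_shift y, h5]
  exact h6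

/-- Uniform continuity of the dual map: each further letter costs M further edges of y. -/
theorem exists_agree_dualMap (n : ℕ) : ∃ N, ∀ y y' : E.InfPath, InfPath.Agree N y y' →
    InfPath.Agree n (𝒥.dualMap y) (𝒥.dualMap y') := by
  obtain ⟨M, hM⟩ := 𝒥.exists_length_le
  suffices h : ∃ N, ∀ y y' : E.InfPath, InfPath.Agree N y y' →
      (𝒥.dualMap y).take n = (𝒥.dualMap y').take n by
    obtain ⟨N, hN⟩ := h
    exact ⟨N, fun y y' hy => ⟨by rw [source_dualMap, source_dualMap, hy.1], hN y y' hy⟩⟩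
  induction n with
  | zero => exact ⟨0, fun _ _ _ => rfl⟩
  | succ n ih =>
    obtain ⟨N, hN⟩ := ih
    refine ⟨M + N, fun y y' h => ?_⟩
    obtain ⟨h1, h2⟩ := 𝒥.agree_shift hM h
    rw [InfPath.take_succ, InfPath.take_succ, dualMap_drop_one, dualMap_drop_one, hN _ _ h2,
      dualMap_seq, dualMap_seq, Function.iterate_zero, id, id, h1]

/-- Density of the range. An approximate preimage of z without its first edge is pulled back once
along the shift map, with the first edge of z prescribed; for n = 0 only the source has to match,
and the dual map preserves sources. -/
theorem exists_agree_dualMap_eq (n : ℕ) (z : E.InfPath) :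
    ∃ y, InfPath.Agree n (𝒥.dualMap y) z := by
  induction n generalizing z with
  | zero => exact ⟨z, 𝒥.source_dualMap z, rfl⟩
  | succ n ih =>
    obtain ⟨y', hy'⟩ := ih (z.drop 1)
    obtain ⟨y, hy, rfl⟩ := 𝒥.exists_vertexEdge_shift_eq (e := z.seq 0) (z := y')
      (by rw [← z.source_drop_one, ← hy'.1, source_dualMap])
    have h0 : (𝒥.dualMap y).seq 0 = z.seq 0 := hy
    refine ⟨y, congrArg E.src h0, ?_⟩
    rw [InfPath.take_succ, InfPath.take_succ, dualMap_drop_one, hy'.2, h0]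

/-- By compactness and continuity, a limit of approximate preimages is a preimage. -/
theorem dualMap_surjective : Function.Surjective 𝒥.dualMap := fun z => by
  choose y hy using fun n => 𝒥.exists_agree_dualMap_eq n z
  obtain ⟨w, hw⟩ := InfPath.exists_limit y
  refine ⟨w, InfPath.eq_of_agree fun n => ?_⟩
  obtain ⟨N, hN⟩ := 𝒥.exists_agree_dualMap n
  have h1 : ∀ᶠ m in (Filter.hyperfilter ℕ : Filter ℕ), n ≤ m :=
    (Filter.eventually_ge_atTop n).filter_mono (by
      rw [← Nat.cofinite_eq_atTop]; exact Filter.hyperfilter_le_cofinite)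
  obtain ⟨m, hm1, hm2⟩ := ((hw N).and h1).exists
  exact (hN _ _ hm1.symm).trans ((hy m).mono hm2)

/-- If the dual map is injective, then its inverse is continuous. -/
theorem exists_startsWith_of_agree_dualMap (h : Function.Injective 𝒥.dualMap) (v : V)
    (l : List A) : ∃ n, ∀ y y' : E.InfPath, InfPath.Agree n (𝒥.dualMap y) (𝒥.dualMap y') →
      y.StartsWith v l → y'.StartsWith v l := by
  -- Counterexamples for all n have limits w and w' with the same image, so w = w'. But whether a
  -- path lies in the cylinder of l depends only on finitely many edges, so it cannot separate the
  -- two sequences in the limit.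
  by_contra! hcon
  choose y y' h1 h2 h3 using hcon
  obtain ⟨w, hw⟩ := InfPath.exists_limit y
  obtain ⟨w', hw'⟩ := InfPath.exists_limit y'
  have heq : w = w' := h (InfPath.eq_of_agree fun n => by
    obtain ⟨N, hN⟩ := 𝒥.exists_agree_dualMap n
    have h4 : ∀ᶠ m in (Filter.hyperfilter ℕ : Filter ℕ), n ≤ m :=
      (Filter.eventually_ge_atTop n).filter_mono (by
        rw [← Nat.cofinite_eq_atTop]; exact Filter.hyperfilter_le_cofinite)
    obtain ⟨m, ⟨hm1, hm2⟩, hm3⟩ := (((hw N).and (hw' N)).and h4).exists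
    exact ((hN _ _ hm1.symm).trans ((h1 m).mono hm3)).trans (hN _ _ hm2))
  subst heq
  obtain ⟨m, hm1, hm2⟩ := ((hw l.length).and (hw' l.length)).exists
  exact h3 m (hm2.symm.startsWith le_rfl (hm1.startsWith le_rfl (h2 m)))

/-! #### Criteria for automorphisms of the diagonal -/

/-- If a projection is the image of a diagonal element, then its value at y depends only on `dualMap
y`; the projections of all words separate infinite paths. -/
theorem injective_dualMap_of_proj_mem (hE : ∀ v, ∃ e, E.src e = v)
    (h : ∀ v l, ∃ d ∈ E.cstarDiagonal, 𝒥.cstarEndo d = (GraphCStar.family E).proj v l) :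
    Function.Injective 𝒥.dualMap := by
  classical
  intro y y' hy
  refine InfPath.eq_of_agree fun n => ?_
  obtain ⟨d, hd, hd'⟩ := h y.source (y.take n)
  have h1 := 𝒥.evalAt_cstarEndo hE y hd
  rw [hy, ← 𝒥.evalAt_cstarEndo hE y' hd, hd', evalAt_proj, evalAt_proj,
    if_pos ⟨rfl, by rw [InfPath.length_take]⟩] at h1
  have h2 : y'.StartsWith y.source (y.take n) := by
    by_contra h3
    rw [if_neg h3] at h1
    exact one_ne_zero h1
  exact ⟨h2.1.symm, by simpa using h2.2.symm⟩

/-- For suitable n, the first n letters of `dualMap y`, together with its source, decide whether y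
starts with l. The preimage is the sum of the projections of those words of length n that occur as
images of such y, so integer coefficients suffice. -/
theorem exists_leavittEndo_eq_proj (hE : ∀ v, ∃ e, E.src e = v)
    (h : Function.Injective 𝒥.dualMap) (v : V) (l : List A) :
    ∃ d ∈ E.leavittDiagonal, 𝒥.leavittEndo d = (Leavitt.family ℤ E).proj v l := by
  classical
  obtain ⟨n, hn⟩ := 𝒥.exists_startsWith_of_agree_dualMap h v l
  let c : V × (Fin n → A) → ℤ := fun i => if ∃ y : E.InfPath, y.StartsWith v l ∧
    ((𝒥.dualMap y).source, fun k : Fin n => (𝒥.dualMap y).seq k) = i then 1 else 0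
  have hd : (Leavitt.family ℤ E).diagonalHom ℤ hE n c ∈ E.leavittDiagonal := by
    rw [LeavittFamily.diagonalHom_apply]
    exact sum_mem fun i _ => Subalgebra.smul_mem _ (proj_mem_leavittDiagonal hE _ _) _
  refine ⟨_, hd, sub_eq_zero.1 (eq_zero_of_mem_leavittDiagonal hE
    (sub_mem (𝒥.leavittEndo_mem hE hd) (proj_mem_leavittDiagonal hE v l)) fun y => ?_)⟩
  rw [map_sub, map_sub, toCStar_leavittEndo,
    𝒥.evalAt_cstarEndo hE y (toCStar_mem_cstarDiagonal hE hd), evalAt_toCStar_diagonalHom,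
    toCStar_proj, evalAt_proj, sub_eq_zero]
  have h1 : (∃ y' : E.InfPath, y'.StartsWith v l ∧
      ((𝒥.dualMap y').source, fun k : Fin n => (𝒥.dualMap y').seq k) =
        ((𝒥.dualMap y).source, fun k : Fin n => (𝒥.dualMap y).seq k)) ↔ y.StartsWith v l := by
    simp only [← InfPath.agree_iff]
    exact ⟨fun ⟨y', h1, h2⟩ => hn y' y h2 h1, fun h1 => ⟨y, h1, rfl, rfl⟩⟩
  simp only [c, h1]
  split_ifs <;> simp

/-- Injectivity on the diagonal is automatic, as the dual map is onto; being onto the diagonal is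
what injectivity of the dual map decides. -/
theorem leavittRestrictsToAut_iff (hE : ∀ v, ∃ e, E.src e = v) :
    𝒥.LeavittRestrictsToAut ↔ Function.Injective 𝒥.dualMap := by
  constructor
  · intro h
    refine 𝒥.injective_dualMap_of_proj_mem hE fun v l => ?_
    obtain ⟨d, hd, hd'⟩ := h.2.2 (proj_mem_leavittDiagonal hE v l)
    exact ⟨E.toCStar d, toCStar_mem_cstarDiagonal hE hd, by
      rw [← toCStar_leavittEndo, hd', toCStar_proj]⟩
  · intro h
    refine ⟨fun d hd => 𝒥.leavittEndo_mem hE hd, fun d hd d' hd' hdd => ?_, fun d hd => ?_⟩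
    · refine sub_eq_zero.1 (eq_zero_of_mem_leavittDiagonal hE (sub_mem hd hd') fun x => ?_)
      obtain ⟨y, rfl⟩ := 𝒥.dualMap_surjective x
      rw [← 𝒥.evalAt_cstarEndo hE y (toCStar_mem_cstarDiagonal hE (sub_mem hd hd')),
        ← toCStar_leavittEndo, map_sub, hdd, sub_self, map_zero, map_zero]
    · exact leavittDiagonal_induction hE 0 (S := E.leavittDiagonal.toSubring.toAddSubgroup.map
        (𝒥.leavittEndo : Leavitt ℤ E →+ Leavitt ℤ E))
        (fun v l _ _ => 𝒥.exists_leavittEndo_eq_proj hE h v l) hd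

theorem cstarEndo_injOn (hE : ∀ v, ∃ e, E.src e = v) :
    Set.InjOn 𝒥.cstarEndo E.cstarDiagonal := fun d hd d' hd' hdd => by
  refine sub_eq_zero.1 (eq_zero_of_mem_cstarDiagonal hE (sub_mem hd hd') fun x => ?_)
  obtain ⟨y, rfl⟩ := 𝒥.dualMap_surjective x
  rw [← 𝒥.evalAt_cstarEndo hE y (sub_mem hd hd'), map_sub, hdd, sub_self, map_zero]

/-- An injective *-homomorphism of C*-algebras is isometric, so its range is complete. -/
theorem isClosed_image_cstarEndo (hE : ∀ v, ∃ e, E.src e = v) :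
    IsClosed (𝒥.cstarEndo '' E.cstarDiagonal) := by
  have : IsClosed (E.cstarDiagonal : Set (GraphCStar E)) := isClosed_cstarDiagonal
  let φ : E.cstarDiagonal →⋆ₐ[ℂ] GraphCStar E := 𝒥.cstarEndo.comp E.cstarDiagonal.subtype
  have hφ : Function.Injective φ := fun d d' h => Subtype.ext (𝒥.cstarEndo_injOn hE d.2 d'.2 h)
  have h : Set.range φ = 𝒥.cstarEndo '' E.cstarDiagonal := by
    ext; simp [φ]
  rw [← h]
  exact (NonUnitalStarAlgHom.isometry φ hφ).isClosedEmbedding.isClosed_range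

/-- For surjectivity it is enough to reach the projections, because the image is closed; their
preimages already exist over ℤ. -/
theorem cstarRestrictsToAut_iff (hE : ∀ v, ∃ e, E.src e = v) :
    𝒥.CStarRestrictsToAut ↔ Function.Injective 𝒥.dualMap := by
  constructor
  · intro h
    exact 𝒥.injective_dualMap_of_proj_mem hE fun v l => h.2.2 (proj_mem_cstarDiagonal hE v l)
  · intro h
    refine ⟨fun d hd => 𝒥.cstarEndo_mem hE hd, 𝒥.cstarEndo_injOn hE, fun d hd => ?_⟩
    refine cstarDiagonal_induction hE (S := E.cstarDiagonal.toSubalgebra.toSubmodule.map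
      (𝒥.cstarEndo : GraphCStar E →ₗ[ℂ] GraphCStar E)) (𝒥.isClosed_image_cstarEndo hE)
      (fun v l => ?_) hd
    obtain ⟨d, hd, hd'⟩ := 𝒥.exists_leavittEndo_eq_proj hE h v l
    refine ⟨E.toCStar d, toCStar_mem_cstarDiagonal hE hd, ?_⟩
    change 𝒥.cstarEndo (E.toCStar d) = _
    rw [← toCStar_leavittEndo, hd', toCStar_proj]

end PolynomialUnitary

end DirectedGraph

/-! ### The coding graph and the dual map -/

namespace DirectedGraph

open lp

section Walks

variable {V A : Type*} {E : DirectedGraph V A}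

theorem exists_src_eq_or_walkEnd_eq {v : V} {l : List A} (h : E.IsWalk v l) {e : A} (he : e ∈ l) :
    (∃ f ∈ l, E.src f = E.rng e) ∨ E.walkEnd v l = E.rng e := by
  induction l generalizing v with
  | nil => simp at he
  | cons f l ih =>
    rcases List.mem_cons.1 he with rfl | he
    · cases l with
      | nil => exact .inr rfl
      | cons g l => exact .inl ⟨g, by simp, h.2.1⟩
    · rcases ih h.2 he with ⟨g, hg, hg'⟩ | h'
      · exact .inl ⟨g, List.mem_cons_of_mem _ hg, hg'⟩
      · exact .inr h'

/-- The end of every edge of a cycle is the source of an edge of the cycle. -/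
theorem FinPath.IsCycle.exists_src_eq {μ : E.FinPath} (hμ : μ.IsCycle) {e : A}
    (he : e ∈ μ.edges) : ∃ f ∈ μ.edges, E.src f = E.rng e := by
  rcases exists_src_eq_or_walkEnd_eq μ.isWalk he with h | h
  · exact h
  · refine ⟨μ.firstEdge hμ.1, List.head_mem _, ?_⟩
    rw [← μ.source_eq hμ.1, ← h]
    exact hμ.2.symm

end Walks

variable {V A : Type*} {E : DirectedGraph V A} [Fintype V] [Fintype A]

/-! ### Labels and degrees of the edges of the coding graph -/

theorem leavittPath_basisVector (α : E.FinPath) (x : E.InfPath) (n : ℤ) :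
    E.pathSpaceRep (E.toCStar (E.leavittPath α)) (basisVector (x, n)) = 0 ∨
    ∃ y, E.pathSpaceRep (E.toCStar (E.leavittPath α)) (basisVector (x, n)) =
      basisVector (y, n + α.length) := by
  rw [leavittPath_eq, toCStar_word, pathSpaceRep_word]
  by_cases h : x.source = E.walkEnd α.source α.edges
  · obtain ⟨y, hy, rfl⟩ := InfPath.exists_append α.isWalk x h
    exact .inr ⟨y, word_basisVector _ _ _ _ hy⟩
  · exact .inl (word_basisVector_of_not _ _ _ _ h)

theorem star_leavittPath_basisVector (α : E.FinPath) (x : E.InfPath) (n : ℤ) :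
    E.pathSpaceRep (E.toCStar (star (E.leavittPath α))) (basisVector (x, n)) = 0 ∨
    ∃ y, E.pathSpaceRep (E.toCStar (star (E.leavittPath α))) (basisVector (x, n)) =
      basisVector (y, n - α.length) := by
  rw [leavittPath_eq, map_star, map_star, toCStar_word, pathSpaceRep_word]
  by_cases h : x.StartsWith α.source α.edges
  · exact .inr ⟨_, star_word_basisVector _ _ _ _ h⟩
  · exact .inl (star_word_basisVector_of_not _ _ _ _ h)

/-- Elements of degree 0 of this kind do not change the height, while S_α and its adjoint change it
by |α| and -|α|. Comparing heights identifies degrees. -/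
theorem span_P_basisVector {a : Leavitt ℤ E}
    (ha : a ∈ Submodule.span ℤ (Set.range (Leavitt.P ℤ E))) (x : E.InfPath) (n : ℤ) :
    ∃ c : ℂ, E.pathSpaceRep (E.toCStar a) (basisVector (x, n)) = c • basisVector (x, n) := by
  classical
  induction ha using Submodule.span_induction with
  | mem a h =>
    obtain ⟨v, rfl⟩ := h
    rw [toCStar_P, pathSpaceRep_p, P_basisVector]
    split_ifs
    · exact ⟨1, (one_smul _ _).symm⟩
    · exact ⟨0, (zero_smul _ _).symm⟩
  | zero => exact ⟨0, by rw [map_zero, map_zero, zero_smul]; rfl⟩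
  | add a b _ _ ha hb =>
    obtain ⟨c, hc⟩ := ha
    obtain ⟨d, hd⟩ := hb
    exact ⟨c + d, by rw [map_add, map_add, _root_.add_apply, hc, hd, add_smul]⟩
  | smul r a _ ha =>
    obtain ⟨c, hc⟩ := ha
    refine ⟨r * c, ?_⟩
    rw [map_zsmul, map_zsmul, ← Int.cast_smul_eq_zsmul ℂ, _root_.smul_apply, hc, smul_smul]

namespace PolynomialUnitary

variable (𝒥 : E.PolynomialUnitary)

theorem label_eq (a b : 𝒥.J) :
    𝒥.label a b = star (E.leavittPath (𝒥.rest a)) * E.leavittPath b.1.1 := rfl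

theorem label_basisVector {a b : 𝒥.J} {z : E.InfPath} (ha : z.HasPrefix (𝒥.rest a))
    (hb : z.HasPrefix b.1.1) :
    E.pathSpaceRep (E.toCStar (𝒥.label a b)) (basisVector (z.drop b.1.1.edges.length, 0)) =
      basisVector (z.drop (𝒥.rest a).edges.length,
        (b.1.1.edges.length : ℤ) - (𝒥.rest a).edges.length) := by
  rw [label_eq, map_mul, map_mul, map_star, map_star, leavittPath_eq, leavittPath_eq, toCStar_word,
    toCStar_word, pathSpaceRep_word, pathSpaceRep_word, mul_apply_eq_comp,
    word_basisVector _ _ _ _ hb, star_word_basisVector _ _ _ _ ha, zero_add]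

theorem label_ne_zero {a b : 𝒥.J} {z : E.InfPath} (ha : z.HasPrefix (𝒥.rest a))
    (hb : z.HasPrefix b.1.1) : 𝒥.label a b ≠ 0 := fun h => by
  have h1 := 𝒥.label_basisVector ha hb
  rw [h, map_zero, map_zero] at h1
  exact basisVector_ne_zero _ h1.symm

theorem comparable_of_label_ne_zero {a b : 𝒥.J} (h : 𝒥.label a b ≠ 0) :
    (𝒥.rest a).source = b.1.1.source ∧ ((∃ t, b.1.1.edges = (𝒥.rest a).edges ++ t) ∨
      ∃ t, (𝒥.rest a).edges = b.1.1.edges ++ t) := by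
  rw [label_eq, leavittPath_eq, leavittPath_eq] at h
  obtain ⟨h1, -, -, h2⟩ := LeavittFamily.comparable_of_star_word_mul_word_ne_zero _ h
  exact ⟨h1, h2⟩

/-- The two paths are comparable, and any infinite extension of the longer one serves for both. -/
theorem exists_hasPrefix_of_label_ne_zero (hE : ∀ v, ∃ e, E.src e = v) {a b : 𝒥.J}
    (h : 𝒥.label a b ≠ 0) : ∃ z : E.InfPath, z.HasPrefix (𝒥.rest a) ∧ z.HasPrefix b.1.1 := by
  obtain ⟨h1, ⟨t, ht⟩ | ⟨t, ht⟩⟩ := 𝒥.comparable_of_label_ne_zero h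
  · obtain ⟨z, hz⟩ := InfPath.exists_startsWith hE b.1.1.isWalk
    refine ⟨z, ?_, hz⟩
    rw [ht, ← h1] at hz
    exact (InfPath.startsWith_append.1 hz).1
  · obtain ⟨z, hz⟩ := InfPath.exists_startsWith hE (𝒥.rest a).isWalk
    refine ⟨z, hz, ?_⟩
    rw [ht, h1] at hz
    exact (InfPath.startsWith_append.1 hz).1

/-- Degrees of edges are well-defined. -/
theorem HasDegree.eq (hE : ∀ v, ∃ e, E.src e = v)
    {η : {q : 𝒥.J × 𝒥.J // 𝒥.label q.1 q.2 ≠ 0}} {d : ℤ} (h : 𝒥.HasDegree η d) :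
    d = (η.1.2.1.1.edges.length : ℤ) - (𝒥.rest η.1.1).edges.length := by
  obtain ⟨z, hz, hz'⟩ := 𝒥.exists_hasPrefix_of_label_ne_zero hE η.2
  have h1 := 𝒥.label_basisVector hz hz'
  have hinj : ∀ {k j : E.InfPath × ℤ}, basisVector k = basisVector j → k = j := fun {k j} hkj => by
    classical
    have := inner_basisVector k j
    rw [← hkj, inner_basisVector, if_pos rfl] at this
    by_contra hne
    rw [if_neg hne] at this
    exact one_ne_zero this
  -- By `label_basisVector` the label raises the height by |μ₂| - |ν₁| at a vector it does not kill.
  -- In each of the three cases the height is raised by d.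
  rcases h with ⟨α, hα, rfl⟩ | ⟨hs, rfl⟩ | ⟨α, hα, rfl⟩
  · rw [hα] at h1
    rcases leavittPath_basisVector α (z.drop η.1.2.1.1.edges.length) 0 with h2 | ⟨y, h2⟩
    · exact absurd (h1.symm.trans h2) (basisVector_ne_zero _)
    · simpa using (congrArg Prod.snd (hinj (h2.symm.trans h1)))
  · obtain ⟨c, hc⟩ := span_P_basisVector hs (z.drop η.1.2.1.1.edges.length) 0
    have h2 := h1.symm.trans hc
    have h3 := congrArg (fun f => inner ℂ (basisVector (z.drop (𝒥.rest η.1.1).edges.length,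
        (η.1.2.1.1.edges.length : ℤ) - (𝒥.rest η.1.1).edges.length)) f) h2
    classical
    simp only [inner_smul_right, inner_basisVector] at h3
    rw [if_pos trivial] at h3
    split_ifs at h3 with h4
    · exact (congrArg Prod.snd h4).symm
    · simp at h3
  · rw [hα] at h1
    rcases star_leavittPath_basisVector α (z.drop η.1.2.1.1.edges.length) 0 with h2 | ⟨y, h2⟩
    · exact absurd (h1.symm.trans h2) (basisVector_ne_zero _)
    · simpa using (congrArg Prod.snd (hinj (h2.symm.trans h1)))

/-- If the degree is at most `0`, then `ν₁` extends `μ₂`. -/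
theorem exists_rest_eq_append {a b : 𝒥.J} (h : 𝒥.label a b ≠ 0)
    (hl : b.1.1.edges.length ≤ (𝒥.rest a).edges.length) :
    (𝒥.rest a).source = b.1.1.source ∧ ∃ t, (𝒥.rest a).edges = b.1.1.edges ++ t := by
  obtain ⟨h1, ⟨t, ht⟩ | h2⟩ := 𝒥.comparable_of_label_ne_zero h
  · rw [ht, List.length_append] at hl
    obtain rfl : t = [] := List.eq_nil_of_length_eq_zero (by omega)
    exact ⟨h1, [], by simpa using ht.symm⟩
  · exact ⟨h1, h2⟩

/-- If the degree is at least `0`, then `μ₂` extends `ν₁`. -/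
theorem exists_fst_eq_append {a b : 𝒥.J} (h : 𝒥.label a b ≠ 0)
    (hl : (𝒥.rest a).edges.length ≤ b.1.1.edges.length) :
    b.1.1.source = (𝒥.rest a).source ∧ ∃ t, b.1.1.edges = (𝒥.rest a).edges ++ t := by
  obtain ⟨h1, h2 | ⟨t, ht⟩⟩ := 𝒥.comparable_of_label_ne_zero h
  · exact ⟨h1.symm, h2⟩
  · rw [ht, List.length_append] at hl
    obtain rfl : t = [] := List.eq_nil_of_length_eq_zero (by omega)
    exact ⟨h1.symm, [], by simpa using ht.symm⟩

/-- Here ν₁ = μ₂t, and the label is the adjoint of S_t; an empty t is included, with degree 0. -/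
theorem hasDegree_of_le {η : {q : 𝒥.J × 𝒥.J // 𝒥.label q.1 q.2 ≠ 0}}
    (hl : η.1.2.1.1.edges.length ≤ (𝒥.rest η.1.1).edges.length) :
    ∃ d, 𝒥.HasDegree η d ∧ d ≤ 0 := by
  obtain ⟨h1, t, ht⟩ := 𝒥.exists_rest_eq_append η.2 hl
  have hw : E.IsWalk (E.walkEnd η.1.2.1.1.source η.1.2.1.1.edges) t := by
    have := (𝒥.rest η.1.1).isWalk
    rw [ht, h1] at this
    exact (isWalk_append.1 this).2
  refine ⟨_, .inr (.inr ⟨⟨_, t, hw⟩, ?_, rfl⟩), by simp⟩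
  rw [label_eq, leavittPath_eq, leavittPath_eq, ht, h1,
    LeavittFamily.star_word_append_mul_word _ η.1.2.1.1.isWalk]
  rfl

/-! #### Non-positive cycles -/

/-- Along a non-positive edge the code of y forces the code of `shift y`. Starting on the cycle, all
later codes are forced, so the dual map is constant on the cylinder of μ. -/
theorem not_injective_of_hasNonpositiveCycle (hE : E.IsAdmissible) (h : 𝒥.HasNonpositiveCycle) :
    ¬ Function.Injective 𝒥.dualMap := by
  obtain ⟨ω, hω, hdeg⟩ := h
  let Z : Set 𝒥.J := {a | ∃ η ∈ ω.edges, 𝒥.codingGraph.src η = a}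
  have hnext : ∀ a ∈ Z, ∃ b ∈ Z, ∀ y, 𝒥.code y = a → 𝒥.code (𝒥.shift y) = b := by
    rintro _ ⟨η, hη, rfl⟩
    obtain ⟨d, hd, hd0⟩ := hdeg η hη
    have hd1 := HasDegree.eq 𝒥 hE.no_sinks hd
    obtain ⟨h1, t, ht⟩ := 𝒥.exists_rest_eq_append η.2 (by omega)
    refine ⟨_, hω.exists_src_eq hη, fun y hy => 𝒥.code_eq ?_⟩
    have h2 := 𝒥.hasPrefix_shift y
    rw [hy, InfPath.HasPrefix] at h2
    change (𝒥.shift y).StartsWith (𝒥.rest η.1.1).source (𝒥.rest η.1.1).edges at h2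
    rw [h1, ht] at h2
    exact (InfPath.startsWith_append.1 h2).1
  have hall : ∀ n, ∀ a ∈ Z, ∃ b : 𝒥.J, ∀ y, 𝒥.code y = a → 𝒥.code (𝒥.shift^[n] y) = b := by
    intro n
    induction n with
    | zero => exact fun a _ => ⟨a, fun y hy => hy⟩
    | succ n ih =>
      intro a ha
      obtain ⟨b, hb, hab⟩ := hnext a ha
      obtain ⟨c, hc⟩ := ih b hb
      exact ⟨c, fun y hy => hc _ (hab y hy)⟩
  let a := 𝒥.codingGraph.src (ω.firstEdge hω.1)
  have ha : a ∈ Z := ⟨_, List.head_mem _, rfl⟩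
  -- Two different continuations of μ exist because every cycle has an exit.
  obtain ⟨x, x', hne, hx, hx'⟩ := InfPath.exists_ne_source hE (E.walkEnd a.1.1.source a.1.1.edges)
  obtain ⟨y, hy, rfl⟩ := InfPath.exists_append a.1.1.isWalk x hx
  obtain ⟨y', hy', rfl⟩ := InfPath.exists_append a.1.1.isWalk x' hx'
  intro hinj
  refine hne (congrArg _ (hinj (InfPath.ext (funext fun n => ?_))))
  obtain ⟨b, hb⟩ := hall n a ha
  rw [dualMap_seq, dualMap_seq, hb y (𝒥.code_eq hy), hb y' (𝒥.code_eq hy')]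

/-! #### Non-negative edges -/

/-- The path in the coding graph that is determined by an infinite path. -/
noncomputable def itinerary (y : E.InfPath) : 𝒥.codingGraph.InfPath where
  seq n := ⟨(𝒥.code (𝒥.shift^[n] y), 𝒥.code (𝒥.shift^[n + 1] y)), by
    rw [Function.iterate_succ_apply']
    exact 𝒥.label_ne_zero (𝒥.hasPrefix_shift _) (𝒥.hasPrefix_code _)⟩
  isPath _ := rfl

/-- A path with m edges visits m + 1 vertices, hence the m + 1 letters. -/
theorem edgeLabel_takePath (y : E.InfPath) (m : ℕ) :
    𝒥.edgeLabel ((𝒥.itinerary y).takePath m) = (𝒥.dualMap y).take (m + 1) := by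
  rw [InfPath.take_succ, dualMap_drop_one, edgeLabel]
  congr 1
  change List.map _ (List.map _ (List.range m)) = List.map _ (List.range m)
  rw [List.map_map]
  rfl

theorem length_rest_le (hE : ∀ v, ∃ e, E.src e = v) (hnn : 𝒥.OnlyNonnegativeEdges) {a b : 𝒥.J}
    (h : 𝒥.label a b ≠ 0) : (𝒥.rest a).edges.length ≤ b.1.1.edges.length := by
  obtain ⟨d, hd, hd0⟩ := hnn ⟨(a, b), h⟩
  have := HasDegree.eq 𝒥 hE hd
  dsimp only at this
  omega

/-- The initial segments of length m of the two itineraries carry the same label, and the code is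
their source. -/
theorem code_eq_of_leftSynchronizing (hLS : 𝒥.LeftSynchronizing) {y y' : E.InfPath}
    (h : 𝒥.dualMap y = 𝒥.dualMap y') : 𝒥.code y = 𝒥.code y' := by
  obtain ⟨m, hm⟩ := hLS
  exact hm ((𝒥.itinerary y).takePath m) ((𝒥.itinerary y').takePath m)
    (InfPath.length_take m _) (InfPath.length_take m _) (by
      rw [edgeLabel_takePath, edgeLabel_takePath, h])

/-- If the edges between the codes of `y` and its image have degree `≥ 0`, then agreement is
transported backwards. -/
theorem take_drop_eq_of_shift (hE : ∀ v, ∃ e, E.src e = v) (hnn : 𝒥.OnlyNonnegativeEdges)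
    {y y' : E.InfPath} (h0 : 𝒥.code y' = 𝒥.code y)
    (h1 : 𝒥.code (𝒥.shift y') = 𝒥.code (𝒥.shift y)) {n : ℕ}
    (h : ((𝒥.shift y).drop (𝒥.code (𝒥.shift y)).1.1.edges.length).take n =
      ((𝒥.shift y').drop (𝒥.code (𝒥.shift y)).1.1.edges.length).take n) :
    (y.drop (𝒥.code y).1.1.edges.length).take ((𝒥.code (𝒥.shift y)).1.1.edges.length -
      (𝒥.rest (𝒥.code y)).edges.length + n) =
    (y'.drop (𝒥.code y).1.1.edges.length).take ((𝒥.code (𝒥.shift y)).1.1.edges.length -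
      (𝒥.rest (𝒥.code y)).edges.length + n) := by
  have hl := 𝒥.label_ne_zero (𝒥.hasPrefix_shift y) (𝒥.hasPrefix_code _)
  have hle := 𝒥.length_rest_le hE hnn hl
  have h2 := 𝒥.hasPrefix_code (𝒥.shift y')
  rw [h1] at h2
  have h3 := ((𝒥.hasPrefix_code (𝒥.shift y)).agree h2 h).2
  -- The shifted paths agree on |μ₂| + n edges. The first |ν₁| of these are ν₁, and what follows is
  -- copied from y and y' behind μ₁.
  rw [← Nat.add_sub_of_le hle, add_assoc,
    InfPath.take_add (𝒥.rest (𝒥.code y)).edges.length _ (𝒥.shift y),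
    InfPath.take_add (𝒥.rest (𝒥.code y)).edges.length _ (𝒥.shift y')] at h3
  have h4 := (List.append_inj h3 (by simp)).2
  have h5 := 𝒥.drop_shift y'
  rw [h0] at h5
  have h6 := 𝒥.drop_shift y
  rw [FinPath.length, FinPath.length] at h5 h6
  rwa [h5, h6] at h4

/-- Equal images force equal codes along both orbits. What remains to compare is the part of each
path behind its code, and agreement there is gained at edges of positive degree and never lost when
pulled back. -/
theorem injective_of_leftSynchronizing (hE : ∀ v, ∃ e, E.src e = v)
    (hnn : 𝒥.OnlyNonnegativeEdges) (hc : ¬ 𝒥.HasNonpositiveCycle) (hLS : 𝒥.LeftSynchronizing) :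
    Function.Injective 𝒥.dualMap := by
  have hcode : ∀ {y y' : E.InfPath}, 𝒥.dualMap y = 𝒥.dualMap y' → 𝒥.code y' = 𝒥.code y :=
    fun h => (𝒥.code_eq_of_leftSynchronizing hLS h).symm
  have hshift : ∀ {y y' : E.InfPath}, 𝒥.dualMap y = 𝒥.dualMap y' → ∀ k,
      𝒥.dualMap (𝒥.shift^[k] y) = 𝒥.dualMap (𝒥.shift^[k] y') := fun h k => by
    rw [← dualMap_drop, ← dualMap_drop, h]
  -- agreement of the remainders is transported backwards along the orbit
  have hback : ∀ (n k : ℕ) {y y' : E.InfPath}, 𝒥.dualMap y = 𝒥.dualMap y' →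
      ((𝒥.shift^[k] y).drop (𝒥.code (𝒥.shift^[k] y)).1.1.edges.length).take n =
        ((𝒥.shift^[k] y').drop (𝒥.code (𝒥.shift^[k] y)).1.1.edges.length).take n →
      (y.drop (𝒥.code y).1.1.edges.length).take n =
        (y'.drop (𝒥.code y).1.1.edges.length).take n := by
    intro n k
    induction k with
    | zero => exact fun _ h => h
    | succ k ih =>
      intro y y' hy h
      have h1 := ih (hshift hy 1) h
      exact InfPath.take_eq_of_le (Nat.le_add_left _ _)
        (𝒥.take_drop_eq_of_shift hE hnn (hcode hy) (hcode (hshift hy 1)) h1)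
  -- Otherwise all edges of the itinerary of y are non-positive, and since the coding graph is
  -- finite, the itinerary closes up to a non-positive cycle.
  have hpos : ∀ y : E.InfPath, ∃ k, (𝒥.rest (𝒥.code (𝒥.shift^[k] y))).edges.length <
      (𝒥.code (𝒥.shift^[k + 1] y)).1.1.edges.length := by
    intro y
    by_contra! hle
    obtain ⟨i, n, hn, h⟩ := (𝒥.itinerary y).exists_source_drop_eq
    refine hc ⟨_, InfPath.isCycle_takePath hn h, fun η hη => ?_⟩
    obtain ⟨k, -, rfl⟩ := InfPath.mem_take hη
    exact 𝒥.hasDegree_of_le (hle (i + k))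
  have hall : ∀ (n : ℕ) {y y' : E.InfPath}, 𝒥.dualMap y = 𝒥.dualMap y' →
      (y.drop (𝒥.code y).1.1.edges.length).take n =
        (y'.drop (𝒥.code y).1.1.edges.length).take n := by
    intro n
    induction n with
    | zero => exact fun _ => rfl
    | succ n ih =>
      intro y y' hy
      obtain ⟨k, hk⟩ := hpos y
      -- At time k + 1 the remainders agree on n edges by induction; the positive edge from time k
      -- to k + 1 gives one more, and `hback` carries this to time 0.
      refine hback (n + 1) k hy ?_
      have h1 := hshift hy k
      rw [Function.iterate_succ_apply'] at hk
      exact InfPath.take_eq_of_le (by omega) (𝒥.take_drop_eq_of_shift hE hnn (hcode h1)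
        (hcode (hshift h1 1)) (ih (hshift h1 1)))
  intro y y' hy
  have h1 := 𝒥.hasPrefix_code y'
  rw [hcode hy] at h1
  exact InfPath.eq_of_startsWith (𝒥.hasPrefix_code y) h1 (InfPath.ext_of_take fun n => hall n hy)

/-- Every finite path of the coding graph is the beginning of an itinerary. -/
theorem exists_code_eq_of_isWalk (hE : ∀ v, ∃ e, E.src e = v) (hnn : 𝒥.OnlyNonnegativeEdges)
    {a : 𝒥.J} {l : List {q : 𝒥.J × 𝒥.J // 𝒥.label q.1 q.2 ≠ 0}} (hl : 𝒥.codingGraph.IsWalk a l) :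
    ∃ y, 𝒥.code y = a ∧ (𝒥.dualMap y).take (l.length + 1) =
      𝒥.vertexEdge a :: l.map fun η => 𝒥.vertexEdge (𝒥.codingGraph.rng η) := by
  induction l generalizing a with
  | nil =>
    obtain ⟨y, hy⟩ := InfPath.exists_startsWith hE a.1.1.isWalk
    obtain rfl := 𝒥.code_eq hy
    exact ⟨y, rfl, rfl⟩
  | cons η l ih =>
    obtain ⟨rfl, hl⟩ := hl
    obtain ⟨z, hz, hz'⟩ := ih hl
    -- The edge is non-negative, so μ₂ extends ν₁ and z starts with ν₁; hence z is the shift of a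
    -- path whose code is the source of the edge.
    have h1 : z.HasPrefix (𝒥.rest η.1.1) := by
      obtain ⟨h2, t, ht⟩ := 𝒥.exists_fst_eq_append η.2 (𝒥.length_rest_le hE hnn η.2)
      have h3 : z.HasPrefix η.1.2.1.1 := 𝒥.code_eq_iff.1 hz
      rw [InfPath.HasPrefix, h2, ht] at h3
      exact (InfPath.startsWith_append.1 h3).1
    obtain ⟨y, hy, rfl⟩ := 𝒥.exists_shift_eq η.1.1 h1
    refine ⟨y, hy, ?_⟩
    have h0 : (𝒥.dualMap y).seq 0 = 𝒥.vertexEdge (𝒥.code y) := rfl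
    rw [List.length_cons, InfPath.take_succ, dualMap_drop_one, hz', h0, hy]
    rfl

theorem leftSynchronizing_of_injective (hE : ∀ v, ∃ e, E.src e = v)
    (hnn : 𝒥.OnlyNonnegativeEdges) (h : Function.Injective 𝒥.dualMap) : 𝒥.LeftSynchronizing := by
  choose n hn using fun a : 𝒥.J =>
    𝒥.exists_startsWith_of_agree_dualMap h a.1.1.source a.1.1.edges
  -- The sum bounds each n a. The label has one letter more than the path has edges, and that letter
  -- secures the common source required by `Agree`.
  refine ⟨∑ a, n a, fun ω₁ ω₂ h₁ h₂ hω => ?_⟩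
  obtain ⟨y, hy, hy'⟩ := 𝒥.exists_code_eq_of_isWalk hE hnn ω₁.isWalk
  obtain ⟨z, hz, hz'⟩ := 𝒥.exists_code_eq_of_isWalk hE hnn ω₂.isWalk
  have h1 : ω₁.edges.length = ∑ a, n a := h₁
  have h2 : ω₂.edges.length = ∑ a, n a := h₂
  rw [h1] at hy'
  rw [h2] at hz'
  have h3 := InfPath.agree_of_take_succ ((hy'.trans hω).trans hz'.symm)
  have h4 := hn ω₁.source y z (h3.mono (Finset.single_le_sum (fun _ _ => Nat.zero_le _)
    (Finset.mem_univ _))) (𝒥.code_eq_iff.1 hy)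
  rw [← hz, 𝒥.code_eq h4]

end PolynomialUnitary

end DirectedGraph

theorem mainTheorem1 {V A : Type*} [Fintype V] [Fintype A] (E : DirectedGraph V A)
    (hE : E.IsAdmissible) (𝒥 : E.PolynomialUnitary) :
    (𝒥.HasNonpositiveCycle → ¬ 𝒥.LeavittRestrictsToAut ∧ ¬ 𝒥.CStarRestrictsToAut) ∧
    (𝒥.OnlyNonnegativeEdges → ¬ 𝒥.HasNonpositiveCycle →
      (𝒥.LeftSynchronizing ↔ 𝒥.LeavittRestrictsToAut) ∧
      (𝒥.LeftSynchronizing ↔ 𝒥.CStarRestrictsToAut)) := by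
  rw [𝒥.leavittRestrictsToAut_iff hE.no_sinks, 𝒥.cstarRestrictsToAut_iff hE.no_sinks]
  refine ⟨fun h => ?_, fun hnn hc => ?_⟩
  · have := 𝒥.not_injective_of_hasNonpositiveCycle hE h
    exact ⟨this, this⟩
  · have : 𝒥.LeftSynchronizing ↔ Function.Injective 𝒥.dualMap :=
      ⟨𝒥.injective_of_leftSynchronizing hE.no_sinks hnn hc,
        𝒥.leftSynchronizing_of_injective hE.no_sinks hnn⟩
    exact ⟨this, this⟩
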